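/- Let $X$ be a smooth edge manifold: a smooth manifold-with-boundary (Hausdorff and second countable) whose boundary is the total space of a smooth (locally trivial) fibration $\pi:\partial X\to Y$ with fibre $F$. Let $V=\ker\pi_*\subset T\partial X$. An edge vector field is a smooth vector field on $X$ whose restriction to $\partial X$ is a section of $V$; the edge tangent bundle ${}^eTX$ is the vector bundle whose smooth sections are the edge vector fields, with evaluation map $\operatorname{Eval}:{}^eTX\to TX$ (an isomorphism over the interior, with image $V$ over $\partial X$), and $H=\ker\operatorname{Eval}|_{\partial X}\subset{}^eTX|_{\partial X}$. An edge metric is a smooth nondegenerate section $g$ of $S^2({}^eT^*X)$, of arbitrary signature; it is horizontally nondegenerate if $g|_{H_p}$ is nondegenerate for all $p\in\partial X$. In that case $\operatorname{Eval}(g^{-1})|_{\partial X}$ is a metric on $V^*$, and $g_F$ denotes the dual metric on $V$. A defining function is a smooth function $x$ with $x>0$ in the interior, and $x=0$, $dx\neq0$ on $\partial X$ (a defining function on an open neighbourhood of $\partial X$ is defined likewise). Then $\frac{dx}{x}$ is a smooth section of ${}^eT^*X$ up to the boundary. Let $X_x$ be its $g$-dual edge vector field, and let $\alpha_x$ be the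 section of $V^*$ that is $g_F$-dual to $\operatorname{Eval}(X_x)|_{\partial X}$. The metric $g$ is called normalized if it is horizontally nondegenerate and $\big|\frac{dx}{x}\big|_H\big|^2_{g|_H}=1$ on $\partial X$ (this does not depend on $x$). It is called exact if it is horizontally nondegenerate and for each defining function $x$ there is $f\in C^\infty(\partial X)$ with $\alpha_x=df|_V$. If $g$ is exact, $x$ is called $g$-related if $\alpha_x=0$. Let $g$ be an exact, normalized edge metric on $X$ and let $x_0$ be a $g$-related defining function. Then there are an open neighbourhood $U$ of $\partial X$ and a $g$-related smooth defining function $\widehat x$ on $U$ such that $$\Big|\frac{d\widehat x}{\widehat x}\Big|_g^2=1\ \text{ on } U,\qquad \widehat x=x_0+O(x_0^2)\ \text{ near each point of }\partial X .$$ It is uniquely determined near $\partial X$ by these two conditions: if $\widehat x'$ is a defining function on an open neighbourhood $U'$ of $\partial X$ with $\big|\frac{d\widehat x'}{\widehat x'}\big|_g^2=1$ on $U'$ and $\widehat x'=x_0+O(x_0^2)$ near each point of $\partial X$, then $\widehat x'=\widehat x$ on some neighbourhood of $\partial X$. -/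

import Mathlib

open Set Filter Topology Manifold
open scoped ContDiff Asymptotics

noncomputable section

/-- A manifold-with-boundary `X` of dimension `m + 1` together with its boundary, presented as a
manifold `B` of dimension `m` smoothly embedded with image `∂X`, and a smooth fibration
`proj : B → Y` with fibre `F` (a locally trivial smooth fibre bundle). -/
structure EdgeManifold (m b f : ℕ) (X B Y F : Type*)
    [TopologicalSpace X] [ChartedSpace (EuclideanHalfSpace (m + 1)) X]
    [TopologicalSpace B] [ChartedSpace (EuclideanSpace ℝ (Fin m)) B]
    [TopologicalSpace Y] [ChartedSpace (EuclideanSpace ℝ (Fin b)) Y]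
    [TopologicalSpace F] [ChartedSpace (EuclideanSpace ℝ (Fin f)) F] where
  /-- the inclusion of the boundary -/
  incl : B → X
  isSmoothEmbedding_incl : IsSmoothEmbedding (𝓡 m) (𝓡∂ (m + 1)) ∞ incl
  range_incl : range incl = (𝓡∂ (m + 1)).boundary X
  /-- the fibration of the boundary -/
  proj : B → Y
  contMDiff_proj : ContMDiff (𝓡 m) (𝓡 b) ∞ proj
  locally_trivial : ∀ y : Y, ∃ e : Bundle.Trivialization F proj, y ∈ e.baseSet ∧
    ContMDiffOn (𝓡 m) ((𝓡 b).prod (𝓡 f)) ∞ e e.source ∧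
    ContMDiffOn ((𝓡 b).prod (𝓡 f)) (𝓡 m) ∞ e.toOpenPartialHomeomorph.symm e.target

namespace EdgeManifold

variable {m b f : ℕ} {X B Y F : Type*}
  [TopologicalSpace X] [ChartedSpace (EuclideanHalfSpace (m + 1)) X]
  [IsManifold (𝓡∂ (m + 1)) ∞ X]
  [TopologicalSpace B] [ChartedSpace (EuclideanSpace ℝ (Fin m)) B]
  [TopologicalSpace Y] [ChartedSpace (EuclideanSpace ℝ (Fin b)) Y]
  [TopologicalSpace F] [ChartedSpace (EuclideanSpace ℝ (Fin f)) F]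
  (S : EdgeManifold m b f X B Y F)

/-- The vertical space `V = ker π_* ⊂ T∂X ⊂ TX` at a boundary point. -/
def vertical (q : B) : Submodule ℝ (TangentSpace (𝓡∂ (m + 1)) (S.incl q)) :=
  (LinearMap.ker (mfderiv (𝓡 m) (𝓡 b) S.proj q).toLinearMap).map
    (mfderiv (𝓡 m) (𝓡∂ (m + 1)) S.incl q).toLinearMap

/-- The edge vector fields: smooth vector fields on `X` whose restriction to the boundary is
tangent to the fibres. -/
def edgeFields :
    Submodule ℝ (Cₛ^∞⟮𝓡∂ (m + 1); EuclideanSpace ℝ (Fin (m + 1)),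
      (TangentSpace (𝓡∂ (m + 1)) : X → Type _)⟯) where
  carrier := {ξ | ∀ q : B, ξ (S.incl q) ∈ S.vertical q}
  add_mem' hξ hη q := by
    simpa using (S.vertical q).add_mem (hξ q) (hη q)
  zero_mem' q := by simp
  smul_mem' c ξ hξ q := by
    simpa using (S.vertical q).smul_mem c (hξ q)

/-- The subspace `I_p · 𝓥`, where `𝓥` is the module of edge vector fields and `I_p` the ideal of
smooth functions vanishing at `p`. -/
def vanishing (p : X) : Submodule ℝ S.edgeFields :=
  Submodule.span ℝ {ζ | ∃ h : X → ℝ, ContMDiff (𝓡∂ (m + 1)) 𝓘(ℝ, ℝ) ∞ h ∧ h p = 0 ∧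
    ∃ η : S.edgeFields, ∀ r : X, ζ.1 r = h r • η.1 r}

/-- The fibre at `p` of the edge tangent bundle, i.e. of the vector bundle whose smooth sections
are the edge vector fields: `𝓥 / I_p 𝓥`. -/
abbrev Tangent (p : X) : Type _ := S.edgeFields ⧸ S.vanishing p

/-- The value at `p`, in the edge tangent bundle, of an edge vector field. -/
def val (p : X) : S.edgeFields →ₗ[ℝ] S.Tangent p := (S.vanishing p).mkQ

/-- The value at `p`, in the ordinary tangent bundle, of an edge vector field. -/
def fieldEval (p : X) : S.edgeFields →ₗ[ℝ] TangentSpace (𝓡∂ (m + 1)) p where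
  toFun ξ := ξ.1 p
  map_add' ξ η := by simp
  map_smul' c ξ := by simp

theorem vanishing_le_ker_fieldEval (p : X) :
    S.vanishing p ≤ LinearMap.ker (S.fieldEval p) := by
  refine Submodule.span_le.2 ?_
  rintro ζ ⟨h, -, hp, η, hη⟩
  simp [fieldEval, hη, hp]

/-- The evaluation map from the edge tangent bundle to the tangent bundle. -/
def eval (p : X) : S.Tangent p →ₗ[ℝ] TangentSpace (𝓡∂ (m + 1)) p :=
  (S.vanishing p).liftQ (S.fieldEval p) (S.vanishing_le_ker_fieldEval p)

theorem eval_mem_vertical (q : B) (v : S.Tangent (S.incl q)) :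
    S.eval (S.incl q) v ∈ S.vertical q := by
  obtain ⟨ξ, rfl⟩ := Submodule.Quotient.mk_surjective _ v
  exact ξ.2 q

/-- At a boundary point the evaluation map takes values in the vertical space. -/
def evalVertical (q : B) : S.Tangent (S.incl q) →ₗ[ℝ] S.vertical q :=
  (S.eval (S.incl q)).codRestrict (S.vertical q) (S.eval_mem_vertical q)

/-- The horizontal space `H = ker Eval` at a boundary point. -/
def horizontal (q : B) : Submodule ℝ (S.Tangent (S.incl q)) :=
  LinearMap.ker (S.eval (S.incl q))

variable (m X) in
/-- `x` is a smooth defining function for the boundary on the open set `U`: it is positive on the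
interior, and it vanishes with nonzero differential at the boundary. The values of `x` outside `U`
are irrelevant. -/
structure IsDefiningOn (U : Set X) (x : X → ℝ) : Prop where
  contMDiffOn : ContMDiffOn (𝓡∂ (m + 1)) 𝓘(ℝ, ℝ) ∞ x U
  pos : ∀ p ∈ U, p ∈ (𝓡∂ (m + 1)).interior X → 0 < x p
  eq_zero : ∀ p ∈ U, p ∈ (𝓡∂ (m + 1)).boundary X → x p = 0
  mfderiv_ne_zero : ∀ p ∈ U, p ∈ (𝓡∂ (m + 1)).boundary X →
    mfderiv (𝓡∂ (m + 1)) 𝓘(ℝ, ℝ) x p ≠ 0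

/-- The differential of a function `x : X → ℝ`, as a real number. -/
def dif (x : X → ℝ) (r : X) (v : TangentSpace (𝓡∂ (m + 1)) r) : ℝ :=
  mfderiv (𝓡∂ (m + 1)) 𝓘(ℝ, ℝ) x r v

/-- `θ` is the value at `p` of the section `dx / x` of the edge cotangent bundle: its pairing with
an edge vector field `ξ` is `dx(ξ) / x` in the interior, extended to the boundary by continuity. -/
def IsDlog (x : X → ℝ) (p : X) (θ : Module.Dual ℝ (S.Tangent p)) : Prop :=
  ∀ ξ : S.edgeFields,
    Tendsto (fun r : X => dif x r (ξ.1 r) / x r)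
      (𝓝[(𝓡∂ (m + 1)).interior X] p) (𝓝 (θ (S.val p ξ)))

/-- `v` is the vector dual to the covector `θ` with respect to `β`. -/
def IsSharp {W : Type*} [AddCommGroup W] [Module ℝ W] (β : LinearMap.BilinForm ℝ W)
    (θ : Module.Dual ℝ W) (v : W) : Prop :=
  ∀ w, β v w = θ w

/-- `c` is the length squared of the covector `θ` with respect to (the dual of) `β`. -/
def IsNormSq {W : Type*} [AddCommGroup W] [Module ℝ W] (β : LinearMap.BilinForm ℝ W)
    (θ : Module.Dual ℝ W) (c : ℝ) : Prop :=
  ∃ v, IsSharp β θ v ∧ θ v = c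

/-- An edge metric: a smooth nondegenerate section, of arbitrary signature, of the symmetric square
of the edge cotangent bundle. -/
structure Metric where
  form : ∀ p : X, LinearMap.BilinForm ℝ (S.Tangent p)
  isSymm : ∀ p, (form p).IsSymm
  nondegenerate : ∀ p, (form p).Nondegenerate
  contMDiff : ∀ ξ η : S.edgeFields,
    ContMDiff (𝓡∂ (m + 1)) 𝓘(ℝ, ℝ) ∞ (fun p => form p (S.val p ξ) (S.val p η))

namespace Metric

variable {S} (g : S.Metric)

/-- The restriction of `g` to the horizontal space is nondegenerate at every boundary point. -/
def HorizontallyNondegenerate : Prop :=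
  ∀ q : B, ((g.form (S.incl q)).restrict (S.horizontal q)).Nondegenerate

/-- `g` is horizontally nondegenerate and the length squared of `dx / x` restricted to `H`, which
does not depend on the defining function `x`, is `1` on the boundary. -/
def IsNormalized : Prop :=
  g.HorizontallyNondegenerate ∧
    ∀ x : X → ℝ, IsDefiningOn m X univ x → ∀ (q : B) (θ : Module.Dual ℝ (S.Tangent (S.incl q))),
      S.IsDlog x (S.incl q) θ →
        IsNormSq ((g.form (S.incl q)).restrict (S.horizontal q))
          (θ ∘ₗ (S.horizontal q).subtype) 1

/-- `α = g_F(u, ·)`, where `g_F` is the metric on `V` dual to the metric `Eval(g⁻¹)` on `V*`: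
the covector `α` is sent to `u` by `Eval(g⁻¹) : V* → V`, that is, pulling `α` back along the
evaluation map, raising the index with `g` and evaluating gives `u`. -/
def IsFiberFlat (q : B) (u : S.vertical q) (α : Module.Dual ℝ (S.vertical q)) : Prop :=
  ∃ v : S.Tangent (S.incl q),
    IsSharp (g.form (S.incl q)) (α ∘ₗ S.evalVertical q) v ∧ S.evalVertical q v = u

/-- `α` is the value at `q` of the form `α_x` on the boundary fibres: the `g_F`-dual of
`Eval(X_x)`, where `X_x` is the `g`-dual of `dx / x`. -/
def IsAlpha (x : X → ℝ) (q : B) (α : Module.Dual ℝ (S.vertical q)) : Prop :=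
  ∃ (θ : Module.Dual ℝ (S.Tangent (S.incl q))) (v : S.Tangent (S.incl q)),
    S.IsDlog x (S.incl q) θ ∧ IsSharp (g.form (S.incl q)) θ v ∧
      g.IsFiberFlat q (S.evalVertical q v) α

/-- `g` is horizontally nondegenerate and for each defining function `x` the form `α_x` is the
fibre differential `d_V φ` of a smooth function `φ` on the boundary. -/
def IsExact : Prop :=
  g.HorizontallyNondegenerate ∧
    ∀ x : X → ℝ, IsDefiningOn m X univ x →
      ∃ φ : B → ℝ, ContMDiff (𝓡 m) 𝓘(ℝ, ℝ) ∞ φ ∧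
        ∀ q : B, ∃ α : Module.Dual ℝ (S.vertical q), g.IsAlpha x q α ∧
          ∀ u ∈ LinearMap.ker (mfderiv (𝓡 m) (𝓡 b) S.proj q).toLinearMap,
            ∀ hu : mfderiv (𝓡 m) (𝓡∂ (m + 1)) S.incl q u ∈ S.vertical q,
              α ⟨mfderiv (𝓡 m) (𝓡∂ (m + 1)) S.incl q u, hu⟩ =
                (mfderiv (𝓡 m) 𝓘(ℝ, ℝ) φ q u : ℝ)

/-- The defining function `x` is `g`-related: `α_x = 0`. -/
def IsRelated (x : X → ℝ) : Prop := ∀ q : B, g.IsAlpha x q 0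

/-- The eikonal equation `|dx / x|²_g = 1` on `U`. -/
def SolvesEikonalOn (U : Set X) (x : X → ℝ) : Prop :=
  ∀ p ∈ U, ∃ θ : Module.Dual ℝ (S.Tangent p), S.IsDlog x p θ ∧ IsNormSq (g.form p) θ 1

end Metric

end EdgeManifold

end

/-!
Write the sought defining function as `x̂ = x₀ e^ω`. Then `dx̂/x̂ = dx₀/x₀ + dω`, and the condition
`x̂ = x₀ + O(x₀²)` says that `ω` vanishes on the boundary, so `ω = x u` for a boundary coordinate `x`.
In a local frame of the edge tangent bundle (`EdgeManifold.IsEdgeFrame`) the anchor to the ordinary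
tangent bundle is `x ∂ₓ` in the normal direction, the identity on the vertical directions and
multiplication by `x` on complementary ones (`edgeAnchor`); hence the eikonal equation for `ω` reads
`|θ + x (σ τ + K η)|² = 1`, where `dω = σ dx + x η`, `θ = dx₀/x₀`, `τ = dx/x`, and `K` is dual to the
anchor.

Three facts at the boundary make this equation tractable (`EdgeManifold.IsEdgeFrame.isEikonalData`).
As `x₀` is related, the vector dual to `θ` is horizontal, so it pairs to zero with every `K η`; as
the metric is normalized, `|θ|² = 1`; and so `⟨θ, τ⟩ = 1`. The equation is therefore divisible by
`x`, and after division it can be solved for the normal derivative: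
`σ = ∂ₓ(x u) = F(x, q, η, σ)`, a first-order equation for `x u` which is noncharacteristic at `x = 0`,
although its data are only defined for `x ≥ 0`. It is solved by characteristics. The characteristic
curves, rescaled to a fixed time interval, are fixed points of an integral operator on a space of
curves that depends smoothly on the parameters (`exists_fixedPoint_contDiffOn`, which rests on the
smoothness of composition operators on spaces of continuous curves); they sweep out a half ball, and
the contact form is transported by the flow and so vanishes (`contactForm_eq_zero`), which is the
equation (`exists_solution_hamiltonJacobi`, `exists_solution_singular`). For uniqueness, the
difference of two solutions solves a linear transport equation with bounded coefficients and zero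
initial values (`eq_zero_of_transport`).

The passage between the manifold and the half balls rests on Hadamard's lemma at the boundary
(`exists_eq_smul_of_eq_zero`). With it a field which is vertical on the boundary has smooth
coefficients in the edge frame, a defining function is `x k` with `k > 0` smooth, and defining
functions agreeing to second order differ by a factor `e^{x u}`. The vertical spaces are brought to
the kernels of a smooth family of projections by means of a local retraction onto the boundary.
The local solutions have equal germs at common boundary points, by uniqueness
(`EdgeManifold.IsLocalSolution.eventuallyEq`), so they glue along the closed set `∂X` to one
function (`exists_glue_germs`). The vectors dual to `dx̂/x̂` and `dx₀/x₀` agree on the boundary, so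
`x̂` is related as well.
-/

noncomputable section

set_option linter.unusedSectionVars false

/-! ### Composition operators on spaces of continuous maps -/

section Superposition

universe u

variable {K : Type*} [TopologicalSpace K]
  {G H : Type u} [NormedAddCommGroup G] [NormedSpace ℝ G] [NormedAddCommGroup H] [NormedSpace ℝ H]

open Classical in
/-- The composition (Nemytskii) operator `γ ↦ φ ∘ γ` on continuous maps, with the value `0` where
`φ ∘ γ` fails to be continuous. -/
def superpos (φ : G → H) (γ : C(K, G)) : C(K, H) :=
  if h : Continuous (fun k => φ (γ k)) then ⟨fun k => φ (γ k), h⟩ else 0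

theorem superpos_apply {φ : G → H} {T : Set G} (hφ : ContinuousOn φ T) {γ : C(K, G)}
    (hγ : ∀ k, γ k ∈ T) (k : K) : superpos φ γ k = φ (γ k) := by
  have h : Continuous (fun k => φ (γ k)) := hφ.comp_continuous γ.continuous hγ
  simp [superpos, h]

variable [CompactSpace K]

variable (K G H) in
/-- Pointwise application of a continuous family of continuous linear maps to a continuous map, as
a continuous bilinear map. -/
def curveApply : C(K, G →L[ℝ] H) →L[ℝ] C(K, G) →L[ℝ] C(K, H) :=
  LinearMap.mkContinuous₂
    (LinearMap.mk₂ ℝ (fun (A : C(K, G →L[ℝ] H)) (γ : C(K, G)) => (⟨fun k => A k (γ k), by fun_prop⟩ : C(K, H)))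
      (fun A A' γ => by ext; simp) (fun c A γ => by ext; simp)
      (fun A γ γ' => by ext; simp) (fun c A γ => by ext; simp)) 1
    (fun A γ => by
      refine (ContinuousMap.norm_le _
        (mul_nonneg (mul_nonneg zero_le_one (norm_nonneg A)) (norm_nonneg γ))).2 fun k => ?_
      simp only [LinearMap.mk₂_apply, ContinuousMap.coe_mk, one_mul]
      exact ((A k).le_opNorm _).trans
        (mul_le_mul (A.norm_coe_le_norm k) (γ.norm_coe_le_norm k) (norm_nonneg _) (norm_nonneg _)))

@[simp]
theorem curveApply_apply (A : C(K, G →L[ℝ] H)) (γ : C(K, G)) (k : K) :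
    curveApply K G H A γ k = A k (γ k) := rfl

theorem convex_curves {T : Set G} (hT : Convex ℝ T) : Convex ℝ {γ : C(K, G) | ∀ k, γ k ∈ T} :=
  fun γ hγ δ hδ a b ha hb hab k => by
    simpa using hT (hγ k) (hδ k) ha hb hab

theorem uniqueDiffOn_curves {T : Set G} (hT : Convex ℝ T) (hTi : (interior T).Nonempty) :
    UniqueDiffOn ℝ {γ : C(K, G) | ∀ k, γ k ∈ T} := by
  refine uniqueDiffOn_convex (convex_curves hT) ?_
  obtain ⟨c, hc⟩ := hTi
  obtain ⟨ε, hε, hb⟩ := Metric.isOpen_iff.1 isOpen_interior c hc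
  refine ⟨ContinuousMap.const K c, mem_interior.2 ⟨Metric.ball _ ε, ?_, Metric.isOpen_ball,
    Metric.mem_ball_self hε⟩⟩
  intro γ hγ k
  refine interior_subset (hb ?_)
  rw [Metric.mem_ball] at hγ ⊢
  exact (ContinuousMap.dist_apply_le_dist k).trans_lt hγ

theorem exists_uniform_of_continuousOn {T : Set G} {φ : G → H} (hφ : ContinuousOn φ T)
    {γ : C(K, G)} (hγ : ∀ k, γ k ∈ T) {ε : ℝ} (hε : 0 < ε) :
    ∃ δ > 0, ∀ k, ∀ z ∈ T, dist z (γ k) < δ → dist (φ z) (φ (γ k)) < ε := by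
  let γ' : K → T := fun k => ⟨γ k, hγ k⟩
  have hγ' : Continuous γ' := γ.continuous.subtype_mk _
  have hc : Continuous (T.domRestrict φ) := continuousOn_iff_continuous_domRestrict.1 hφ
  have := (isCompact_range hγ').uniformContinuousAt_of_continuousAt (T.domRestrict φ)
    (fun x _ => hc.continuousAt) (Metric.dist_mem_uniformity hε)
  obtain ⟨δ, hδ, h⟩ := Metric.mem_uniformity_dist.1 this
  refine ⟨δ, hδ, fun k z hz hd => ?_⟩
  have := @h (γ' k) ⟨z, hz⟩ (by rw [dist_comm]; exact hd) (mem_range_self k)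
  rw [dist_comm]
  exact this

theorem continuousOn_superpos {T : Set G} {φ : G → H} (hφ : ContinuousOn φ T) :
    ContinuousOn (superpos φ) {γ : C(K, G) | ∀ k, γ k ∈ T} := by
  intro γ hγ
  rw [Metric.continuousWithinAt_iff]
  intro ε hε
  obtain ⟨δ, hδ, h⟩ := exists_uniform_of_continuousOn hφ hγ (half_pos hε)
  refine ⟨δ, hδ, fun γ' hγ' hd => lt_of_le_of_lt ?_ (half_lt_self hε)⟩
  refine (ContinuousMap.dist_le (half_pos hε).le).2 fun k => ?_
  rw [superpos_apply hφ hγ, superpos_apply hφ hγ']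
  exact (h k _ (hγ' k) ((ContinuousMap.dist_apply_le_dist k).trans_lt hd)).le

theorem hasFDerivWithinAt_superpos {T : Set G} (hT : Convex ℝ T) {φ : G → H} {φ' : G → G →L[ℝ] H}
    (hφ : ∀ x ∈ T, HasFDerivWithinAt φ (φ' x) T x) (hφ' : ContinuousOn φ' T) {γ : C(K, G)}
    (hγ : ∀ k, γ k ∈ T) :
    HasFDerivWithinAt (superpos φ) (curveApply K G H (superpos φ' γ))
      {γ : C(K, G) | ∀ k, γ k ∈ T} γ := by
  have hc : ContinuousOn φ T := fun x hx => (hφ x hx).continuousWithinAt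
  rw [hasFDerivWithinAt_iff_isLittleO, Asymptotics.isLittleO_iff]
  intro ε hε
  obtain ⟨δ, hδ, h⟩ := exists_uniform_of_continuousOn hφ' hγ hε
  filter_upwards [self_mem_nhdsWithin, mem_nhdsWithin_of_mem_nhds (Metric.ball_mem_nhds γ hδ)]
    with γ' hγ' hd
  refine (ContinuousMap.norm_le _ (by positivity)).2 fun k => ?_
  simp only [ContinuousMap.sub_apply, curveApply_apply, superpos_apply hc hγ, superpos_apply hc hγ',
    superpos_apply hφ' hγ]
  have hk : dist (γ' k) (γ k) < δ := (ContinuousMap.dist_apply_le_dist k).trans_lt hd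
  have key := (hT.inter (convex_ball (γ k) δ)).norm_image_sub_le_of_norm_hasFDerivWithin_le'
    (f := φ) (f' := φ') (φ := φ' (γ k)) (C := ε) (x := γ k) (y := γ' k)
    (fun x hx => (hφ x hx.1).mono inter_subset_left)
    (fun x hx => by rw [← dist_eq_norm]; exact (h k x hx.1 hx.2).le)
    ⟨hγ k, Metric.mem_ball_self hδ⟩ ⟨hγ' k, hk⟩
  refine key.trans (mul_le_mul_of_nonneg_left ?_ hε.le)
  exact (γ' - γ).norm_coe_le_norm k

/-- The composition operator of a smooth map is smooth. As `φ` is smooth on a convex set with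
interior only, and not on a neighbourhood of it, this applies at the boundary of a half space. -/
theorem contDiffOn_superpos {T : Set G} (hT : Convex ℝ T) (hTi : (interior T).Nonempty)
    {φ : G → H} (hφ : ContDiffOn ℝ ∞ φ T) :
    ContDiffOn ℝ ∞ (superpos φ) {γ : C(K, G) | ∀ k, γ k ∈ T} := by
  have hu : UniqueDiffOn ℝ T := uniqueDiffOn_convex hT hTi
  have hU := uniqueDiffOn_curves (K := K) hT hTi
  rw [contDiffOn_infty] at hφ ⊢
  intro n
  replace hφ := hφ n
  induction n generalizing H with
  | zero => simpa using continuousOn_superpos (by simpa using hφ)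
  | succ n ih =>
    rw [Nat.cast_succ] at hφ ⊢
    obtain ⟨hd, -, h'⟩ := (contDiffOn_succ_iff_fderivWithin hu).1 hφ
    have hD : ∀ γ ∈ {γ : C(K, G) | ∀ k, γ k ∈ T}, HasFDerivWithinAt (superpos φ) _ _ γ :=
      fun γ hγ => hasFDerivWithinAt_superpos hT (fun x hx => (hd x hx).hasFDerivWithinAt)
        h'.continuousOn hγ
    refine (contDiffOn_succ_iff_fderivWithin hU).2
      ⟨fun γ hγ => (hD γ hγ).differentiableWithinAt, by simp, ?_⟩
    refine ((curveApply K G H).contDiff.comp_contDiffOn (ih h')).congr fun γ hγ => ?_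
    exact (hD γ hγ).fderivWithin (hU γ hγ)

end Superposition

/-! ### Integral operators on curves and division by the boundary coordinate -/

section Curves

universe u

variable {E W : Type u} [NormedAddCommGroup E] [NormedSpace ℝ E] [NormedAddCommGroup W]
  [NormedSpace ℝ W]

/-- The values of a curve on the unit interval, continued by constants to the line. -/
def curveExt (γ : C(unitInterval, W)) (s : ℝ) : W := γ (projIcc 0 1 zero_le_one s)

@[fun_prop]
theorem continuous_curveExt (γ : C(unitInterval, W)) : Continuous (curveExt γ) :=
  γ.continuous.comp continuous_projIcc

theorem curveExt_of_mem (γ : C(unitInterval, W)) {s : ℝ} (hs : s ∈ Icc (0 : ℝ) 1) :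
    curveExt γ s = γ ⟨s, hs⟩ := by
  rw [curveExt, projIcc_of_mem]

theorem norm_curveExt_le (γ : C(unitInterval, W)) (s : ℝ) : ‖curveExt γ s‖ ≤ ‖γ‖ :=
  γ.norm_coe_le_norm _

variable (W) in
/-- The primitive `s ↦ ∫₀ˢ γ` of a curve. -/
def curvePrim : C(unitInterval, W) →L[ℝ] C(unitInterval, W) :=
  LinearMap.mkContinuous
    { toFun := fun γ => ⟨fun s => ∫ t in (0 : ℝ)..s, curveExt γ t,
        (intervalIntegral.continuous_primitive
          (fun a b => (continuous_curveExt γ).intervalIntegrable a b) 0).comp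
          continuous_subtype_val⟩
      map_add' := fun γ δ => by
        ext s
        exact intervalIntegral.integral_add ((continuous_curveExt γ).intervalIntegrable _ _)
          ((continuous_curveExt δ).intervalIntegrable _ _)
      map_smul' := fun c γ => by
        ext s
        exact intervalIntegral.integral_smul c _ } 1
    (fun γ => by
      rw [one_mul]
      refine (ContinuousMap.norm_le _ (norm_nonneg γ)).2 fun s => ?_
      refine (intervalIntegral.norm_integral_le_of_norm_le_const
        (fun t _ => norm_curveExt_le γ t)).trans ?_
      rw [sub_zero, abs_of_nonneg s.2.1]
      exact mul_le_of_le_one_right (norm_nonneg _) s.2.2)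

theorem curvePrim_apply (γ : C(unitInterval, W)) (s : unitInterval) :
    curvePrim W γ s = ∫ t in (0 : ℝ)..s, curveExt γ t := rfl

theorem hasDerivAt_curvePrim [CompleteSpace W] (γ : C(unitInterval, W)) {s : ℝ}
    (hs : s ∈ Ioo (0 : ℝ) 1) : HasDerivAt (curveExt (curvePrim W γ)) (curveExt γ s) s := by
  have h1 := ((continuous_curveExt γ).integral_hasStrictDerivAt 0 s).hasDerivAt
  refine h1.congr_of_eventuallyEq ?_
  filter_upwards [Icc_mem_nhds hs.1 hs.2] with t ht
  rw [curveExt_of_mem _ ht, curvePrim_apply]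

variable (W) in
/-- The mean `s ↦ ∫₀¹ γ(s t) dt` of a curve over the intervals `[0, s]`. -/
def curveMean : C(unitInterval, W) →L[ℝ] C(unitInterval, W) :=
  LinearMap.mkContinuous
    { toFun := fun γ => ⟨fun s => ∫ t in (0 : ℝ)..1, curveExt γ (s * t),
        intervalIntegral.continuous_parametric_intervalIntegral_of_continuous' (by fun_prop) 0 1⟩
      map_add' := fun γ δ => by
        ext s
        exact intervalIntegral.integral_add (Continuous.intervalIntegrable (by fun_prop) _ _)
          (Continuous.intervalIntegrable (by fun_prop) _ _)
      map_smul' := fun c γ => by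
        ext s
        exact intervalIntegral.integral_smul c _ } 1
    (fun γ => by
      rw [one_mul]
      refine (ContinuousMap.norm_le _ (norm_nonneg γ)).2 fun s => ?_
      exact (intervalIntegral.norm_integral_le_of_norm_le_const (C := ‖γ‖)
        (fun t _ => norm_curveExt_le γ _)).trans (by simp))

theorem smul_curveMean (γ : C(unitInterval, W)) (s : unitInterval) :
    (s : ℝ) • curveMean W γ s = curvePrim W γ s := by
  have := intervalIntegral.smul_integral_comp_mul_left (a := (0 : ℝ)) (b := 1)
    (fun t => curveExt γ t) (s : ℝ)
  rw [mul_zero, mul_one] at this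
  exact this

/-- The half ball of radius `r` at the boundary point `(0, q)` of the half space `x ≥ 0`. -/
def halfBall (q : E) (r : ℝ) : Set (ℝ × E) := Ico 0 r ×ˢ Metric.ball q r

theorem convex_halfBall (q : E) (r : ℝ) : Convex ℝ (halfBall q r) :=
  (convex_Ico 0 r).prod (convex_ball q r)

theorem interior_halfBall (q : E) (r : ℝ) :
    interior (halfBall q r) = Ioo 0 r ×ˢ Metric.ball q r := by
  rw [halfBall, interior_prod_eq, interior_Ico, Metric.isOpen_ball.interior_eq]

theorem interior_halfBall_nonempty (q : E) {r : ℝ} (hr : 0 < r) :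
    (interior (halfBall q r)).Nonempty := by
  rw [interior_halfBall]
  exact (nonempty_Ioo.2 hr).prod ⟨q, Metric.mem_ball_self hr⟩

theorem uniqueDiffOn_halfBall (q : E) {r : ℝ} (hr : 0 < r) : UniqueDiffOn ℝ (halfBall q r) :=
  uniqueDiffOn_convex (convex_halfBall q r) (interior_halfBall_nonempty q hr)

theorem halfBall_mem_nhds {q : E} {r : ℝ} {p : ℝ × E} (hp : p ∈ halfBall q r) (h0 : 0 < p.1) :
    halfBall q r ∈ 𝓝 p := by
  rw [← mem_interior_iff_mem_nhds, interior_halfBall]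
  exact ⟨⟨h0, hp.1.2⟩, hp.2⟩

theorem halfBall_mono {q : E} {r r' : ℝ} (h : r ≤ r') : halfBall q r ⊆ halfBall q r' :=
  prod_mono (Ico_subset_Ico_right h) (Metric.ball_subset_ball h)

/-- Half balls form a basis of neighbourhoods of a boundary point in the half space. -/
theorem exists_halfBall_subset {q : E} {N : Set (ℝ × E)} (hN : N ∈ 𝓝[{p | 0 ≤ p.1}] (0, q)) :
    ∃ r > 0, halfBall q r ⊆ N := by
  obtain ⟨r, hr, h⟩ := Metric.mem_nhdsWithin_iff.1 hN
  refine ⟨r, hr, fun p hp => h ⟨?_, hp.1.1⟩⟩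
  rw [Metric.mem_ball, Prod.dist_eq, max_lt_iff]
  exact ⟨by simpa [abs_of_nonneg hp.1.1] using hp.1.2, hp.2⟩

variable (E) in
/-- The segment from the boundary point `(0, q)` to `(x, q)`, as a linear function of `(x, q)`. -/
def verticalSegment : ℝ × E →L[ℝ] C(unitInterval, ℝ × E) :=
  LinearMap.mkContinuous
    { toFun := fun p => ⟨fun s => (s * p.1, p.2), by fun_prop⟩
      map_add' := fun p p' => by ext s <;> simp [mul_add]
      map_smul' := fun c p => by ext s <;> simp [mul_left_comm] } 1
    (fun p => by
      rw [one_mul]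
      refine (ContinuousMap.norm_le _ (norm_nonneg p)).2 fun s => ?_
      refine max_le ?_ (norm_snd_le p)
      simp only [LinearMap.coe_mk, AddHom.coe_mk, ContinuousMap.coe_mk, norm_mul]
      rw [Real.norm_of_nonneg s.2.1]
      exact (mul_le_of_le_one_left (norm_nonneg _) s.2.2).trans (norm_fst_le p))

/-- A smooth function on a half ball that vanishes on the boundary is the product of the boundary
coordinate and a smooth function. -/
theorem exists_eq_smul_of_eq_zero [CompleteSpace W] {q₀ : E} {r : ℝ} (hr : 0 < r)
    {f : ℝ × E → W} (hf : ContDiffOn ℝ ∞ f (halfBall q₀ r))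
    (h0 : ∀ q ∈ Metric.ball q₀ r, f (0, q) = 0) :
    ∃ h : ℝ × E → W, ContDiffOn ℝ ∞ h (halfBall q₀ r) ∧ ∀ p ∈ halfBall q₀ r, f p = p.1 • h p := by
  have hu := uniqueDiffOn_halfBall q₀ hr
  set T := halfBall q₀ r with hT
  set φ : ℝ × E → W := fun z => fderivWithin ℝ f T z (1, 0) with hφ
  have hφs : ContDiffOn ℝ ∞ φ T :=
    (hf.fderivWithin hu (by simp)).clm_apply contDiffOn_const
  have hmem : ∀ p ∈ T, ∀ s : unitInterval, verticalSegment E p s ∈ T := fun p hp s =>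
    ⟨⟨mul_nonneg s.2.1 hp.1.1, (mul_le_of_le_one_left hp.1.1 s.2.2).trans_lt hp.1.2⟩, hp.2⟩
  refine ⟨fun p => curvePrim W (superpos φ (verticalSegment E p)) 1, ?_, fun p hp => ?_⟩
  · have h1 := contDiffOn_superpos (K := unitInterval) (convex_halfBall q₀ r)
      (interior_halfBall_nonempty q₀ hr) hφs
    have h2 := h1.comp (verticalSegment E).contDiff.contDiffOn hmem
    exact ((ContinuousMap.evalCLM ℝ (1 : unitInterval)).comp (curvePrim W)).contDiff.comp_contDiffOn
      h2
  · rcases hp.1.1.eq_or_lt with h | h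
    · rw [show p = (0, p.2) from Prod.ext h.symm rfl, h0 _ hp.2]
      simp
    have hd : ∀ s ∈ Ioo (0 : ℝ) 1, HasDerivAt (fun s => f (s * p.1, p.2))
        (p.1 • curveExt (superpos φ (verticalSegment E p)) s) s := by
      intro s hs
      have hs' : s ∈ Icc (0 : ℝ) 1 := Ioo_subset_Icc_self hs
      have hz := hmem p hp ⟨s, hs'⟩
      rw [curveExt_of_mem _ hs', superpos_apply hφs.continuousOn (hmem p hp)]
      have hn : T ∈ 𝓝 (s * p.1, p.2) := halfBall_mem_nhds hz (mul_pos hs.1 h)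
      have hfd := ((hf.differentiableOn (by simp)) _ hz).hasFDerivWithinAt.hasFDerivAt hn
      have hl : HasDerivAt (fun s : ℝ => (s * p.1, p.2)) (p.1, (0 : E)) s :=
        (hasDerivAt_mul_const p.1).prodMk (hasDerivAt_const s p.2)
      have := hfd.comp_hasDerivAt s hl
      have h1 : fderivWithin ℝ f T (verticalSegment E p ⟨s, hs'⟩) (p.1, 0) =
          p.1 • φ (verticalSegment E p ⟨s, hs'⟩) := by
        rw [show φ _ = fderivWithin ℝ f T _ (1, 0) from rfl, ← map_smul]
        simp
      rwa [h1] at this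
    have := intervalIntegral.integral_eq_sub_of_hasDerivAt_of_le zero_le_one
      (f := fun s => f (s * p.1, p.2)) (hf.continuousOn.comp (by fun_prop)
        (fun s hs => hmem p hp ⟨s, hs⟩)) hd (Continuous.intervalIntegrable (by fun_prop) _ _)
    simp only [zero_mul, one_mul, h0 _ hp.2, sub_zero, intervalIntegral.integral_smul] at this
    exact this.symm

end Curves

/-! ### Smooth dependence of fixed points on parameters in a convex set -/

section FixedPoint

variable {P E : Type*} [NormedAddCommGroup P] [NormedSpace ℝ P] [NormedAddCommGroup E]
  [NormedSpace ℝ E]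

/-- Differentiability of a continuous family of fixed points, one-sided in the parameter. -/
theorem hasFDerivWithinAt_fixedPoint {S : Set P} {R : Set (P × E)} {Φ : P × E → E} {e : P → E}
    {p : P} {L : P × E →L[ℝ] E} (hp : p ∈ S) (hL : HasFDerivWithinAt Φ L R (p, e p))
    (hR : ∀ p' ∈ S, (p', e p') ∈ R) (hfix : ∀ p' ∈ S, Φ (p', e p') = e p')
    (he : ContinuousWithinAt e S p) {T : E →L[ℝ] E}
    (hT : T.comp (.id ℝ E - L.comp (.inr ℝ P E)) = .id ℝ E) :
    HasFDerivWithinAt e (T.comp (L.comp (.inl ℝ P E))) S p := by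
  have htend : Tendsto (fun p' => (p', e p')) (𝓝[S] p) (𝓝[R] (p, e p)) :=
    tendsto_nhdsWithin_iff.2 ⟨(continuousWithinAt_id.prodMk he),
      eventually_mem_nhdsWithin.mono hR⟩
  have hF := (hasFDerivWithinAt_iff_isLittleO.1 hL).comp_tendsto htend
  -- the error term of the fixed point equation controls the increment of `e`
  have key : ∀ p' ∈ S, e p' - e p - T (L.comp (.inl ℝ P E) (p' - p)) =
      T (Φ (p', e p') - Φ (p, e p) - L ((p', e p') - (p, e p))) := by
    intro p' hp'
    have h1 := DFunLike.congr_fun hT (e p' - e p)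
    simp only [ContinuousLinearMap.comp_apply, sub_apply,
      ContinuousLinearMap.id_apply, ContinuousLinearMap.inr_apply,
      ContinuousLinearMap.inl_apply] at h1 ⊢
    rw [hfix _ hp', hfix _ hp]
    have h2 : ((p', e p') - (p, e p) : P × E) = (p' - p, 0) + (0, e p' - e p) := by simp
    rw [h2, map_add]
    conv_lhs => rw [← h1]
    rw [← map_sub]
    congr 1
    abel
  have hbig : (fun p' => ((p', e p') - (p, e p) : P × E)) =O[𝓝[S] p] fun p' => p' - p := by
    have hc : (0 : ℝ) < (2 * (‖T‖ + 1))⁻¹ := by positivity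
    refine Asymptotics.IsBigO.of_bound (2 * ‖T‖ * ‖L.comp (.inl ℝ P E)‖ + 1) ?_
    filter_upwards [self_mem_nhdsWithin, Asymptotics.isLittleO_iff.1 hF hc] with p' hp' hb
    simp only [Function.comp_apply] at hb
    set A := ‖e p' - e p‖
    set B := ‖p' - p‖
    have hm : ‖((p', e p') - (p, e p) : P × E)‖ = max B A := rfl
    have h1 : A ≤ ‖T‖ * (‖L.comp (.inl ℝ P E)‖ * B) +
        ‖T‖ * ((2 * (‖T‖ + 1))⁻¹ * max B A) := by
      have h2 : e p' - e p = T (L.comp (.inl ℝ P E) (p' - p)) +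
          T (Φ (p', e p') - Φ (p, e p) - L ((p', e p') - (p, e p))) := by
        rw [← key p' hp']; abel
      calc A = _ := by rw [show A = ‖e p' - e p‖ from rfl, h2]
        _ ≤ _ := norm_add_le _ _
        _ ≤ _ := by
          gcongr
          · exact (T.le_opNorm _).trans
              (mul_le_mul_of_nonneg_left (ContinuousLinearMap.le_opNorm _ _) (norm_nonneg _))
          · exact (T.le_opNorm _).trans (mul_le_mul_of_nonneg_left hb (norm_nonneg _))
    have h3 : ‖T‖ * ((2 * (‖T‖ + 1))⁻¹ * max B A) ≤ 1 / 2 * max B A := by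
      rw [← mul_assoc]
      refine mul_le_mul_of_nonneg_right ?_ (le_max_of_le_left (norm_nonneg _))
      rw [← div_eq_mul_inv, div_le_div_iff₀ (by positivity) (by norm_num)]
      linarith [norm_nonneg T]
    have hB : 0 ≤ B := norm_nonneg _
    have hTL : 0 ≤ ‖T‖ * (‖L.comp (.inl ℝ P E)‖ * B) := by positivity
    rw [hm]
    rcases le_total A B with h | h
    · rw [max_eq_left h]; nlinarith
    · rw [max_eq_right h] at h3 h1 ⊢
      nlinarith
  rw [hasFDerivWithinAt_iff_isLittleO]
  have h1 : (fun p' => T (Φ (p', e p') - Φ (p, e p) - L ((p', e p') - (p, e p)))) =o[𝓝[S] p]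
      fun p' => p' - p :=
    (T.isBigO_comp _ _).trans_isLittleO (hF.trans_isBigO hbig)
  refine h1.congr' ?_ EventuallyEq.rfl
  filter_upwards [self_mem_nhdsWithin] with p' hp' using (key p' hp').symm

/-- If `Φ(p₀, ·)` is the constant `e₀`, then the equation `e = Φ(p, e)` has for `p` near `p₀` a
solution that depends smoothly on `p`. The parameter is restricted to a convex set with interior,
of which `p₀` may be a boundary point. -/
theorem exists_fixedPoint_contDiffOn [CompleteSpace E] {S : Set P} (hS : Convex ℝ S)
    (hSi : (interior S).Nonempty) {V : Set E} (hV : IsOpen V) {p₀ : P} {e₀ : E}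
    (hp₀ : p₀ ∈ S) (he₀ : e₀ ∈ V) {Φ : P × E → E} (hΦ : ContDiffOn ℝ ∞ Φ (S ×ˢ V))
    (h0 : ∀ e ∈ V, Φ (p₀, e) = e₀) :
    ∃ r > 0, ∃ e : P → E, ContDiffOn ℝ ∞ e (S ∩ Metric.ball p₀ r) ∧
      ∀ p ∈ S ∩ Metric.ball p₀ r, e p ∈ V ∧ Φ (p, e p) = e p := by
  have hSu : UniqueDiffOn ℝ S := uniqueDiffOn_convex hS hSi
  have hu : UniqueDiffOn ℝ (S ×ˢ V) := hSu.prod hV.uniqueDiffOn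
  set D := fun z => fderivWithin ℝ Φ (S ×ˢ V) z with hD
  have hDs : ContDiffOn ℝ ∞ D (S ×ˢ V) := hΦ.fderivWithin hu (by simp)
  have hder : ∀ z ∈ S ×ˢ V, HasFDerivWithinAt Φ (D z) (S ×ˢ V) z := fun z hz =>
    (hΦ.differentiableOn (by simp) z hz).hasFDerivWithinAt
  have hpart : ∀ p ∈ S, ∀ e ∈ V, HasFDerivWithinAt (fun e => Φ (p, e))
      ((D (p, e)).comp (.inr ℝ P E)) V e := fun p hp e he => by
    have h1 : HasFDerivWithinAt (fun e : E => (p, e)) (ContinuousLinearMap.inr ℝ P E) V e :=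
      (hasFDerivAt_prodMk_right p e).hasFDerivWithinAt
    exact (hder (p, e) ⟨hp, he⟩).comp e h1 (fun e he => ⟨hp, he⟩)
  have hD0 : (D (p₀, e₀)).comp (.inr ℝ P E) = 0 := by
    have h1 : HasFDerivWithinAt (fun e => Φ (p₀, e)) (0 : E →L[ℝ] E) V e₀ :=
      (hasFDerivWithinAt_const e₀ e₀ V).congr h0 (h0 _ he₀)
    exact (hV.uniqueDiffOn e₀ he₀).eq (hpart p₀ hp₀ e₀ he₀) h1
  -- neighbourhoods on which the equation is a contraction
  obtain ⟨δ, hδ, hδ'⟩ : ∃ δ > 0, ∀ z ∈ S ×ˢ V, dist z (p₀, e₀) < δ →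
      ‖(D z).comp (.inr ℝ P E)‖ < 1 / 2 := by
    have hc : ContinuousOn (fun z => (D z).comp (.inr ℝ P E)) (S ×ˢ V) :=
      hDs.continuousOn.clm_comp continuousOn_const
    obtain ⟨δ, hδ, h⟩ := Metric.continuousWithinAt_iff.1 (hc (p₀, e₀) ⟨hp₀, he₀⟩) (1 / 2)
      (by norm_num)
    exact ⟨δ, hδ, fun z hz hd => by simpa [hD0] using h hz hd⟩
  obtain ⟨ρ, hρ, hρV⟩ : ∃ ρ > 0, Metric.closedBall e₀ ρ ⊆ V ∩ Metric.ball e₀ δ :=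
    Metric.nhds_basis_closedBall.mem_iff.1
      (inter_mem (hV.mem_nhds he₀) (Metric.ball_mem_nhds e₀ hδ))
  obtain ⟨r₁, hr₁, hr₁'⟩ : ∃ r > 0, ∀ p ∈ S, dist p p₀ < r → dist (Φ (p, e₀)) e₀ < ρ / 2 := by
    have hc : ContinuousOn (fun p => Φ (p, e₀)) S :=
      hΦ.continuousOn.comp (by fun_prop) (fun p hp => ⟨hp, he₀⟩)
    obtain ⟨r, hr, h⟩ := Metric.continuousWithinAt_iff.1 (hc p₀ hp₀) (ρ / 2) (by positivity)
    exact ⟨r, hr, fun p hp hd => by simpa [h0 _ he₀] using h hp hd⟩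
  set r := min r₁ δ with hr
  have hrpos : 0 < r := lt_min hr₁ hδ
  set S' := S ∩ Metric.ball p₀ r with hS'
  have hS'u : UniqueDiffOn ℝ S' := hSu.inter Metric.isOpen_ball
  have hsmall : ∀ p ∈ S', ∀ e ∈ Metric.closedBall e₀ ρ,
      ‖(D (p, e)).comp (.inr ℝ P E)‖ < 1 / 2 := fun p hp e he => by
    refine hδ' (p, e) ⟨hp.1, (hρV he).1⟩ ?_
    rw [Prod.dist_eq, max_lt_iff]
    exact ⟨(Metric.mem_ball.1 hp.2).trans_le (min_le_right _ _), (hρV he).2⟩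
  have hlip : ∀ p ∈ S', ∀ e ∈ Metric.closedBall e₀ ρ, ∀ e' ∈ Metric.closedBall e₀ ρ,
      dist (Φ (p, e)) (Φ (p, e')) ≤ 1 / 2 * dist e e' := fun p hp e he e' he' => by
    rw [dist_eq_norm, dist_eq_norm]
    exact (convex_closedBall e₀ ρ).norm_image_sub_le_of_norm_hasFDerivWithin_le
      (f := fun e => Φ (p, e))
      (fun z hz => (hpart p hp.1 z (hρV hz).1).mono fun y hy => (hρV hy).1)
      (fun z hz => (hsmall p hp z hz).le) he' he
  have hex : ∀ p, ∃ e, p ∈ S' → e ∈ Metric.closedBall e₀ ρ ∧ Φ (p, e) = e := by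
    intro p
    by_cases hp : p ∈ S'
    swap
    · exact ⟨e₀, fun h => absurd h hp⟩
    have hmaps : MapsTo (fun e => Φ (p, e)) (Metric.closedBall e₀ ρ) (Metric.closedBall e₀ ρ) := by
      intro e he
      have h1 := hlip p hp e he e₀ (Metric.mem_closedBall_self hρ.le)
      have h2 := hr₁' p hp.1 ((Metric.mem_ball.1 hp.2).trans_le (min_le_left _ _))
      have h3 := Metric.mem_closedBall.1 he
      exact Metric.mem_closedBall.2 ((dist_triangle _ (Φ (p, e₀)) _).trans (by linarith))
    have hcon : ContractingWith (1 / 2) (hmaps.restrict _ _ _) := by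
      refine ⟨by rw [← NNReal.coe_lt_coe]; norm_num, LipschitzWith.of_dist_le_mul fun e e' => ?_⟩
      have := hlip p hp e e.2 e' e'.2
      simpa [Subtype.dist_eq] using this
    obtain ⟨e, he, hfix, -⟩ := hcon.exists_fixedPoint' Metric.isClosed_closedBall.isComplete hmaps
      (Metric.mem_closedBall_self hρ.le) (edist_ne_top _ _)
    exact ⟨e, fun _ => ⟨he, hfix⟩⟩
  choose e he using hex
  have heV : ∀ p ∈ S', e p ∈ V := fun p hp => (hρV (he p hp).1).1
  have hcont : ContinuousOn e S' := by
    intro p hp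
    have hc : ContinuousWithinAt (fun p' => Φ (p', e p)) S' p :=
      (hΦ.continuousOn.comp (by fun_prop) (fun p' hp' => ⟨hp'.1, heV p hp⟩) :
        ContinuousOn (fun p' => Φ (p', e p)) S') p hp
    rw [Metric.continuousWithinAt_iff] at hc ⊢
    intro ε hε
    obtain ⟨η, hη, h⟩ := hc (ε / 2) (by positivity)
    refine ⟨η, hη, fun p' hp' hd => ?_⟩
    have h1 := h hp' hd
    have h2 := hlip p' hp' _ (he p' hp').1 _ (he p hp).1
    rw [(he p' hp').2] at h2
    rw [(he p hp).2] at h1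
    have h3 := dist_triangle (e p') (Φ (p', e p)) (e p)
    linarith
  have hD' : ∀ p ∈ S', HasFDerivWithinAt e
      ((Ring.inverse (1 - (D (p, e p)).comp (.inr ℝ P E))).comp ((D (p, e p)).comp (.inl ℝ P E)))
      S' p := by
    intro p hp
    refine hasFDerivWithinAt_fixedPoint hp (hder (p, e p) ⟨hp.1, heV p hp⟩)
      (fun p' hp' => ⟨hp'.1, heV p' hp'⟩) (fun p' hp' => (he p' hp').2) (hcont p hp) ?_
    exact Ring.inverse_mul_cancel _
      (isUnit_one_sub_of_norm_lt_one ((hsmall p hp _ (he p hp).1).trans (by norm_num)))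
  refine ⟨r, hrpos, e, ?_, fun p hp => ⟨heV p hp, (he p hp).2⟩⟩
  rw [contDiffOn_infty]
  intro n
  induction n with
  | zero => simpa using hcont
  | succ n ih =>
    rw [Nat.cast_succ, contDiffOn_succ_iff_fderivWithin hS'u]
    refine ⟨fun p hp => (hD' p hp).differentiableWithinAt, by simp, ?_⟩
    have hcomp : ContDiffOn ℝ n (fun p => D (p, e p)) S' :=
      (hDs.of_le (by exact_mod_cast le_top)).comp (contDiffOn_id.prodMk ih)
        (fun p hp => ⟨hp.1, heV p hp⟩)
    have hinv : ContDiffOn ℝ n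
        (fun p => Ring.inverse (1 - (D (p, e p)).comp (.inr ℝ P E))) S' := by
      intro p hp
      obtain ⟨w, hw⟩ := isUnit_one_sub_of_norm_lt_one
        ((hsmall p hp _ (he p hp).1).trans (by norm_num))
      have h1 : ContDiffAt ℝ n Ring.inverse (1 - (D (p, e p)).comp (.inr ℝ P E)) := by
        rw [← hw]; exact contDiffAt_ringInverse ℝ w
      exact h1.comp_contDiffWithinAt p
        ((contDiffOn_const.sub (hcomp.clm_comp contDiffOn_const)) p hp)
    refine (hinv.clm_comp (hcomp.clm_comp
      (contDiffOn_const (c := ContinuousLinearMap.inl ℝ P E)))).congr fun p hp => ?_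
    exact (hD' p hp).fderivWithin (hS'u p hp)

end FixedPoint

/-! ### A singular Hamilton-Jacobi equation -/

section HamiltonJacobi

variable {E D : Type} [NormedAddCommGroup E] [NormedSpace ℝ E] [NormedAddCommGroup D]
  [NormedSpace ℝ D]

/-- Along a variation `(δq, δη)` of the characteristic curves of `ω_x = x Q(x, q, ω_q / x)`, where
the variation of the curve parameter `x s` is `s a`, the contact form `dω - x s η dq - x s Q d(x s)`
vanishes. -/
theorem contactForm_eq_zero (b : D →L[ℝ] E →L[ℝ] ℝ) {x a : ℝ} {Q : ℝ × (E × D) → ℝ}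
    {Q' : ℝ → ℝ × (E × D) →L[ℝ] ℝ} {q C δq δC : ℝ → E} {η B δη : ℝ → D}
    {δω : ℝ → ℝ}
    (hQ : ∀ s ∈ Ioo (0 : ℝ) 1, HasFDerivAt Q (Q' s) (s * x, (q s, η s)))
    (hC : ∀ s ∈ Ioo (0 : ℝ) 1, ∀ θ, Q' s (0, (0, θ)) = b θ (C s))
    (hB : ∀ s ∈ Ioo (0 : ℝ) 1, ∀ w, s * x * Q' s (0, (w, 0)) = b (B s) w)
    (hq : ∀ s ∈ Ioo (0 : ℝ) 1, HasDerivAt q (-(x • C s)) s)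
    (hη : ∀ s ∈ Ioo (0 : ℝ) 1, HasDerivAt (fun s => s • η s) (B s) s)
    (hδq : ∀ s ∈ Ioo (0 : ℝ) 1, HasDerivAt δq (-(a • C s + x • δC s)) s)
    (hδω : ∀ s ∈ Ioo (0 : ℝ) 1, HasDerivAt δω
      (a * (s * x * Q (s * x, (q s, η s)) - s * x * b (η s) (C s)) +
        x * (s * a * Q (s * x, (q s, η s)) + s * x * Q' s (s * a, (δq s, δη s)) -
          (s * a * b (η s) (C s) + s * x * b (δη s) (C s) + s * x * b (η s) (δC s)))) s)
    (hηc : ContinuousOn η (Icc 0 1)) (hδqc : ContinuousOn δq (Icc 0 1))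
    (hδωc : ContinuousOn δω (Icc 0 1))
    (hQc : ContinuousOn (fun s => Q (s * x, (q s, η s))) (Icc 0 1)) (h0 : δω 0 = 0) :
    δω 1 = x * b (η 1) (δq 1) + x * Q (x, (q 1, η 1)) * a := by
  have hder : ∀ s ∈ Ioo (0 : ℝ) 1, HasDerivAt
      (fun s => δω s - x * b (s • η s) (δq s) - s * x * Q (s * x, (q s, η s)) * (s * a)) 0 s := by
    intro s hs
    have hη' : HasDerivAt η (s⁻¹ • (B s - η s)) s := by
      have h1 := (hasDerivAt_inv hs.1.ne').smul (hη s hs)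
      have h2 : HasDerivAt η (s⁻¹ • B s + -(s ^ 2)⁻¹ • s • η s) s := by
        refine h1.congr_of_eventuallyEq ?_
        filter_upwards [eventually_ne_nhds hs.1.ne'] with t ht
        simp [smul_smul, ht]
      convert h2 using 1
      rw [smul_smul, smul_sub, sub_eq_add_neg, ← neg_smul]
      congr 2
      field_simp
    have hγ : HasDerivAt (fun s => (s * x, (q s, η s)))
        (x, (-(x • C s), s⁻¹ • (B s - η s))) s :=
      (hasDerivAt_mul_const x).prodMk ((hq s hs).prodMk hη')
    have hQγ := (hQ s hs).comp_hasDerivAt s hγ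
    have hζ : HasDerivAt (fun s => x * b (s • η s) (δq s))
        (x * (b (B s) (δq s) + b (s • η s) (-(a • C s + x • δC s)))) s := ((b.hasFDerivAt.comp_hasDerivAt s (hη s hs)).clm_apply (hδq s hs)).const_mul x
    have hH : HasDerivAt (fun s => s * x * Q (s * x, (q s, η s)) * (s * a))
        ((x * Q (s * x, (q s, η s)) + s * x * Q' s (x, (-(x • C s), s⁻¹ • (B s - η s)))) * (s * a) +
          s * x * Q (s * x, (q s, η s)) * a) s := ((hasDerivAt_mul_const (x := s) x).mul hQγ).mul (hasDerivAt_mul_const (x := s) a)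
    refine HasDerivAt.congr_deriv (((hδω s hs).sub hζ).sub hH) ?_
    -- split the differential of `Q` into its three components
    have hs3 : ∀ (t : ℝ) (w : E) (θ : D),
        Q' s (t, (w, θ)) = t * Q' s (1, (0, 0)) + Q' s (0, (w, 0)) + b θ (C s) := by
      intro t w θ
      rw [← hC s hs θ, ← smul_eq_mul, ← map_smul, ← map_add, ← map_add]
      simp
    rw [hs3 (s * a) (δq s) (δη s), hs3 x _ _]
    have h1 := hB s hs (δq s)
    have h2 := hB s hs (C s)
    have h3 : Q' s (0, (-(x • C s), 0)) = -(x * Q' s (0, (C s, 0))) := by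
      rw [← smul_eq_mul, ← map_smul, ← map_neg]
      simp
    have h4 : b (B s - η s) (C s) = b (B s) (C s) - b (η s) (C s) := by rw [map_sub]; rfl
    simp only [h3, h4, smul_apply, smul_eq_mul, map_neg, map_add, map_smul]
    have hs0 : s ≠ 0 := hs.1.ne'
    field_simp
    linear_combination x * h1 + x * s * a * h2
  have hint := intervalIntegral.integral_eq_sub_of_hasDerivAt_of_le zero_le_one
    (((hδωc.sub (continuousOn_const.mul ((b.continuous.comp_continuousOn (continuousOn_id.smul hηc)).clm_apply hδqc))).sub
      (((continuousOn_id.mul continuousOn_const).mul hQc).mul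
        (continuousOn_id.mul continuousOn_const)))) hder
    (by simp)
  simp [h0] at hint
  linarith

/-- A finite-dimensional space is reflexive. -/
theorem exists_reflexivity_map [FiniteDimensional ℝ E] :
    ∃ J : ((E →L[ℝ] ℝ) →L[ℝ] ℝ) →L[ℝ] E, ∀ (l : (E →L[ℝ] ℝ) →L[ℝ] ℝ) (θ : E →L[ℝ] ℝ),
      θ (J l) = l θ := by
  let b := Module.finBasis ℝ E
  let c := fun i => LinearMap.toContinuousLinearMap (b.coord i)
  refine ⟨∑ i, (ContinuousLinearMap.apply ℝ ℝ (c i)).smulRight (b i), fun l θ => ?_⟩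
  have hθ : θ = ∑ i, θ (b i) • c i := by
    ext v
    have h := congrArg θ (b.sum_repr v)
    rw [map_sum] at h
    simp [c, ← h, mul_comm]
  conv_rhs => rw [hθ]
  simp [mul_comm]

section

variable {W : Type} [NormedAddCommGroup W] [NormedSpace ℝ W]

variable (W) in
/-- The constant curves. -/
def curveConst : W →L[ℝ] C(unitInterval, W) :=
  LinearMap.mkContinuous
    { toFun := fun w => ContinuousMap.const _ w
      map_add' := fun _ _ => rfl
      map_smul' := fun _ _ => rfl } 1
    (fun w => by
      rw [one_mul]
      exact (ContinuousMap.norm_le _ (norm_nonneg w)).2 fun s => le_rfl)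

@[simp]
theorem curveConst_apply (w : W) (s : unitInterval) : curveConst W w s = w := rfl

end

variable (E D) in
/-- The curve `s ↦ (s x, q(s), η(s))` attached to the end point parameter `(x, _)` and to the
unknowns `q`, `η` of the characteristic system. -/
def stateCurve : (ℝ × E) × (C(unitInterval, E) × C(unitInterval, D)) →L[ℝ]
    C(unitInterval, ℝ × (E × D)) :=
  LinearMap.mkContinuous
    { toFun := fun z => ⟨fun s => (s * z.1.1, (z.2.1 s, z.2.2 s)), by fun_prop⟩
      map_add' := fun z z' => by ext s <;> simp [mul_add]
      map_smul' := fun c z => by ext s <;> simp [mul_left_comm] } 1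
    (fun z => by
      rw [one_mul]
      refine (ContinuousMap.norm_le _ (norm_nonneg z)).2 fun s => ?_
      refine max_le ?_ (max_le ?_ ?_)
      · simp only [LinearMap.coe_mk, AddHom.coe_mk, ContinuousMap.coe_mk, norm_mul]
        rw [Real.norm_of_nonneg s.2.1]
        exact (mul_le_of_le_one_left (norm_nonneg _) s.2.2).trans
          ((norm_fst_le z.1).trans (norm_fst_le z))
      · exact (z.2.1.norm_coe_le_norm s).trans ((norm_fst_le z.2).trans (norm_snd_le z))
      · exact (z.2.2.norm_coe_le_norm s).trans ((norm_snd_le z.2).trans (norm_snd_le z)))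

theorem stateCurve_apply (z : (ℝ × E) × (C(unitInterval, E) × C(unitInterval, D)))
    (s : unitInterval) : stateCurve E D z s = (s * z.1.1, (z.2.1 s, z.2.2 s)) := rfl

theorem fderiv_superpos_apply {K : Type*} [TopologicalSpace K] [CompactSpace K]
    {P : Type*} {G H : Type} [NormedAddCommGroup P] [NormedSpace ℝ P]
    [NormedAddCommGroup G] [NormedSpace ℝ G] [NormedAddCommGroup H] [NormedSpace ℝ H]
    {φ : G → H} {T : Set G} (hφ : ContinuousOn φ T) {γ : P → C(K, G)} {p : P}
    (hγ : DifferentiableAt ℝ γ p) (hT : ∀ᶠ p' in 𝓝 p, ∀ k, γ p' k ∈ T)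
    (hd : DifferentiableAt ℝ (fun p => superpos φ (γ p)) p) {k : K} {φ' : G →L[ℝ] H}
    (hφ' : HasFDerivAt φ φ' (γ p k)) (v : P) :
    fderiv ℝ (fun p => superpos φ (γ p)) p v k = φ' (fderiv ℝ γ p v k) := by
  have h1 : HasFDerivAt (fun p => superpos φ (γ p) k)
      ((ContinuousMap.evalCLM ℝ k).comp (fderiv ℝ (fun p => superpos φ (γ p)) p)) p :=
    (ContinuousMap.evalCLM ℝ k : C(K, H) →L[ℝ] H).hasFDerivAt.comp p hd.hasFDerivAt
  have h2 : HasFDerivAt (fun p => φ (γ p k))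
      (φ'.comp ((ContinuousMap.evalCLM ℝ k).comp (fderiv ℝ γ p))) p :=
    hφ'.comp p ((ContinuousMap.evalCLM ℝ k : C(K, G) →L[ℝ] G).hasFDerivAt.comp p hγ.hasFDerivAt)
  have h3 : (fun p => superpos φ (γ p) k) =ᶠ[𝓝 p] fun p => φ (γ p k) :=
    hT.mono fun p' hp' => superpos_apply hφ hp' k
  exact DFunLike.congr_fun (h1.unique (h2.congr_of_eventuallyEq h3)) v

/-- The differential of the action `ω = x u` of the characteristic curves with respect to their end
points `(x, q)`: as the contact form vanishes along the curves, it is given by the final momentum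
and by `Q` at the end point. -/
theorem hasFDerivAt_action [CompleteSpace E] [CompleteSpace D] (b : D →L[ℝ] E →L[ℝ] ℝ)
    {T : Set (ℝ × (E × D))}
    {Q : ℝ × (E × D) → ℝ} {dQ : ℝ × (E × D) → ℝ × (E × D) →L[ℝ] ℝ} {C : ℝ × (E × D) → E}
    {B : ℝ × (E × D) → D} (hQc : ContinuousOn Q T) (hCc : ContinuousOn C T) (hBc : ContinuousOn B T)
    (hQ : ∀ z ∈ T, 0 < z.1 → HasFDerivAt Q (dQ z) z)
    (hCd : ∀ z ∈ T, 0 < z.1 → DifferentiableAt ℝ C z)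
    (hC : ∀ z ∈ T, 0 < z.1 → ∀ θ, dQ z (0, (0, θ)) = b θ (C z))
    (hB : ∀ z ∈ T, 0 < z.1 → ∀ w, z.1 * dQ z (0, (w, 0)) = b (B z) w)
    {γ : ℝ × E → C(unitInterval, ℝ × (E × D))} {p : ℝ × E} (hp : 0 < p.1)
    (hγ : DifferentiableAt ℝ γ p) (hγT : ∀ᶠ p' in 𝓝 p, ∀ s, γ p' s ∈ T)
    (hγx : ∀ᶠ p' in 𝓝 p, ∀ s, (γ p' s).1 = s * p'.1)
    (hγq : ∀ᶠ p' in 𝓝 p, ∀ s, (γ p' s).2.1 = p'.2 + p'.1 •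
      (curvePrim E (superpos C (γ p')) 1 - curvePrim E (superpos C (γ p')) s))
    (hγη : ∀ s : unitInterval, (s : ℝ) • (γ p s).2.2 = curvePrim D (superpos B (γ p)) s)
    (hdC : DifferentiableAt ℝ (fun p => superpos C (γ p)) p)
    (hdΛ : DifferentiableAt ℝ
      (fun p => superpos (fun z => z.1 * (Q z - b z.2.2 (C z))) (γ p)) p) :
    HasFDerivAt
      (fun p => p.1 * curvePrim ℝ (superpos (fun z => z.1 * (Q z - b z.2.2 (C z))) (γ p)) 1)
      ((p.1 * Q (p.1, (p.2, (γ p 1).2.2))) • ContinuousLinearMap.fst ℝ ℝ E +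
        p.1 • (b (γ p 1).2.2).comp (ContinuousLinearMap.snd ℝ ℝ E)) p := by
  set Λ : ℝ × (E × D) → ℝ := fun z => z.1 * (Q z - b z.2.2 (C z)) with hΛ
  have hΛc : ContinuousOn Λ T := continuousOn_fst.mul (hQc.sub
    ((b.continuous.comp_continuousOn (continuous_snd.snd.continuousOn)).clm_apply hCc))
  have hT := hγT.self_of_nhds
  have hx1 := hγx.self_of_nhds
  have hq1 := hγq.self_of_nhds
  have hev : HasFDerivAt (fun p => curvePrim ℝ (superpos Λ (γ p)) 1)
      (((ContinuousMap.evalCLM ℝ (1 : unitInterval)).comp (curvePrim ℝ)).comp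
        (fderiv ℝ (fun p => superpos Λ (γ p)) p)) p :=
    ((ContinuousMap.evalCLM ℝ (1 : unitInterval)).comp (curvePrim ℝ)).hasFDerivAt.comp p
      hdΛ.hasFDerivAt
  refine (hasFDerivAt_fst.mul hev).congr_fderiv ?_
  refine ContinuousLinearMap.ext fun v => ?_
  set KC := superpos C (γ p)
  set KΛ := superpos Λ (γ p)
  set δγ := fderiv ℝ γ p v with hδγ
  set δC := fderiv ℝ (fun p => superpos C (γ p)) p v with hδC
  set δΛ := fderiv ℝ (fun p => superpos Λ (γ p)) p v with hδΛ
  have hδ1 : ∀ s, (δγ s).1 = s * v.1 := by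
    intro s
    have h1 : HasFDerivAt (fun p => (γ p s).1) ((ContinuousLinearMap.fst ℝ ℝ (E × D)).comp
        ((ContinuousMap.evalCLM ℝ s).comp (fderiv ℝ γ p))) p :=
      (ContinuousLinearMap.fst ℝ ℝ (E × D)).hasFDerivAt.comp p
        ((ContinuousMap.evalCLM ℝ s : C(unitInterval, ℝ × (E × D)) →L[ℝ] _).hasFDerivAt.comp p
          hγ.hasFDerivAt)
    have h2 : HasFDerivAt (fun p : ℝ × E => (s : ℝ) * p.1)
        ((s : ℝ) • ContinuousLinearMap.fst ℝ ℝ E) p := hasFDerivAt_fst.const_mul _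
    exact DFunLike.congr_fun
      (h1.unique (h2.congr_of_eventuallyEq (hγx.mono fun p' hp' => hp' s))) v
  have hδ2 : ∀ s, (δγ s).2.1 = v.2 + (v.1 • (curvePrim E KC 1 - curvePrim E KC s) +
      p.1 • (curvePrim E δC 1 - curvePrim E δC s)) := by
    intro s
    have h1 : HasFDerivAt (fun p => (γ p s).2.1) (((ContinuousLinearMap.fst ℝ E D).comp
        (ContinuousLinearMap.snd ℝ ℝ (E × D))).comp
        ((ContinuousMap.evalCLM ℝ s).comp (fderiv ℝ γ p))) p :=
      ((ContinuousLinearMap.fst ℝ E D).comp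
        (ContinuousLinearMap.snd ℝ ℝ (E × D))).hasFDerivAt.comp p
        ((ContinuousMap.evalCLM ℝ s : C(unitInterval, ℝ × (E × D)) →L[ℝ] _).hasFDerivAt.comp p
          hγ.hasFDerivAt)
    let A : C(unitInterval, E) →L[ℝ] E :=
      ((ContinuousMap.evalCLM ℝ (1 : unitInterval)).comp (curvePrim E)) -
        ((ContinuousMap.evalCLM ℝ s).comp (curvePrim E))
    have h2 : HasFDerivAt (fun p => A (superpos C (γ p)))
        (A.comp (fderiv ℝ (fun p => superpos C (γ p)) p)) p :=
      A.hasFDerivAt.comp p hdC.hasFDerivAt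
    have h3 := (hasFDerivAt_snd (𝕜 := ℝ) (p := p)).add
      ((hasFDerivAt_fst (𝕜 := ℝ) (p := p)).smul h2)
    have h4 := DFunLike.congr_fun
      (h1.unique (h3.congr_of_eventuallyEq (hγq.mono fun p' hp' => hp' s))) v
    refine Eq.trans h4 ?_
    rw [add_comm (v.1 • _)]
    rfl
  have hpos : ∀ s (hs : s ∈ Ioo (0 : ℝ) 1), 0 < (γ p ⟨s, Ioo_subset_Icc_self hs⟩).1 :=
    fun s hs => by rw [hx1]; exact mul_pos hs.1 hp
  have hδC' : ∀ s (hs : s ∈ Ioo (0 : ℝ) 1), δC ⟨s, Ioo_subset_Icc_self hs⟩ =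
      fderiv ℝ C (γ p ⟨s, Ioo_subset_Icc_self hs⟩) (δγ ⟨s, Ioo_subset_Icc_self hs⟩) := fun s hs =>
    fderiv_superpos_apply hCc hγ hγT hdC (hCd _ (hT _) (hpos s hs)).hasFDerivAt v
  have hδΛ' : ∀ s (hs : s ∈ Ioo (0 : ℝ) 1), δΛ ⟨s, Ioo_subset_Icc_self hs⟩ =
      (γ p ⟨s, Ioo_subset_Icc_self hs⟩).1 * (dQ (γ p ⟨s, Ioo_subset_Icc_self hs⟩)
        (δγ ⟨s, Ioo_subset_Icc_self hs⟩) - (b (γ p ⟨s, Ioo_subset_Icc_self hs⟩).2.2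
          (δC ⟨s, Ioo_subset_Icc_self hs⟩) + b (δγ ⟨s, Ioo_subset_Icc_self hs⟩).2.2
          (C (γ p ⟨s, Ioo_subset_Icc_self hs⟩)))) +
      (Q (γ p ⟨s, Ioo_subset_Icc_self hs⟩) - b (γ p ⟨s, Ioo_subset_Icc_self hs⟩).2.2
        (C (γ p ⟨s, Ioo_subset_Icc_self hs⟩))) * (δγ ⟨s, Ioo_subset_Icc_self hs⟩).1 := by
    intro s hs
    have h1 := (hasFDerivAt_fst (𝕜 := ℝ) (p := γ p ⟨s, Ioo_subset_Icc_self hs⟩)).mul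
      ((hQ _ (hT _) (hpos s hs)).sub ((b.hasFDerivAt.comp (γ p ⟨s, Ioo_subset_Icc_self hs⟩)
        (hasFDerivAt_snd (𝕜 := ℝ) (p := γ p ⟨s, Ioo_subset_Icc_self hs⟩)).snd).clm_apply
        (hCd _ (hT _) (hpos s hs)).hasFDerivAt))
    rw [hδC' s hs]
    exact fderiv_superpos_apply hΛc hγ hγT hdΛ h1 v
  have hmem : ∀ {s : ℝ}, s ∈ Ioo (0 : ℝ) 1 → s ∈ Icc (0 : ℝ) 1 := fun h => Ioo_subset_Icc_self h
  have hgs : ∀ s (hs : s ∈ Icc (0 : ℝ) 1), (s * p.1, ((curveExt (γ p) s).2.1,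
      (curveExt (γ p) s).2.2)) = γ p ⟨s, hs⟩ := fun s hs => by
    rw [curveExt_of_mem _ hs]
    exact Prod.ext (hx1 ⟨s, hs⟩).symm rfl
  have key := contactForm_eq_zero b (x := p.1) (a := v.1) (Q := Q)
    (Q' := fun s => dQ (curveExt (γ p) s)) (q := fun s => (curveExt (γ p) s).2.1)
    (η := fun s => (curveExt (γ p) s).2.2) (C := curveExt KC) (δC := curveExt δC)
    (B := curveExt (superpos B (γ p))) (δq := fun s => (curveExt δγ s).2.1)
    (δη := fun s => (curveExt δγ s).2.2)
    (δω := fun s => v.1 * curveExt (curvePrim ℝ KΛ) s + p.1 * curveExt (curvePrim ℝ δΛ) s)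
    (fun s hs => by
      rw [hgs s (hmem hs), curveExt_of_mem _ (hmem hs)]
      exact hQ _ (hT _) (hpos s hs))
    (fun s hs θ => by
      rw [curveExt_of_mem _ (hmem hs), curveExt_of_mem _ (hmem hs), superpos_apply hCc hT]
      exact hC _ (hT _) (hpos s hs) θ)
    (fun s hs w => by
      rw [curveExt_of_mem _ (hmem hs), curveExt_of_mem _ (hmem hs), superpos_apply hBc hT,
        ← hB _ (hT _) (hpos s hs) w, hx1])
    (fun s hs => by
      have h1 := (((hasDerivAt_curvePrim KC hs).const_sub (curvePrim E KC 1)).const_smul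
        p.1).const_add p.2
      rw [smul_neg] at h1
      refine h1.congr_of_eventuallyEq ?_
      filter_upwards [Icc_mem_nhds hs.1 hs.2] with t ht
      rw [curveExt_of_mem _ ht, hq1]
      simp only [Pi.smul_apply, curveExt_of_mem _ ht])
    (fun s hs => by
      refine (hasDerivAt_curvePrim _ hs).congr_of_eventuallyEq ?_
      filter_upwards [Icc_mem_nhds hs.1 hs.2] with t ht
      rw [curveExt_of_mem _ ht, curveExt_of_mem _ ht, ← hγη])
    (fun s hs => by
      have h1 := ((((hasDerivAt_curvePrim KC hs).const_sub (curvePrim E KC 1)).const_smul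
        v.1).add (((hasDerivAt_curvePrim δC hs).const_sub (curvePrim E δC 1)).const_smul
        p.1)).const_add v.2
      rw [smul_neg, smul_neg, ← neg_add] at h1
      refine h1.congr_of_eventuallyEq ?_
      filter_upwards [Icc_mem_nhds hs.1 hs.2] with t ht
      rw [curveExt_of_mem _ ht, hδ2]
      simp only [Pi.add_apply, Pi.smul_apply, curveExt_of_mem _ ht])
    (fun s hs => by
      refine (((hasDerivAt_curvePrim KΛ hs).const_mul v.1).add
        ((hasDerivAt_curvePrim δΛ hs).const_mul p.1)).congr_deriv ?_
      rw [hgs s (hmem hs)]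
      simp only [curveExt_of_mem _ (hmem hs)]
      rw [hδΛ' s hs, superpos_apply hCc hT, superpos_apply hΛc hT, hδ1]
      simp only [hΛ]
      rw [hx1 ⟨s, hmem hs⟩]
      have h3 : (s * v.1, ((δγ ⟨s, hmem hs⟩).2.1, (δγ ⟨s, hmem hs⟩).2.2)) = δγ ⟨s, hmem hs⟩ :=
        Prod.ext (hδ1 ⟨s, hmem hs⟩).symm rfl
      rw [h3]
      ring)
    (continuous_curveExt _).snd.snd.continuousOn (continuous_curveExt _).snd.fst.continuousOn
    (by fun_prop)
    (by
      refine ContinuousOn.congr (f := fun s => Q (curveExt (γ p) s)) ?_ fun s hs => by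
        rw [hgs s hs]
        exact congrArg Q (curveExt_of_mem _ hs).symm
      exact hQc.comp (by fun_prop) fun s _ => hT _)
    (by
      rw [curveExt_of_mem _ (left_mem_Icc.2 zero_le_one),
        curveExt_of_mem _ (left_mem_Icc.2 zero_le_one), curvePrim_apply, curvePrim_apply]
      simp)
  have h1 : ∀ {H : Type} [NormedAddCommGroup H] [NormedSpace ℝ H] (k : C(unitInterval, H)), curveExt k 1 = k 1 :=
    fun k => curveExt_of_mem k (right_mem_Icc.2 zero_le_one)
  simp only [h1] at key
  rw [hδ2, hq1] at key
  simp only [sub_self, smul_zero, add_zero] at key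
  have h2 : curvePrim ℝ KΛ 1 * v.1 + p.1 * curvePrim ℝ δΛ 1 =
      p.1 * Q (p.1, (p.2, (γ p 1).2.2)) * v.1 + p.1 * b (γ p 1).2.2 v.2 := by
    linear_combination key
  refine Eq.trans ?_ h2
  rw [add_comm]
  rfl

/-- Existence of a smooth solution `u`, up to the singular boundary `x = 0`, of
`∂ₓ(x u) = x Q(x, q, ∂_q u)`. The characteristic curves are parametrized by their end points
`(x, q)`, so that they solve a fixed point equation in a space of curves `s ↦ (q(s), η(s))` over
`x s`, `0 ≤ s ≤ 1`, which is trivial for `x = 0`: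
`q(s) = q + x ∫ₛ¹ Q_η` and `x s η(s) = ∫₀ˢ x (x t) Q_q dt`. -/
theorem exists_solution_hamiltonJacobi [CompleteSpace E] [CompleteSpace D]
    (b : D →L[ℝ] E →L[ℝ] ℝ)
    (J : (D →L[ℝ] ℝ) →L[ℝ] E) (hJ : ∀ l θ, b θ (J l) = l θ)
    (J' : (E →L[ℝ] ℝ) →L[ℝ] D) (hJ' : ∀ l, b (J' l) = l) {q₀ : E} {r : ℝ} (hr : 0 < r)
    {Q : ℝ × (E × D) → ℝ} (hQ : ContDiffOn ℝ ∞ Q (halfBall (q₀, 0) r)) :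
    ∃ r' > 0, ∃ u : ℝ × E → ℝ, ContDiffOn ℝ ∞ u (halfBall q₀ r') ∧
      ∀ p ∈ halfBall q₀ r', 0 < p.1 → ∃ η : D, (p.2, η) ∈ Metric.ball (q₀, 0) r ∧
        HasFDerivAt (fun p => p.1 * u p)
          ((p.1 * Q (p.1, (p.2, η))) • ContinuousLinearMap.fst ℝ ℝ E +
            p.1 • (b η).comp (ContinuousLinearMap.snd ℝ ℝ E)) p := by
  set T := halfBall ((q₀, 0) : E × D) r with hT
  have hTu : UniqueDiffOn ℝ T := uniqueDiffOn_halfBall _ hr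
  have hTc : Convex ℝ T := convex_halfBall _ r
  have hTi : (interior T).Nonempty := interior_halfBall_nonempty _ hr
  set dQ := fderivWithin ℝ Q T with hdQ
  have hdQs : ContDiffOn ℝ ∞ dQ T := hQ.fderivWithin hTu (by simp)
  let C : ℝ × (E × D) → E := fun z =>
    J ((dQ z).comp ((ContinuousLinearMap.inr ℝ ℝ (E × D)).comp
      (ContinuousLinearMap.inr ℝ E D)))
  let B : ℝ × (E × D) → D := fun z =>
    z.1 • J' ((dQ z).comp ((ContinuousLinearMap.inr ℝ ℝ (E × D)).comp
      (ContinuousLinearMap.inl ℝ E D)))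
  let Λ : ℝ × (E × D) → ℝ := fun z => z.1 * (Q z - b z.2.2 (C z))
  have hJs : ContDiff ℝ ∞ J := J.contDiff
  have hsc : ContDiff ℝ ∞ (stateCurve E D) := (stateCurve E D).contDiff
  have hC : ContDiffOn ℝ ∞ C T := hJs.comp_contDiffOn (hdQs.clm_comp contDiffOn_const)
  have hB : ContDiffOn ℝ ∞ B T := contDiff_fst.contDiffOn.smul
    (J'.contDiff.comp_contDiffOn (hdQs.clm_comp contDiffOn_const))
  have hΛ : ContDiffOn ℝ ∞ Λ T := contDiff_fst.contDiffOn.mul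
    (hQ.sub ((b.contDiff.comp contDiff_snd.snd).contDiffOn.clm_apply hC))
  set S := halfBall q₀ r with hS
  set V := Metric.ball ((curveConst E q₀, 0) : C(unitInterval, E) × C(unitInterval, D)) r
    with hV
  have hmem : ∀ z ∈ S ×ˢ V, ∀ s, stateCurve E D z s ∈ T := by
    rintro ⟨p, e⟩ ⟨hp, he⟩ s
    rw [hV, Metric.mem_ball, Prod.dist_eq, max_lt_iff] at he
    refine ⟨⟨mul_nonneg s.2.1 hp.1.1, (mul_le_of_le_one_left hp.1.1 s.2.2).trans_lt hp.1.2⟩, ?_⟩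
    rw [Metric.mem_ball, Prod.dist_eq, max_lt_iff]
    exact ⟨(ContinuousMap.dist_apply_le_dist s).trans_lt he.1,
      (ContinuousMap.dist_apply_le_dist s).trans_lt he.2⟩
  have hsup : ∀ {H : Type} [NormedAddCommGroup H] [NormedSpace ℝ H]
      {φ : ℝ × (E × D) → H}, ContDiffOn ℝ ∞ φ T →
      ContDiffOn ℝ ∞ (fun z => superpos φ (stateCurve E D z)) (S ×ˢ V) := fun hφ =>
    (contDiffOn_superpos hTc hTi hφ).comp hsc.contDiffOn hmem
  let Φ : (ℝ × E) × (C(unitInterval, E) × C(unitInterval, D)) →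
      C(unitInterval, E) × C(unitInterval, D) := fun z =>
    (curveConst E z.1.2 + z.1.1 • (curveConst E (curvePrim E (superpos C (stateCurve E D z)) 1) -
      curvePrim E (superpos C (stateCurve E D z))), curveMean D (superpos B (stateCurve E D z)))
  have hprim : ∀ {H : Type} [NormedAddCommGroup H] [NormedSpace ℝ H] {X : Type}
      [NormedAddCommGroup X] [NormedSpace ℝ X] {s : Set X} {k : X → C(unitInterval, H)},
      ContDiffOn ℝ ∞ k s → ContDiffOn ℝ ∞ (fun z => curvePrim H (k z) 1) s := by
    intro H _ _ X _ _ s k hk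
    exact ((ContinuousMap.evalCLM ℝ (1 : unitInterval)).comp
      (curvePrim H)).contDiff.comp_contDiffOn hk
  have hΦ : ContDiffOn ℝ ∞ Φ (S ×ˢ V) := by
    refine ContDiffOn.prodMk ?_ ((curveMean D).contDiff.comp_contDiffOn (hsup hB))
    refine ((curveConst E).contDiff.comp contDiff_fst.snd).contDiffOn.add
      (contDiff_fst.fst.contDiffOn.smul (ContDiffOn.sub ?_ ?_))
    · exact (curveConst E).contDiff.comp_contDiffOn (hprim (hsup hC))
    · exact (curvePrim E).contDiff.comp_contDiffOn (hsup hC)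
  have hp₀ : ((0, q₀) : ℝ × E) ∈ S := ⟨⟨le_rfl, hr⟩, Metric.mem_ball_self hr⟩
  obtain ⟨r₁, hr₁, e, he, hfix⟩ := exists_fixedPoint_contDiffOn (convex_halfBall q₀ r)
    (interior_halfBall_nonempty q₀ hr) (V := V) Metric.isOpen_ball hp₀ (Metric.mem_ball_self hr)
    hΦ (by
      intro e he
      have h1 : superpos B (stateCurve E D ((0, q₀), e)) = 0 := by
        ext1 s
        rw [superpos_apply hB.continuousOn (hmem ((0, q₀), e) ⟨hp₀, he⟩)]
        simp [B, stateCurve_apply]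
      simp [Φ, h1])
  set r' := min r r₁ with hr'
  have hsub : halfBall q₀ r' ⊆ S ∩ Metric.ball (0, q₀) r₁ := by
    refine fun p hp => ⟨halfBall_mono (min_le_left _ _) hp, ?_⟩
    have := halfBall_mono (min_le_right _ _) hp
    rw [Metric.mem_ball, Prod.dist_eq, max_lt_iff]
    exact ⟨by simpa [abs_of_nonneg this.1.1] using this.1.2, this.2⟩
  have hSV : ∀ p ∈ halfBall q₀ r', (p, e p) ∈ S ×ˢ V := fun p hp =>
    ⟨(hsub hp).1, (hfix p (hsub hp)).1⟩
  have hpe : ContDiffOn ℝ ∞ (fun p => (p, e p)) (halfBall q₀ r') :=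
    contDiffOn_id.prodMk (he.mono hsub)
  set γ : ℝ × E → C(unitInterval, ℝ × (E × D)) := fun p => stateCurve E D (p, e p) with hγ
  have hγs : ContDiffOn ℝ ∞ γ (halfBall q₀ r') := hsc.comp_contDiffOn hpe
  have hK : ∀ {H : Type} [NormedAddCommGroup H] [NormedSpace ℝ H] {φ : ℝ × (E × D) → H},
      ContDiffOn ℝ ∞ φ T → ContDiffOn ℝ ∞ (fun p => superpos φ (γ p)) (halfBall q₀ r') := by
    intro H _ _ φ hφ
    exact (hsup hφ).comp hpe hSV
  have hγT : ∀ p ∈ halfBall q₀ r', ∀ s, γ p s ∈ T := fun p hp => hmem _ (hSV p hp)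
  have hγq : ∀ p ∈ halfBall q₀ r', ∀ s, (γ p s).2.1 = p.2 + p.1 •
      (curvePrim E (superpos C (γ p)) 1 - curvePrim E (superpos C (γ p)) s) := by
    intro p hp s
    have h1 : (e p).1 = (Φ (p, e p)).1 := by rw [(hfix p (hsub hp)).2]
    exact DFunLike.congr_fun h1 s
  have hγη : ∀ p ∈ halfBall q₀ r', ∀ s : unitInterval, (s : ℝ) • (γ p s).2.2 =
      curvePrim D (superpos B (γ p)) s := by
    intro p hp s
    have h1 : (e p).2 = (Φ (p, e p)).2 := by rw [(hfix p (hsub hp)).2]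
    rw [← smul_curveMean]
    exact congrArg ((s : ℝ) • ·) (DFunLike.congr_fun h1 s)
  have hu : ContDiffOn ℝ ∞ (fun p => curvePrim ℝ (superpos Λ (γ p)) 1) (halfBall q₀ r') :=
    hprim (k := fun p => superpos Λ (γ p)) (hK hΛ)
  refine ⟨r', lt_min hr hr₁, _, hu, fun p hp hx => ⟨(γ p 1).2.2, ?_, ?_⟩⟩
  · -- the characteristic curve belonging to `p = (x, q)` ends at `q`
    have h1 := (hγT p hp 1).2
    have h2 := hγq p hp 1
    rw [sub_self, smul_zero, add_zero] at h2
    rw [← h2]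
    exact h1
  have hnhds := halfBall_mem_nhds hp hx
  have hTn : ∀ z ∈ T, 0 < z.1 → T ∈ 𝓝 z := fun z hz h => halfBall_mem_nhds hz h
  refine hasFDerivAt_action b hQ.continuousOn hC.continuousOn hB.continuousOn (dQ := dQ)
    (fun z hz h => ((hQ.differentiableOn (by simp)) z hz).hasFDerivWithinAt.hasFDerivAt (hTn z hz h))
    (fun z hz h => (hC.contDiffAt (hTn z hz h)).differentiableAt (by simp))
    (fun z hz h θ => ?_) (fun z hz h w => ?_) hx
    ((hγs.contDiffAt hnhds).differentiableAt (by simp))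
    (by filter_upwards [hnhds] with p' hp' using hγT p' hp')
    (Eventually.of_forall fun p' s => rfl)
    (by filter_upwards [hnhds] with p' hp' using hγq p' hp') (hγη p hp)
    (((hK hC).contDiffAt hnhds).differentiableAt (by simp))
    (((hK hΛ).contDiffAt hnhds).differentiableAt (by simp))
  · simp [C, hJ]
  · simp [B, hJ']

end HamiltonJacobi

section HamiltonJacobi

variable {E : Type} [NormedAddCommGroup E] [NormedSpace ℝ E]

theorem halfBall_subset_inter_ball (q₀ : E) {r r' : ℝ} (h : r' ≤ r) :
    halfBall q₀ r' ⊆ halfBall q₀ r ∩ Metric.ball (0, q₀) r' := by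
  refine fun p hp => ⟨halfBall_mono h hp, ?_⟩
  rw [Metric.mem_ball, Prod.dist_eq, max_lt_iff]
  exact ⟨by simpa [abs_of_nonneg hp.1.1] using hp.1.2, hp.2⟩

/-- Smooth solutions `u`, up to the boundary `x = 0`, of the singular first order equation
`σ = F(x, q, η, σ)` for `σ = ∂ₓ(x u)` and `η = ∂_q u`, where `F` does not depend on `η` and `σ` at
`x = 0`. Solving for `σ` and subtracting from `u` its boundary value gives an equation
`∂ₓ(x v) = x Q(x, q, ∂_q v)`. -/
theorem exists_solution_singular [FiniteDimensional ℝ E] {q₀ : E} {r : ℝ} (hr : 0 < r)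
    {F : (ℝ × E) × ((E →L[ℝ] ℝ) × ℝ) → ℝ} (hF : ContDiffOn ℝ ∞ F (halfBall q₀ r ×ˢ univ))
    (h0 : ∀ q ∈ Metric.ball q₀ r, ∀ w w', F ((0, q), w) = F ((0, q), w')) :
    ∃ r' > 0, r' ≤ r ∧ ∃ u : ℝ × E → ℝ, ContDiffOn ℝ ∞ u (halfBall q₀ r') ∧
      ∀ p ∈ halfBall q₀ r', 0 < p.1 → ∃ (σ : ℝ) (η : E →L[ℝ] ℝ), σ = F (p, (η, σ)) ∧
        HasFDerivAt (fun p => p.1 * u p) (σ • ContinuousLinearMap.fst ℝ ℝ E +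
          p.1 • η.comp (ContinuousLinearMap.snd ℝ ℝ E)) p := by
  set a : E → ℝ := fun q => F ((0, q), 0) with ha
  have has : ContDiffOn ℝ ∞ a (Metric.ball q₀ r) :=
    hF.comp (t := halfBall q₀ r ×ˢ univ) (f := fun q : E => (((0, q), 0) : (ℝ × E) × _))
      (by fun_prop) (fun q hq => ⟨⟨⟨le_rfl, hr⟩, hq⟩, mem_univ _⟩)
  have hda : ContDiffOn ℝ ∞ (fderiv ℝ a) (Metric.ball q₀ r) :=
    has.fderiv_of_isOpen Metric.isOpen_ball (by simp)
  have hmaps : ∀ z ∈ halfBall ((q₀, 0) : E × (E →L[ℝ] ℝ)) r, z.2.1 ∈ Metric.ball q₀ r := by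
    intro z hz
    have := hz.2
    rw [Metric.mem_ball, Prod.dist_eq, max_lt_iff] at this
    exact this.1
  -- solve for `σ`, with `η` replaced by its deviation from the boundary value
  obtain ⟨r₁, hr₁, s, hs, hs'⟩ := exists_fixedPoint_contDiffOn
    (convex_halfBall ((q₀, 0) : E × (E →L[ℝ] ℝ)) r) (interior_halfBall_nonempty _ hr)
    (V := (univ : Set ℝ)) isOpen_univ (p₀ := (0, (q₀, 0))) (e₀ := a q₀)
    ⟨⟨le_rfl, hr⟩, Metric.mem_ball_self hr⟩ (mem_univ _)
    (Φ := fun z => F ((z.1.1, z.1.2.1), (fderiv ℝ a z.1.2.1 + z.1.2.2, z.2)))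
    (by
      refine hF.comp (ContDiffOn.prodMk (by fun_prop) (ContDiffOn.prodMk (ContDiffOn.add ?_
        (by fun_prop)) (by fun_prop))) ?_
      · exact hda.comp (by fun_prop) fun z hz => hmaps _ hz.1
      · exact fun z hz => ⟨⟨hz.1.1, hmaps _ hz.1⟩, mem_univ _⟩)
    (fun e _ => h0 q₀ (Metric.mem_ball_self hr) _ _)
  set r₂ := min r r₁ with hr₂
  have hr₂0 : 0 < r₂ := lt_min hr hr₁
  have hsub : halfBall ((q₀, 0) : E × (E →L[ℝ] ℝ)) r₂ ⊆
      halfBall (q₀, 0) r ∩ Metric.ball (0, (q₀, 0)) r₁ :=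
    (halfBall_subset_inter_ball _ (min_le_left _ _)).trans
      (inter_subset_inter_right _ (Metric.ball_subset_ball (min_le_right _ _)))
  obtain ⟨Q, hQ, hsQ⟩ := exists_eq_smul_of_eq_zero hr₂0
    (f := fun z : ℝ × (E × (E →L[ℝ] ℝ)) => s z - a z.2.1)
    ((hs.mono hsub).sub (has.comp (by fun_prop) fun z hz => hmaps _ (hsub hz).1))
    (by
      intro w hw
      have h1 : (0, w) ∈ halfBall ((q₀, 0) : E × (E →L[ℝ] ℝ)) r₂ := ⟨⟨le_rfl, hr₂0⟩, hw⟩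
      rw [← (hs' _ (hsub h1)).2, sub_eq_zero]
      exact h0 _ (hmaps _ (hsub h1).1) _ _)
  obtain ⟨J, hJ⟩ := exists_reflexivity_map (E := E)
  obtain ⟨r₃, hr₃, v, hv, hv'⟩ := exists_solution_hamiltonJacobi (.id ℝ (E →L[ℝ] ℝ)) J hJ
    (.id ℝ _) (fun _ => rfl) hr₂0 hQ
  refine ⟨min r₂ r₃, lt_min hr₂0 hr₃, (min_le_left _ _).trans (min_le_left _ _),
    fun p => a p.2 + v p, ?_, ?_⟩
  · refine ContDiffOn.add (has.comp (by fun_prop) fun p hp => ?_)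
      (hv.mono (halfBall_mono (min_le_right _ _)))
    exact (halfBall_mono ((min_le_left _ _).trans (min_le_left _ _)) hp).2
  · intro p hp hx
    obtain ⟨η, hη, hd⟩ := hv' p (halfBall_mono (min_le_right _ _) hp) hx
    have hz : (p.1, (p.2, η)) ∈ halfBall ((q₀, 0) : E × (E →L[ℝ] ℝ)) r₂ :=
      ⟨⟨hx.le, hp.1.2.trans_le (min_le_left _ _)⟩, hη⟩
    have h1 := (hs' _ (hsub hz)).2
    have h2 := hsQ _ hz
    simp only [smul_eq_mul] at h2 h1
    refine ⟨s (p.1, (p.2, η)), fderiv ℝ a p.2 + η, h1.symm, ?_⟩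
    have had : HasFDerivAt a (fderiv ℝ a p.2) p.2 :=
      ((has.contDiffAt (Metric.isOpen_ball.mem_nhds (hmaps _ (hsub hz).1))).differentiableAt
        (by simp)).hasFDerivAt
    have h3 := ((hasFDerivAt_fst (𝕜 := ℝ) (p := p)).mul
      (had.comp p hasFDerivAt_snd)).add hd
    have h4 : (fun p : ℝ × E => p.1 * (a p.2 + v p)) =
        (Prod.fst * (a ∘ Prod.snd)) + fun p => p.1 * v p := by
      ext p
      simp [mul_add]
    rw [h4]
    refine h3.congr_fderiv ?_
    refine ContinuousLinearMap.ext fun w => ?_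
    simp
    linear_combination (-w.1) * h2

end HamiltonJacobi

section Uniqueness

variable {E : Type} [NormedAddCommGroup E] [InnerProductSpace ℝ E] [FiniteDimensional ℝ E]

/-- A function that vanishes at `x = 0` and is constant in the directions `(1, b)`, where `b`
depends on the point and is bounded, vanishes near the boundary. On a paraboloid that the directions
`-(1, b)` do not leave, the function `w² e⁻ˣ` could not have a positive maximum. -/
theorem eq_zero_of_transport {q₀ : E} {r M : ℝ} (hr : 0 < r) {w : ℝ × E → ℝ}
    (hw : ContinuousOn w (halfBall q₀ r)) (h0 : ∀ q ∈ Metric.ball q₀ r, w (0, q) = 0)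
    (hd : ∀ p ∈ halfBall q₀ r, 0 < p.1 → ∃ (b : E) (w' : ℝ × E →L[ℝ] ℝ), ‖b‖ ≤ M ∧
      HasFDerivAt w w' p ∧ w' (1, b) = 0) :
    ∃ r' > 0, r' ≤ r ∧ ∀ p ∈ halfBall q₀ r', w p = 0 := by
  wlog hM : 0 ≤ M generalizing M
  · exact this (M := max M 0) (fun p hp hx => by
      obtain ⟨b, w', hb, h⟩ := hd p hp hx
      exact ⟨b, w', hb.trans (le_max_left _ _), h⟩) (le_max_right _ _)
  set ρ := r / 2 with hρ
  have hρ0 : 0 < ρ := half_pos hr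
  set Λ := 2 * ρ * M + 1 + ρ with hΛ
  have hΛ0 : 0 < Λ := by positivity
  set K : Set (ℝ × E) := {p | 0 ≤ p.1 ∧ ‖p.2 - q₀‖ ^ 2 + Λ * p.1 ≤ ρ ^ 2} with hK
  have hq : ∀ p ∈ K, ‖p.2 - q₀‖ ≤ ρ := fun p hp =>
    abs_le_of_sq_le_sq' (by nlinarith [hp.1, hp.2]) hρ0.le |>.2
  have hx : ∀ p ∈ K, p.1 ≤ ρ := fun p hp => by
    have h1 : Λ * p.1 ≤ ρ ^ 2 := by linarith [hp.2, sq_nonneg ‖p.2 - q₀‖]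
    have h2 : ρ * p.1 ≤ Λ * p.1 := mul_le_mul_of_nonneg_right (by nlinarith) hp.1
    nlinarith
  have hKr : K ⊆ halfBall q₀ r := fun p hp =>
    ⟨⟨hp.1, (hx p hp).trans_lt (half_lt_self hr)⟩, by
      rw [mem_ball_iff_norm]; exact (hq p hp).trans_lt (half_lt_self hr)⟩
  have hKc : IsCompact K := by
    refine Metric.isCompact_of_isClosed_isBounded ?_ ?_
    · exact (isClosed_le continuous_const continuous_fst).inter
        (isClosed_le (f := fun p : ℝ × E => ‖p.2 - q₀‖ ^ 2 + Λ * p.1) (by fun_prop)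
          continuous_const)
    · refine (Metric.isBounded_closedBall (x := ((0, q₀) : ℝ × E)) (r := ρ)).subset fun p hp => ?_
      rw [Metric.mem_closedBall, Prod.dist_eq, max_le_iff]
      exact ⟨by simpa [abs_of_nonneg hp.1] using hx p hp,
        by rw [dist_eq_norm]; exact hq p hp⟩
  have hzero : ∀ p ∈ K, w p = 0 := by
    by_contra! hne
    obtain ⟨p₁, hp₁, hw₁⟩ := hne
    obtain ⟨p, hp, hmax⟩ := hKc.exists_isMaxOn (f := fun p => w p ^ 2 * Real.exp (-p.1)) ⟨p₁, hp₁⟩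
      (((hw.mono hKr).pow 2).mul (by fun_prop))
    have hpos : 0 < w p ^ 2 * Real.exp (-p.1) :=
      lt_of_lt_of_le (by positivity) (hmax hp₁)
    have hwp : w p ≠ 0 := by rintro h; simp [h] at hpos
    have hxp : 0 < p.1 := by
      refine lt_of_le_of_ne hp.1 fun h => hwp ?_
      rw [show p = (0, p.2) from Prod.ext h.symm rfl]
      exact h0 _ (hKr hp).2
    obtain ⟨b, w', hb, hd', hz⟩ := hd p (hKr hp) hxp
    -- a short segment in the direction `-(1, b)` stays in the paraboloid
    obtain ⟨ε, hε, hε1, hε2⟩ : ∃ ε > 0, ε ≤ p.1 ∧ ε * M ^ 2 ≤ 1 := by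
      refine ⟨min p.1 (M ^ 2 + 1)⁻¹, lt_min hxp (by positivity), min_le_left _ _, ?_⟩
      calc _ ≤ (M ^ 2 + 1)⁻¹ * M ^ 2 := by gcongr; exact min_le_right _ _
        _ ≤ 1 := by rw [inv_mul_le_one₀ (by positivity)]; linarith
    have hseg : segment ℝ p (p + (-ε) • (1, b)) ⊆ K := by
      rw [segment_eq_image']
      rintro _ ⟨t, ht, rfl⟩
      have e1 : t * ε ≤ p.1 := by nlinarith [ht.1, ht.2]
      have e0 : 0 ≤ t * ε := mul_nonneg ht.1 hε.le
      have e3 : (t * ε) * M ^ 2 ≤ 1 := by nlinarith [ht.1, ht.2, sq_nonneg M]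
      have e2 : ‖p.2 + t • -(ε • b) - q₀‖ ^ 2 ≤ ‖p.2 - q₀‖ ^ 2 + 2 * (t * ε) * (ρ * M) +
          (t * ε) ^ 2 * M ^ 2 := by
        have h1 : p.2 + t • -(ε • b) - q₀ = (p.2 - q₀) - (t * ε) • b := by
          rw [smul_neg, smul_smul]; abel
        have h2 : ‖p.2 + t • -(ε • b) - q₀‖ ≤ ‖p.2 - q₀‖ + (t * ε) * M := by
          rw [h1]
          refine (norm_sub_le _ _).trans ?_
          rw [norm_smul, Real.norm_of_nonneg e0]
          gcongr
        have h3 := pow_le_pow_left₀ (norm_nonneg _) h2 2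
        have h4 := mul_le_mul_of_nonneg_right (hq p hp) hM
        nlinarith
      simp only [add_sub_cancel_left, hK, mem_ofPred_eq, Prod.fst_add, Prod.smul_fst, smul_eq_mul,
        Prod.snd_add, Prod.smul_snd, neg_smul, Prod.fst_neg, Prod.snd_neg, mul_one]
      refine ⟨by linarith, ?_⟩
      have := hp.2
      nlinarith
    have hf : HasFDerivAt (fun p => w p ^ 2 * Real.exp (-p.1))
        (w p ^ 2 • (Real.exp (-p.1) • -ContinuousLinearMap.fst ℝ ℝ E) +
          Real.exp (-p.1) • ((2 * w p ^ 1) • w')) p := by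
      have h1 : HasFDerivAt (fun p : ℝ × E => Real.exp (-p.1))
          (Real.exp (-p.1) • -ContinuousLinearMap.fst ℝ ℝ E) p :=
        (hasFDerivAt_fst (𝕜 := ℝ) (p := p)).neg.exp
      exact (by simpa using hd'.pow 2 : HasFDerivAt (fun p => w p ^ 2) ((2 * w p ^ 1) • w') p).mul h1
    have hle := IsLocalMaxOn.hasFDerivWithinAt_nonpos (hmax.localize) hf.hasFDerivWithinAt
      (mem_posTangentConeAt_of_segment_subset hseg)
    rw [map_smul, smul_eq_mul] at hle
    have h2 : (w p ^ 2 • (Real.exp (-p.1) • -ContinuousLinearMap.fst ℝ ℝ E) +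
        Real.exp (-p.1) • ((2 * w p ^ 1) • w')) (1, b) = -(w p ^ 2 * Real.exp (-p.1)) := by
      simp [hz]
    rw [h2] at hle
    nlinarith [mul_pos hε hpos]
  refine ⟨min ρ (ρ ^ 2 / (ρ + Λ)), by positivity, (min_le_left _ _).trans (half_le_self hr.le),
    fun p hp => hzero p ⟨hp.1.1, ?_⟩⟩
  have h1 := hp.1.2.trans_le (min_le_right _ _)
  have h2 := (mem_ball_iff_norm.1 hp.2)
  have h3 := h2.trans_le (min_le_left _ _)
  have h4 := h2.trans_le (min_le_right _ _)
  rw [lt_div_iff₀ (by positivity)] at h1 h4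
  have h5 := hp.1.1
  have h6 := norm_nonneg (p.2 - q₀)
  by_cases h7 : ‖p.2 - q₀‖ ≤ p.1
  · nlinarith
  · nlinarith

end Uniqueness

/-! ### The eikonal equation in boundary coordinates -/

section Eikonal

/-- A property that is open at the boundary point `(0, q)` holds on a half ball. -/
theorem exists_halfBall_of_eventually {E : Type*} [NormedAddCommGroup E] [NormedSpace ℝ E] {q : E}
    {r : ℝ} (hr : 0 < r) {P : ℝ × E → Prop} (h : ∀ᶠ p in 𝓝[halfBall q r] (0, q), P p) :
    ∃ r' > 0, r' ≤ r ∧ ∀ p ∈ halfBall q r', P p := by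
  have h' : {p | p ∈ halfBall q r → P p} ∈ 𝓝[{p : ℝ × E | 0 ≤ p.1}] (0, q) :=
    mem_nhdsWithin_of_mem_nhds (eventually_nhdsWithin_iff.1 h)
  obtain ⟨r', hr', hsub⟩ := exists_halfBall_subset h'
  exact ⟨min r r', lt_min hr hr', min_le_left _ _, fun p hp =>
    hsub (halfBall_mono (min_le_right _ _) hp) (halfBall_mono (min_le_left _ _) hp)⟩

variable {E W : Type} [NormedAddCommGroup E] [InnerProductSpace ℝ E] [FiniteDimensional ℝ E]
  [NormedAddCommGroup W] [NormedSpace ℝ W]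

/-- The data of the eikonal equation on a half ball: a family `G` of symmetric bilinear forms on
covectors, the covector `θ` of the given defining function, and the covectors `τ` and `K η` for
which `θ + x (σ τ + K η)` is the covector of the defining function multiplied by `e^ω`, when
`dω = σ dx + x η`. The last three conditions state that the given defining function solves the
eikonal equation at the boundary and that the vector field dual to `θ` vanishes there. -/
structure IsEikonalData (q₀ : E) (r : ℝ) (G : ℝ × E → W →L[ℝ] W →L[ℝ] ℝ) (θ : ℝ × E → W) (τ : W)
    (K : ℝ × E → (E →L[ℝ] ℝ) →L[ℝ] W) : Prop where
  pos : 0 < r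
  contDiffOn_G : ContDiffOn ℝ ∞ G (halfBall q₀ r)
  contDiffOn_θ : ContDiffOn ℝ ∞ θ (halfBall q₀ r)
  contDiffOn_K : ContDiffOn ℝ ∞ K (halfBall q₀ r)
  symm : ∀ p ∈ halfBall q₀ r, ∀ α β, G p α β = G p β α
  normSq : ∀ q ∈ Metric.ball q₀ r, G (0, q) (θ (0, q)) (θ (0, q)) = 1
  sharp : ∀ q ∈ Metric.ball q₀ r, ∀ η, G (0, q) (θ (0, q)) (K (0, q) η) = 0
  apply_τ : ∀ q ∈ Metric.ball q₀ r, G (0, q) (θ (0, q)) τ = 1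

variable {q₀ : E} {r : ℝ} {G : ℝ × E → W →L[ℝ] W →L[ℝ] ℝ} {θ : ℝ × E → W} {τ : W}
  {K : ℝ × E → (E →L[ℝ] ℝ) →L[ℝ] W}

theorem IsEikonalData.mono (h : IsEikonalData q₀ r G θ τ K) {r' : ℝ} (hr' : 0 < r') (hle : r' ≤ r) :
    IsEikonalData q₀ r' G θ τ K where
  pos := hr'
  contDiffOn_G := h.contDiffOn_G.mono (halfBall_mono hle)
  contDiffOn_θ := h.contDiffOn_θ.mono (halfBall_mono hle)
  contDiffOn_K := h.contDiffOn_K.mono (halfBall_mono hle)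
  symm p hp := h.symm p (halfBall_mono hle hp)
  normSq q hq := h.normSq q (Metric.ball_subset_ball hle hq)
  sharp q hq := h.sharp q (Metric.ball_subset_ball hle hq)
  apply_τ q hq := h.apply_τ q (Metric.ball_subset_ball hle hq)

/-- For `x > 0` the eikonal equation is divided by `x`. -/
theorem IsEikonalData.exists_reduced (h : IsEikonalData q₀ r G θ τ K) :
    ∃ (a : ℝ × E → ℝ) (Z : ℝ × E → (E →L[ℝ] ℝ) →L[ℝ] ℝ),
      ContDiffOn ℝ ∞ a (halfBall q₀ r) ∧ ContDiffOn ℝ ∞ Z (halfBall q₀ r) ∧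
      ∀ p ∈ halfBall q₀ r, 0 < p.1 → ∀ (σ : ℝ) (η : E →L[ℝ] ℝ),
        G p (θ p + p.1 • (σ • τ + K p η)) (θ p + p.1 • (σ • τ + K p η)) = 1 ↔
        2 * G p (θ p) τ * σ + p.1 * (2 * Z p η + G p (σ • τ + K p η) (σ • τ + K p η)) = a p := by
  have hGθ : ContDiffOn ℝ ∞ (fun p => G p (θ p)) (halfBall q₀ r) :=
    h.contDiffOn_G.clm_apply h.contDiffOn_θ
  obtain ⟨a, ha, ha'⟩ := exists_eq_smul_of_eq_zero h.pos
    (f := fun p => 1 - G p (θ p) (θ p))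
    (contDiffOn_const.sub (hGθ.clm_apply h.contDiffOn_θ))
    (fun q hq => by rw [h.normSq q hq, sub_self])
  obtain ⟨Z, hZ, hZ'⟩ := exists_eq_smul_of_eq_zero h.pos
    (f := fun p => (G p (θ p)).comp (K p))
    (hGθ.clm_comp h.contDiffOn_K)
    (fun q hq => by ext η; exact h.sharp q hq η)
  refine ⟨a, Z, ha, hZ, fun p hp hx σ η => ?_⟩
  have h1 : 1 - G p (θ p) (θ p) = p.1 * a p := ha' p hp
  have h2 : G p (θ p) (K p η) = p.1 * Z p η := DFunLike.congr_fun (hZ' p hp) η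
  have h3 : G p (θ p + p.1 • (σ • τ + K p η)) (θ p + p.1 • (σ • τ + K p η)) =
      G p (θ p) (θ p) + 2 * p.1 * (σ * G p (θ p) τ + G p (θ p) (K p η)) +
        p.1 ^ 2 * G p (σ • τ + K p η) (σ • τ + K p η) := by
    have h4 : ∀ α, G p (θ p + p.1 • α) (θ p + p.1 • α) =
        G p (θ p) (θ p) + 2 * p.1 * G p (θ p) α + p.1 ^ 2 * G p α α := fun α => by
      simp only [map_add, map_smul, add_apply, smul_apply, smul_eq_mul]
      rw [h.symm p hp α (θ p)]
      ring
    rw [h4, map_add (G p (θ p)), map_smul (G p (θ p)), smul_eq_mul]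
  rw [h3, h2]
  constructor
  · intro h4
    refine mul_left_cancel₀ hx.ne' ?_
    linear_combination h4 + h1
  · intro h4
    linear_combination p.1 * h4 - h1

/-- Local existence for the eikonal equation. -/
theorem IsEikonalData.exists_solution (h : IsEikonalData q₀ r G θ τ K) :
    ∃ r' > 0, r' ≤ r ∧ ∃ u : ℝ × E → ℝ, ContDiffOn ℝ ∞ u (halfBall q₀ r') ∧
      ∀ p ∈ halfBall q₀ r', 0 < p.1 → ∃ (σ : ℝ) (η : E →L[ℝ] ℝ),
        G p (θ p + p.1 • (σ • τ + K p η)) (θ p + p.1 • (σ • τ + K p η)) = 1 ∧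
        HasFDerivAt (fun p => p.1 * u p) (σ • ContinuousLinearMap.fst ℝ ℝ E +
          p.1 • η.comp (ContinuousLinearMap.snd ℝ ℝ E)) p := by
  obtain ⟨a, Z, ha, hZ, haZ⟩ := h.exists_reduced
  have hc : ContDiffOn ℝ ∞ (fun p => G p (θ p) τ) (halfBall q₀ r) :=
    (h.contDiffOn_G.clm_apply h.contDiffOn_θ).clm_apply contDiffOn_const
  have hq₀ : ((0, q₀) : ℝ × E) ∈ halfBall q₀ r := ⟨⟨le_rfl, h.pos⟩, Metric.mem_ball_self h.pos⟩
  obtain ⟨r₁, hr₁, hr₁r, hne⟩ := exists_halfBall_of_eventually (P := fun p => G p (θ p) τ ≠ 0) h.pos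
    ((hc.continuousOn _ hq₀).eventually_ne (by
      simp [h.apply_τ q₀ (Metric.mem_ball_self h.pos)]))
  have hsub := halfBall_mono (q := q₀) hr₁r
  have hfst : ∀ z ∈ halfBall q₀ r₁ ×ˢ (univ : Set ((E →L[ℝ] ℝ) × ℝ)), z.1 ∈ halfBall q₀ r :=
    fun z hz => hsub hz.1
  have hβ : ContDiffOn ℝ ∞ (fun z : (ℝ × E) × ((E →L[ℝ] ℝ) × ℝ) => z.2.2 • τ + K z.1 z.2.1)
      (halfBall q₀ r₁ ×ˢ univ) :=
    ContDiffOn.add (by fun_prop)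
      ((h.contDiffOn_K.comp contDiffOn_fst hfst).clm_apply (by fun_prop))
  obtain ⟨r', hr', hle, u, hu, hu'⟩ := exists_solution_singular hr₁
    (F := fun z => (a z.1 - z.1.1 * (2 * Z z.1 z.2.1 +
      G z.1 (z.2.2 • τ + K z.1 z.2.1) (z.2.2 • τ + K z.1 z.2.1))) / (2 * G z.1 (θ z.1) τ))
    (by
      refine ContDiffOn.div ?_ (contDiffOn_const.mul (hc.comp contDiffOn_fst hfst))
        fun z hz => mul_ne_zero two_ne_zero (hne _ hz.1)
      refine (ha.comp contDiffOn_fst hfst).sub (ContDiffOn.mul (by fun_prop) ?_)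
      refine (contDiffOn_const.mul ((hZ.comp contDiffOn_fst hfst).clm_apply (by fun_prop))).add ?_
      exact ((h.contDiffOn_G.comp contDiffOn_fst hfst).clm_apply hβ).clm_apply hβ)
    (fun q hq w w' => by simp)
  refine ⟨r', hr', hle.trans hr₁r, u, hu, fun p hp hx => ?_⟩
  obtain ⟨σ, η, hσ, hd⟩ := hu' p hp hx
  refine ⟨σ, η, ?_, hd⟩
  rw [haZ p (halfBall_mono (hle.trans hr₁r) hp) hx]
  have h1 := hne p (halfBall_mono hle hp)
  rw [eq_div_iff (mul_ne_zero two_ne_zero h1)] at hσ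
  linear_combination hσ

/-- Local uniqueness for the eikonal equation. The difference of two solutions is constant in
directions `(1, b)` with `b` bounded, since the quadratic part of the equation carries a factor
`x`. -/
theorem IsEikonalData.eq_of_solution (h : IsEikonalData q₀ r G θ τ K) {u₁ u₂ : ℝ × E → ℝ}
    (hu₁ : ContDiffOn ℝ ∞ u₁ (halfBall q₀ r)) (hu₂ : ContDiffOn ℝ ∞ u₂ (halfBall q₀ r))
    (h₁ : ∀ p ∈ halfBall q₀ r, 0 < p.1 → ∀ (σ : ℝ) (η : E →L[ℝ] ℝ),
      HasFDerivAt (fun p => p.1 * u₁ p) (σ • ContinuousLinearMap.fst ℝ ℝ E +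
        p.1 • η.comp (ContinuousLinearMap.snd ℝ ℝ E)) p →
      G p (θ p + p.1 • (σ • τ + K p η)) (θ p + p.1 • (σ • τ + K p η)) = 1)
    (h₂ : ∀ p ∈ halfBall q₀ r, 0 < p.1 → ∀ (σ : ℝ) (η : E →L[ℝ] ℝ),
      HasFDerivAt (fun p => p.1 * u₂ p) (σ • ContinuousLinearMap.fst ℝ ℝ E +
        p.1 • η.comp (ContinuousLinearMap.snd ℝ ℝ E)) p →
      G p (θ p + p.1 • (σ • τ + K p η)) (θ p + p.1 • (σ • τ + K p η)) = 1) :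
    ∃ r' > 0, r' ≤ r ∧ ∀ p ∈ halfBall q₀ r', p.1 * u₁ p = p.1 * u₂ p := by
  obtain ⟨a, Z, ha, hZ, haZ⟩ := h.exists_reduced
  obtain ⟨J, hJ⟩ := exists_reflexivity_map (E := E)
  have huniq := uniqueDiffOn_halfBall q₀ h.pos
  set T := halfBall q₀ r with hT
  -- the covectors `σ dx + x η` of the solutions extend continuously to the boundary
  let σ : (ℝ × E → ℝ) → ℝ × E → ℝ := fun u p => u p + p.1 * fderivWithin ℝ u T p (1, 0)
  let η : (ℝ × E → ℝ) → ℝ × E → E →L[ℝ] ℝ := fun u p =>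
    (fderivWithin ℝ u T p).comp (ContinuousLinearMap.inr ℝ ℝ E)
  have hder : ∀ u, ContDiffOn ℝ ∞ u T → ∀ p ∈ T, 0 < p.1 → HasFDerivAt (fun p => p.1 * u p)
      (σ u p • ContinuousLinearMap.fst ℝ ℝ E +
        p.1 • (η u p).comp (ContinuousLinearMap.snd ℝ ℝ E)) p := by
    intro u hu p hp hx
    have h3 := ((hu.differentiableOn (by simp)) p hp).hasFDerivWithinAt.hasFDerivAt
      (halfBall_mem_nhds hp hx)
    refine ((hasFDerivAt_fst (𝕜 := ℝ) (p := p)).mul h3).congr_fderiv ?_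
    refine ContinuousLinearMap.ext fun v => ?_
    have h4 : fderivWithin ℝ u T p v = v.1 * fderivWithin ℝ u T p (1, 0) +
        fderivWithin ℝ u T p (0, v.2) := by
      rw [← smul_eq_mul, ← map_smul, ← map_add]
      simp
    simp [σ, η, h4]
    ring
  have hσc : ∀ u, ContDiffOn ℝ ∞ u T → ContinuousOn (σ u) T := fun u hu =>
    hu.continuousOn.add (continuousOn_fst.mul
      ((hu.continuousOn_fderivWithin huniq (by simp)).clm_apply continuousOn_const))
  have hηc : ∀ u, ContDiffOn ℝ ∞ u T → ContinuousOn (η u) T := fun u hu =>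
    (hu.continuousOn_fderivWithin huniq (by simp)).clm_comp continuousOn_const
  let β : (ℝ × E → ℝ) → ℝ × E → W := fun u p => σ u p • τ + K p (η u p)
  have hβc : ∀ u, ContDiffOn ℝ ∞ u T → ContinuousOn (β u) T := fun u hu =>
    ((hσc u hu).smul continuousOn_const).add (h.contDiffOn_K.continuousOn.clm_apply (hηc u hu))
  -- the coefficients of the linear equation for the difference
  let c : ℝ × E → ℝ := fun p => 2 * G p (θ p) τ + p.1 * G p (β u₁ p + β u₂ p) τ
  let Y : ℝ × E → (E →L[ℝ] ℝ) →L[ℝ] ℝ := fun p =>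
    (2 : ℝ) • Z p + (G p (β u₁ p + β u₂ p)).comp (K p)
  have hGβ : ContinuousOn (fun p => G p (β u₁ p + β u₂ p)) T :=
    h.contDiffOn_G.continuousOn.clm_apply ((hβc u₁ hu₁).add (hβc u₂ hu₂))
  have hcc : ContinuousOn c T :=
    (continuousOn_const.mul ((h.contDiffOn_G.continuousOn.clm_apply
      h.contDiffOn_θ.continuousOn).clm_apply continuousOn_const)).add
      (continuousOn_fst.mul (hGβ.clm_apply continuousOn_const))
  have hYc : ContinuousOn Y T :=
    (hZ.continuousOn.const_smul (2 : ℝ)).add (hGβ.clm_comp h.contDiffOn_K.continuousOn)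
  have hq₀ : ((0, q₀) : ℝ × E) ∈ T := ⟨⟨le_rfl, h.pos⟩, Metric.mem_ball_self h.pos⟩
  have hc0 : 1 < c (0, q₀) := by
    simp [c, h.apply_τ q₀ (Metric.mem_ball_self h.pos)]
  have hJY : ContinuousOn (fun p => J (Y p)) T := J.continuous.comp_continuousOn hYc
  have hYn : ∀ᶠ p in 𝓝[T] (0, q₀), ‖J (Y p)‖ < ‖J (Y (0, q₀))‖ + 1 :=
    (hJY _ hq₀).norm.eventually_lt_const (lt_add_one _)
  obtain ⟨r₁, hr₁, hr₁r, hev⟩ := exists_halfBall_of_eventually h.pos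
    (((hcc _ hq₀).eventually_const_lt hc0).and hYn)
  have hsub := halfBall_mono (q := q₀) hr₁r
  obtain ⟨r', hr', hle, hz⟩ := eq_zero_of_transport (M := ‖J (Y (0, q₀))‖ + 1) hr₁
    (w := fun p => p.1 * u₁ p - p.1 * u₂ p)
    (((continuousOn_fst.mul hu₁.continuousOn).sub (continuousOn_fst.mul hu₂.continuousOn)).mono
      hsub) (fun q _ => by simp) (by
      intro p hp hx
      obtain ⟨hc1, hY1⟩ := hev p hp
      have hd₁ := hder u₁ hu₁ p (hsub hp) hx
      have hd₂ := hder u₂ hu₂ p (hsub hp) hx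
      refine ⟨(c p)⁻¹ • J (Y p), _, ?_, hd₁.sub hd₂, ?_⟩
      · rw [norm_smul, norm_inv, Real.norm_of_nonneg (zero_le_one.trans hc1.le)]
        calc (c p)⁻¹ * ‖J (Y p)‖ ≤ 1 * ‖J (Y p)‖ := by
              gcongr
              exact inv_le_one_of_one_le₀ hc1.le
          _ ≤ _ := by rw [one_mul]; exact hY1.le
      · have e₁ := (haZ p (hsub hp) hx _ _).1 (h₁ p (hsub hp) hx _ _ hd₁)
        have e₂ := (haZ p (hsub hp) hx _ _).1 (h₂ p (hsub hp) hx _ _ hd₂)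
        have e₃ : G p (β u₁ p) (β u₁ p) - G p (β u₂ p) (β u₂ p) =
            (σ u₁ p - σ u₂ p) * G p (β u₁ p + β u₂ p) τ +
              G p (β u₁ p + β u₂ p) (K p (η u₁ p - η u₂ p)) := by
          have e₄ : (σ u₁ p - σ u₂ p) • τ + K p (η u₁ p - η u₂ p) = β u₁ p - β u₂ p := by
            simp only [β, map_sub, sub_smul]; abel
          have e₉ : ∀ α α', G p α α - G p α' α' = G p (α + α') (α - α') := fun α α' => by
            simp only [map_sub, map_add, add_apply]
            rw [h.symm p (hsub hp) α' α]
            ring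
          rw [e₉, ← e₄, map_add, map_smul, smul_eq_mul]
        have e₅ : c p * (σ u₁ p - σ u₂ p) + p.1 * Y p (η u₁ p - η u₂ p) = 0 := by
          have e₆ : Y p (η u₁ p - η u₂ p) = 2 * (Z p (η u₁ p) - Z p (η u₂ p)) +
              G p (β u₁ p + β u₂ p) (K p (η u₁ p - η u₂ p)) := by
            rw [← map_sub]; rfl
          rw [e₆]
          simp only [c]
          linear_combination e₁ - e₂ - p.1 * e₃
        have e₇ : (η u₁ p - η u₂ p) ((c p)⁻¹ • J (Y p)) = (c p)⁻¹ * Y p (η u₁ p - η u₂ p) := by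
          rw [map_smul, hJ, smul_eq_mul]
        have hc2 : c p ≠ 0 := (zero_lt_one.trans hc1).ne'
        have e₈ : (σ u₁ p - σ u₂ p) + p.1 * (η u₁ p - η u₂ p) ((c p)⁻¹ • J (Y p)) = 0 := by
          rw [e₇]
          field_simp
          linear_combination e₅
        refine Eq.trans ?_ e₈
        simp only [sub_apply, add_apply, smul_apply, ContinuousLinearMap.comp_apply,
          ContinuousLinearMap.coe_fst', ContinuousLinearMap.coe_snd', smul_eq_mul]
        ring)
  exact ⟨r', hr', hle.trans hr₁r, fun p hp => sub_eq_zero.1 (hz p hp)⟩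

end Eikonal

/-! ### Boundary charts with values in a half-space `ℝ × E` -/

section HalfChart

/-- The splitting `ℝ^(m+1) ≃ ℝ × ℝ^m` that isolates the first coordinate. -/
def halfSplit (m : ℕ) : EuclideanSpace ℝ (Fin (m + 1)) ≃L[ℝ] ℝ × EuclideanSpace ℝ (Fin m) :=
  LinearEquiv.toContinuousLinearEquiv
    { toFun := fun y => (y 0, WithLp.toLp 2 fun i => y i.succ)
      invFun := fun p => WithLp.toLp 2 (Fin.cons p.1 fun i => p.2 i)
      map_add' := fun _ _ => rfl
      map_smul' := fun _ _ => rfl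
      left_inv := fun y => by
        ext i
        refine Fin.cases ?_ (fun j => ?_) i <;> simp
      right_inv := fun p => by
        refine Prod.ext (by simp) ?_
        ext i
        simp }

variable {m : ℕ} {X : Type*} [TopologicalSpace X] [ChartedSpace (EuclideanHalfSpace (m + 1)) X]

/-- The chart at `p`, with values in `ℝ × ℝ^m`; the boundary is where the first coordinate
vanishes. -/
def halfChart (p : X) : PartialEquiv X (ℝ × EuclideanSpace ℝ (Fin m)) :=
  (extChartAt (𝓡∂ (m + 1)) p).trans (halfSplit m).toEquiv.toPartialEquiv

theorem halfChart_source (p : X) :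
    (halfChart (m := m) p).source = (chartAt (EuclideanHalfSpace (m + 1)) p).source := by
  simp [halfChart]

theorem halfChart_source_eq (p : X) :
    (halfChart (m := m) p).source = (extChartAt (𝓡∂ (m + 1)) p).source := by
  simp [halfChart]

theorem halfChart_target (p : X) :
    (halfChart (m := m) p).target =
      (halfSplit m).symm ⁻¹' (extChartAt (𝓡∂ (m + 1)) p).target := by
  rw [halfChart, PartialEquiv.trans_target]
  simp [Equiv.toPartialEquiv]

theorem isOpen_halfChart_source (p : X) : IsOpen (halfChart (m := m) p).source := by
  rw [halfChart_source]
  exact (chartAt _ p).open_source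

theorem mem_halfChart_source (p : X) : p ∈ (halfChart (m := m) p).source := by
  rw [halfChart_source]
  exact mem_chart_source _ p

theorem mem_halfChart_target_fst {p : X} {y : ℝ × EuclideanSpace ℝ (Fin m)}
    (hy : y ∈ (halfChart p).target) : 0 ≤ y.1 := by
  rw [halfChart_target] at hy
  have h := extChartAt_target_subset_range (I := 𝓡∂ (m + 1)) p hy
  rw [range_modelWithCornersEuclideanHalfSpace] at h
  have h2 : 0 ≤ (halfSplit m ((halfSplit m).symm y)).1 := h
  simpa using h2

theorem fst_halfChart_nonneg {p r : X} (hr : r ∈ (halfChart (m := m) p).source) :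
    0 ≤ (halfChart (m := m) p r).1 :=
  mem_halfChart_target_fst ((halfChart p).map_source hr)

theorem halfChart_target_mem_nhdsWithin {p : X} {y : ℝ × EuclideanSpace ℝ (Fin m)}
    (hy : y ∈ (halfChart p).target) :
    (halfChart (m := m) p).target ∈ 𝓝[{z : ℝ × EuclideanSpace ℝ (Fin m) | 0 ≤ z.1}] y := by
  have h1 : (extChartAt (𝓡∂ (m + 1)) p).target ∈ 𝓝[range (𝓡∂ (m + 1))] ((halfSplit m).symm y) := by
    have := hy
    rw [halfChart_target] at this
    exact extChartAt_target_mem_nhdsWithin_of_mem this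
  rw [halfChart_target]
  have h2 : Tendsto (halfSplit m).symm (𝓝[{z : ℝ × EuclideanSpace ℝ (Fin m) | 0 ≤ z.1}] y)
      (𝓝[range (𝓡∂ (m + 1))] ((halfSplit m).symm y)) := by
    refine ((halfSplit m).symm.continuous.tendsto y).inf ?_
    rw [tendsto_principal_principal]
    intro z hz
    rw [range_modelWithCornersEuclideanHalfSpace]
    have h3 : 0 ≤ (halfSplit m ((halfSplit m).symm z)).1 := by simpa using hz
    exact h3
  exact h2 h1

theorem isOpen_inter_preimage_halfChart (p : X) {s : Set (ℝ × EuclideanSpace ℝ (Fin m))}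
    (hs : IsOpen s) : IsOpen ((halfChart (m := m) p).source ∩ halfChart (m := m) p ⁻¹' s) := by
  rw [halfChart_source_eq]
  exact isOpen_extChartAt_preimage' p (hs.preimage (halfSplit m).continuous)

variable [IsManifold (𝓡∂ (m + 1)) ∞ X]

theorem contMDiffOn_halfChart (p : X) :
    ContMDiffOn (𝓡∂ (m + 1)) 𝓘(ℝ, ℝ × EuclideanSpace ℝ (Fin m)) ∞ (halfChart (m := m) p)
      (halfChart (m := m) p).source := by
  have h : ContMDiff 𝓘(ℝ, EuclideanSpace ℝ (Fin (m + 1))) 𝓘(ℝ, ℝ × EuclideanSpace ℝ (Fin m)) ∞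
      (halfSplit m) := (halfSplit m).contDiff.contMDiff
  rw [halfChart_source]
  exact h.comp_contMDiffOn contMDiffOn_extChartAt

theorem contMDiffOn_halfChart_symm (p : X) :
    ContMDiffOn 𝓘(ℝ, ℝ × EuclideanSpace ℝ (Fin m)) (𝓡∂ (m + 1)) ∞ (halfChart (m := m) p).symm
      (halfChart (m := m) p).target := by
  have h : ContMDiff 𝓘(ℝ, ℝ × EuclideanSpace ℝ (Fin m)) 𝓘(ℝ, EuclideanSpace ℝ (Fin (m + 1))) ∞
      (halfSplit m).symm := (halfSplit m).symm.contDiff.contMDiff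
  rw [halfChart_target]
  exact (contMDiffOn_extChartAt_symm p).comp h.contMDiffOn fun y hy => hy

theorem mem_interior_iff_halfChart {p r : X} (hr : r ∈ (halfChart (m := m) p).source) :
    r ∈ (𝓡∂ (m + 1)).interior X ↔ 0 < (halfChart (m := m) p r).1 := by
  have hr' := hr
  rw [halfChart_source] at hr'
  have h1 := (𝓡∂ (m + 1)).isInteriorPoint_iff_of_mem_atlas (n := ∞) (by simp)
    (chart_mem_atlas (EuclideanHalfSpace (m + 1)) p) hr'
  refine h1.trans ?_
  change extChartAt (𝓡∂ (m + 1)) p r ∈ interior (extChartAt (𝓡∂ (m + 1)) p).target ↔ _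
  have h2 : extChartAt (𝓡∂ (m + 1)) p r ∈ (extChartAt (𝓡∂ (m + 1)) p).target :=
    (extChartAt (𝓡∂ (m + 1)) p).map_source (by rwa [← halfChart_source_eq])
  have h3 : extChartAt (𝓡∂ (m + 1)) p r ∈ interior (extChartAt (𝓡∂ (m + 1)) p).target ↔
      extChartAt (𝓡∂ (m + 1)) p r ∈ interior (range (𝓡∂ (m + 1))) := by
    refine ⟨fun h => interior_mono (extChartAt_target_subset_range p) h, fun h => ?_⟩
    have h4 := extChartAt_target_mem_nhdsWithin_of_mem (I := 𝓡∂ (m + 1)) h2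
    rw [mem_interior_iff_mem_nhds] at h ⊢
    rwa [nhdsWithin_eq_nhds.2 h] at h4
  rw [h3, interior_range_modelWithCornersEuclideanHalfSpace]
  rfl

theorem mem_boundary_iff_halfChart {p r : X} (hr : r ∈ (halfChart (m := m) p).source) :
    r ∈ (𝓡∂ (m + 1)).boundary X ↔ (halfChart (m := m) p r).1 = 0 := by
  have h1 : r ∈ (𝓡∂ (m + 1)).boundary X ↔ ¬ r ∈ (𝓡∂ (m + 1)).interior X := by
    rw [← ModelWithCorners.compl_interior]
    rfl
  rw [h1, mem_interior_iff_halfChart hr, not_lt]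
  exact ⟨fun h => le_antisymm h (fst_halfChart_nonneg hr), fun h => h.le⟩

/-- The differential at `r` of the boundary chart at `p`. -/
def dHalfChart (p r : X) :
    TangentSpace (𝓡∂ (m + 1)) r →L[ℝ] ℝ × EuclideanSpace ℝ (Fin m) :=
  mfderiv (𝓡∂ (m + 1)) 𝓘(ℝ, ℝ × EuclideanSpace ℝ (Fin m)) (halfChart (m := m) p) r

theorem hasMFDerivAt_halfChart {p r : X} (hr : r ∈ (halfChart (m := m) p).source) :
    HasMFDerivAt (𝓡∂ (m + 1)) 𝓘(ℝ, ℝ × EuclideanSpace ℝ (Fin m)) (halfChart (m := m) p) r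
      (dHalfChart p r) :=
  (((contMDiffOn_halfChart p).contMDiffAt ((isOpen_halfChart_source p).mem_nhds hr)).mdifferentiableAt
    (by simp)).hasMFDerivAt

theorem dHalfChart_eq {p r : X} (hr : r ∈ (halfChart (m := m) p).source)
    (v : TangentSpace (𝓡∂ (m + 1)) r) :
    dHalfChart p r v = halfSplit m ((trivializationAt (EuclideanSpace ℝ (Fin (m + 1)))
      (TangentSpace (𝓡∂ (m + 1))) p).continuousLinearMapAt ℝ r v) := by
  have hr' := hr
  rw [halfChart_source] at hr'
  have : IsManifold (𝓡∂ (m + 1)) 1 X := IsManifold.of_le (n := ∞) (by norm_cast)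
  rw [TangentBundle.continuousLinearMapAt_trivializationAt hr']
  have h1 : HasMFDerivAt (𝓡∂ (m + 1)) 𝓘(ℝ, EuclideanSpace ℝ (Fin (m + 1)))
      (extChartAt (𝓡∂ (m + 1)) p) r (mfderiv (𝓡∂ (m + 1)) 𝓘(ℝ, EuclideanSpace ℝ (Fin (m + 1)))
        (extChartAt (𝓡∂ (m + 1)) p) r) := (mdifferentiableAt_extChartAt hr').hasMFDerivAt
  have h2 := ((halfSplit m).hasFDerivAt
    (x := extChartAt (𝓡∂ (m + 1)) p r)).hasMFDerivAt.comp r h1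
  have h3 := hasMFDerivAt_unique (hasMFDerivAt_halfChart hr) h2
  rw [h3]
  rfl

end HalfChart

/-! ### Functions and vector fields in a boundary chart -/

section ChartBall

variable {m : ℕ} {X : Type*} [TopologicalSpace X] [ChartedSpace (EuclideanHalfSpace (m + 1)) X]

/-- The second coordinate of `p` in the boundary chart at `p`. -/
def chartCenter (p : X) : EuclideanSpace ℝ (Fin m) := (halfChart (m := m) p p).2

/-- The part of the chart domain at `p` corresponding to the half ball of radius `r`. -/
def chartBall (m : ℕ) {X : Type*} [TopologicalSpace X]
    [ChartedSpace (EuclideanHalfSpace (m + 1)) X] (p : X) (r : ℝ) : Set X :=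
  (halfChart (m := m) p).source ∩ halfChart (m := m) p ⁻¹' halfBall (chartCenter p) r

theorem isOpen_chartBall (p : X) (r : ℝ) : IsOpen (chartBall m p r) := by
  have h := isOpen_inter_preimage_halfChart (m := m) p
    (isOpen_Ioo (a := -1) (b := r) |>.prod (Metric.isOpen_ball (x := chartCenter (m := m) p) (ε := r)))
  convert h using 1
  ext x
  refine and_congr_right fun hx => ?_
  have h0 := fst_halfChart_nonneg hx
  refine ⟨fun h => ⟨⟨by linarith, h.1.2⟩, h.2⟩, fun h => ⟨⟨h0, h.1.2⟩, h.2⟩⟩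

theorem chartBall_mono (p : X) {r s : ℝ} (h : r ≤ s) : chartBall m p r ⊆ chartBall m p s :=
  inter_subset_inter_right _ (preimage_mono (halfBall_mono h))

theorem symm_mem_chartBall {p : X} {r : ℝ}
    (hr : halfBall (chartCenter (m := m) p) r ⊆ (halfChart (m := m) p).target)
    {y : ℝ × EuclideanSpace ℝ (Fin m)} (hy : y ∈ halfBall (chartCenter p) r) :
    (halfChart p).symm y ∈ chartBall m p r := by
  refine ⟨(halfChart p).map_target (hr hy), ?_⟩
  rw [mem_preimage, (halfChart p).right_inv (hr hy)]
  exact hy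

variable [IsManifold (𝓡∂ (m + 1)) ∞ X]

theorem halfChart_self {p : X} (hp : p ∈ (𝓡∂ (m + 1)).boundary X) :
    halfChart (m := m) p p = (0, chartCenter p) :=
  Prod.ext ((mem_boundary_iff_halfChart (mem_halfChart_source p)).1 hp) rfl

theorem mem_chartBall_self {p : X} (hp : p ∈ (𝓡∂ (m + 1)).boundary X) {r : ℝ} (hr : 0 < r) :
    p ∈ chartBall m p r := by
  refine ⟨mem_halfChart_source p, ?_⟩
  rw [mem_preimage, halfChart_self hp]
  exact ⟨⟨le_rfl, hr⟩, Metric.mem_ball_self hr⟩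

theorem chartBall_mem_nhds {p : X} (hp : p ∈ (𝓡∂ (m + 1)).boundary X) {r : ℝ} (hr : 0 < r) :
    chartBall m p r ∈ 𝓝 p :=
  (isOpen_chartBall p r).mem_nhds (mem_chartBall_self hp hr)

theorem exists_chartBall_subset {p : X} (hp : p ∈ (𝓡∂ (m + 1)).boundary X) {N : Set X}
    (hN : N ∈ 𝓝 p) : ∃ r > 0, halfBall (chartCenter (m := m) p) r ⊆ (halfChart (m := m) p).target ∧
      chartBall m p r ⊆ N := by
  have h1 : (halfChart (m := m) p).target ∩ (halfChart (m := m) p).symm ⁻¹' N ∈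
      𝓝[{z : ℝ × EuclideanSpace ℝ (Fin m) | 0 ≤ z.1}] (0, chartCenter (m := m) p) := by
    have hs := mem_halfChart_source (m := m) p
    have ht : (0, chartCenter (m := m) p) ∈ (halfChart (m := m) p).target := by
      rw [← halfChart_self hp]
      exact (halfChart p).map_source hs
    refine inter_mem (halfChart_target_mem_nhdsWithin ht) ?_
    have hc := (contMDiffOn_halfChart_symm p).continuousOn _ ht
    have h2 : (halfChart (m := m) p).symm (0, chartCenter (m := m) p) = p := by
      rw [← halfChart_self hp]
      exact (halfChart p).left_inv hs
    rw [ContinuousWithinAt, h2] at hc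
    exact nhdsWithin_le_of_mem (halfChart_target_mem_nhdsWithin ht) (hc hN)
  obtain ⟨r, hr, h⟩ := exists_halfBall_subset h1
  refine ⟨r, hr, fun y hy => (h hy).1, fun x hx => ?_⟩
  have h3 := (h hx.2).2
  rwa [mem_preimage, (halfChart p).left_inv hx.1] at h3

variable {G : Type*} [NormedAddCommGroup G] [NormedSpace ℝ G]

theorem ContMDiffOn.contDiffOn_halfBall {p : X} {r : ℝ}
    (hr : halfBall (chartCenter (m := m) p) r ⊆ (halfChart (m := m) p).target) {f : X → G}
    (hf : ContMDiffOn (𝓡∂ (m + 1)) 𝓘(ℝ, G) ∞ f (chartBall m p r)) :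
    ContDiffOn ℝ ∞ (fun y => f ((halfChart p).symm y)) (halfBall (chartCenter (m := m) p) r) :=
  contMDiffOn_iff_contDiffOn.1
    (hf.comp ((contMDiffOn_halfChart_symm p).mono hr) fun _ hy => symm_mem_chartBall hr hy)

theorem ContDiffOn.contMDiffOn_chartBall {p : X} {r : ℝ} {f : ℝ × EuclideanSpace ℝ (Fin m) → G}
    (hf : ContDiffOn ℝ ∞ f (halfBall (chartCenter (m := m) p) r)) :
    ContMDiffOn (𝓡∂ (m + 1)) 𝓘(ℝ, G) ∞ (fun x => f (halfChart p x)) (chartBall m p r) :=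
  (contMDiffOn_iff_contDiffOn.2 hf).comp ((contMDiffOn_halfChart p).mono fun _ hx => hx.1)
    fun _ hx => hx.2

/-- The tangent vector at `r` whose coordinate in the boundary chart at `p` is `v`. -/
def dHalfChartSymm (p r : X) (v : ℝ × EuclideanSpace ℝ (Fin m)) :
    TangentSpace (𝓡∂ (m + 1)) r :=
  (trivializationAt (EuclideanSpace ℝ (Fin (m + 1)))
      (TangentSpace (𝓡∂ (m + 1))) p).symmL ℝ r ((halfSplit m).symm v)

theorem dHalfChart_symm {p r : X} (hr : r ∈ (halfChart (m := m) p).source)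
    (v : ℝ × EuclideanSpace ℝ (Fin m)) : dHalfChart p r (dHalfChartSymm p r v) = v := by
  have : IsManifold (𝓡∂ (m + 1)) 1 X := IsManifold.of_le (n := ∞) (by norm_cast)
  rw [dHalfChart_eq hr, dHalfChartSymm, Bundle.Trivialization.continuousLinearMapAt_symmL]
  · simp
  · rwa [TangentBundle.trivializationAt_baseSet, ← halfChart_source]

theorem dHalfChartSymm_dHalfChart {p r : X} (hr : r ∈ (halfChart (m := m) p).source)
    (v : TangentSpace (𝓡∂ (m + 1)) r) : dHalfChartSymm p r (dHalfChart p r v) = v := by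
  have : IsManifold (𝓡∂ (m + 1)) 1 X := IsManifold.of_le (n := ∞) (by norm_cast)
  rw [dHalfChart_eq hr, dHalfChartSymm, ContinuousLinearEquiv.symm_apply_apply,
    Bundle.Trivialization.symmL_continuousLinearMapAt]
  rwa [TangentBundle.trivializationAt_baseSet, ← halfChart_source]

theorem contDiffOn_dHalfChart {p : X} {r : ℝ}
    (hr : halfBall (chartCenter (m := m) p) r ⊆ (halfChart (m := m) p).target)
    (ξ : Cₛ^∞⟮𝓡∂ (m + 1); EuclideanSpace ℝ (Fin (m + 1)),
      (TangentSpace (𝓡∂ (m + 1)) : X → Type _)⟯) :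
    ContDiffOn ℝ ∞ (fun y => dHalfChart p ((halfChart p).symm y) (ξ ((halfChart p).symm y)))
      (halfBall (chartCenter (m := m) p) r) := by
  have : IsManifold (𝓡∂ (m + 1)) 1 X := IsManifold.of_le (n := ∞) (by norm_cast)
  have hb : chartBall m p r ⊆ (trivializationAt (EuclideanSpace ℝ (Fin (m + 1)))
      (TangentSpace (𝓡∂ (m + 1))) p).baseSet := fun x hx => by
    rw [TangentBundle.trivializationAt_baseSet, ← halfChart_source]
    exact hx.1
  have h1 := (Bundle.Trivialization.contMDiffOn_section_iff (IB := 𝓡∂ (m + 1)) (n := ∞)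
    (trivializationAt (EuclideanSpace ℝ (Fin (m + 1))) (TangentSpace (𝓡∂ (m + 1))) p)
    (isOpen_chartBall p r) hb).1 ξ.contMDiff.contMDiffOn
  have h2 := (halfSplit m).contDiff.comp_contDiffOn (n := ∞) (h1.contDiffOn_halfBall hr)
  refine h2.congr fun y hy => ?_
  have hy' := symm_mem_chartBall hr hy
  rw [dHalfChart_eq hy'.1, Bundle.Trivialization.continuousLinearMapAt_apply,
    Bundle.Trivialization.coe_linearMapAt_of_mem _ (hb hy')]
  rfl

/-- A field of smooth chart coordinates, cut off inside the chart, is a smooth vector field. -/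
theorem exists_section_eq_smul {p : X} {r : ℝ} {χ : X → ℝ}
    (hχ : ContMDiff (𝓡∂ (m + 1)) 𝓘(ℝ, ℝ) ∞ χ) (hs : tsupport χ ⊆ chartBall m p r)
    {a : ℝ × EuclideanSpace ℝ (Fin m) → ℝ × EuclideanSpace ℝ (Fin m)}
    (ha : ContDiffOn ℝ ∞ a (halfBall (chartCenter (m := m) p) r)) :
    ∃ ξ : Cₛ^∞⟮𝓡∂ (m + 1); EuclideanSpace ℝ (Fin (m + 1)),
      (TangentSpace (𝓡∂ (m + 1)) : X → Type _)⟯,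
      ∀ x, ξ x = χ x • dHalfChartSymm p x (a (halfChart p x)) := by
  have : IsManifold (𝓡∂ (m + 1)) 1 X := IsManifold.of_le (n := ∞) (by norm_cast)
  have hb : chartBall m p r ⊆ (trivializationAt (EuclideanSpace ℝ (Fin (m + 1)))
      (TangentSpace (𝓡∂ (m + 1))) p).baseSet := fun x hx => by
    rw [TangentBundle.trivializationAt_baseSet, ← halfChart_source]
    exact hx.1
  have h1 := (Bundle.Trivialization.contMDiffOn_section_iff (IB := 𝓡∂ (m + 1)) (n := ∞)
    (s := fun x => dHalfChartSymm p x (a (halfChart p x)))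
    (trivializationAt (EuclideanSpace ℝ (Fin (m + 1))) (TangentSpace (𝓡∂ (m + 1))) p)
    (isOpen_chartBall p r) hb).2 (by
      refine (((halfSplit m).symm.contDiff.comp_contDiffOn ha).contMDiffOn_chartBall).congr
        fun x hx => ?_
      have h2 := Bundle.Trivialization.continuousLinearMapAt_symmL (R := ℝ)
        (trivializationAt (EuclideanSpace ℝ (Fin (m + 1))) (TangentSpace (𝓡∂ (m + 1))) p)
        (hb hx) ((halfSplit m).symm (a (halfChart p x)))
      rw [Bundle.Trivialization.continuousLinearMapAt_apply,
        Bundle.Trivialization.coe_linearMapAt_of_mem _ (hb hx)] at h2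
      exact h2)
  exact ⟨⟨_, hχ.contMDiffOn.smul_section_of_tsupport (isOpen_chartBall p r) hs h1⟩, fun x => rfl⟩

theorem contMDiff_mul_of_tsupport {u : Set X} (hu : IsOpen u) {χ f : X → ℝ}
    (hχ : ContMDiff (𝓡∂ (m + 1)) 𝓘(ℝ, ℝ) ∞ χ) (hs : tsupport χ ⊆ u)
    (hf : ContMDiffOn (𝓡∂ (m + 1)) 𝓘(ℝ, ℝ) ∞ f u) :
    ContMDiff (𝓡∂ (m + 1)) 𝓘(ℝ, ℝ) ∞ (fun x => χ x * f x) := by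
  refine contMDiff_of_tsupport fun x hx => ?_
  have hx' : x ∈ u := hs (closure_mono (fun y hy => left_ne_zero_of_mul hy) hx)
  exact hχ.contMDiffAt.mul (hf.contMDiffAt (hu.mem_nhds hx'))

theorem exists_bump [T2Space X] {p : X} {N : Set X} (hN : N ∈ 𝓝 p) :
    ∃ χ : X → ℝ, ContMDiff (𝓡∂ (m + 1)) 𝓘(ℝ, ℝ) ∞ χ ∧ tsupport χ ⊆ N ∧ ∀ᶠ x in 𝓝 p, χ x = 1 := by
  obtain ⟨χ, -, h⟩ := (SmoothBumpFunction.nhds_basis_tsupport (I := 𝓡∂ (m + 1)) p).mem_iff.1 hN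
  exact ⟨χ, χ.contMDiff, h, χ.eventuallyEq_one⟩

/-- The chain rule in a boundary chart. -/
theorem dif_eq_of_hasFDerivAt {p : X} {r : X} (hr : r ∈ (halfChart (m := m) p).source)
    {f : X → ℝ} {F : ℝ × EuclideanSpace ℝ (Fin m) → ℝ}
    (h : ∀ᶠ x in 𝓝 r, f x = F (halfChart p x))
    {L : ℝ × EuclideanSpace ℝ (Fin m) →L[ℝ] ℝ} (hF : HasFDerivAt F L (halfChart p r))
    (v : TangentSpace (𝓡∂ (m + 1)) r) : EdgeManifold.dif f r v = L (dHalfChart p r v) := by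
  have h1 : HasMFDerivAt (𝓡∂ (m + 1)) 𝓘(ℝ, ℝ) (F ∘ halfChart p) r (L ∘L dHalfChart p r) :=
    hF.hasMFDerivAt.comp r (hasMFDerivAt_halfChart hr)
  have h2 := h1.congr_of_eventuallyEq (f₁ := f) h
  rw [EdgeManifold.dif, h2.mfderiv]
  rfl

end ChartBall

/-! ### The vertical spaces in a boundary chart -/

/-- A smooth family of surjections has, locally, a smooth family of projections with the same
kernels. -/
theorem exists_projection_ker_eq {E Z : Type*} [NormedAddCommGroup E] [NormedSpace ℝ E]
    [NormedAddCommGroup Z] [NormedSpace ℝ Z] [CompleteSpace Z]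
    {D : E → E →L[ℝ] Z} {q₀ : E} {r : ℝ} (hr : 0 < r)
    (hD : ContDiffOn ℝ ∞ D (Metric.ball q₀ r)) {C : Z →L[ℝ] E}
    (hC : D q₀ ∘L C = ContinuousLinearMap.id ℝ Z) :
    ∃ r' > 0, r' ≤ r ∧ ∃ Q : E → E →L[ℝ] E, ContDiffOn ℝ ∞ Q (Metric.ball q₀ r') ∧
      ∀ q ∈ Metric.ball q₀ r', (∀ w, Q q (Q q w) = Q q w) ∧ ∀ w, Q q w = 0 ↔ D q w = 0 := by
  have h1 : ContDiffOn ℝ ∞ (fun q => D q ∘L C) (Metric.ball q₀ r) :=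
    hD.clm_comp contDiffOn_const
  have h2 : ∀ᶠ q in 𝓝 q₀, D q ∘L C ∈ range ((↑) : (Z ≃L[ℝ] Z) → Z →L[ℝ] Z) := by
    have h3 : ContinuousAt (fun q => D q ∘L C) q₀ :=
      (h1.continuousOn).continuousAt (Metric.ball_mem_nhds q₀ hr)
    refine h3 ?_
    have h4 := ContinuousLinearEquiv.nhds (ContinuousLinearEquiv.refl ℝ Z)
    change _ ∈ 𝓝 (D q₀ ∘L C)
    rw [hC]
    exact h4
  obtain ⟨r₁, hr₁, h3⟩ := Metric.eventually_nhds_iff_ball.1 h2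
  have hsub : Metric.ball q₀ (min r r₁) ⊆ Metric.ball q₀ r := Metric.ball_subset_ball (min_le_left _ _)
  have hinv : ∀ q ∈ Metric.ball q₀ (min r r₁), (D q ∘L C).IsInvertible := fun q hq => by
    obtain ⟨e, he⟩ := h3 q (Metric.ball_subset_ball (min_le_right _ _) hq)
    exact ⟨e, he⟩
  refine ⟨min r r₁, lt_min hr hr₁, min_le_left _ _,
    fun q => C ∘L (D q ∘L C).inverse ∘L D q, ?_, fun q hq => ?_⟩
  · refine contDiffOn_const.clm_comp (ContDiffOn.clm_comp (fun q hq => ?_) (hD.mono hsub))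
    obtain ⟨e, he⟩ := hinv q hq
    have h4 : ContDiffAt ℝ ∞ ContinuousLinearMap.inverse (D q ∘L C) := by
      rw [← he]
      exact contDiffAt_map_inverse e
    exact h4.comp_contDiffWithinAt q (h1.mono hsub q hq)
  · have h5 : ∀ z, D q (C ((D q ∘L C).inverse z)) = z := fun z => by
      have := (hinv q hq).self_comp_inverse
      exact congrArg (fun L : Z →L[ℝ] Z => L z) this
    have h6 : ∀ w, D q (C ((D q ∘L C).inverse (D q w))) = D q w := fun w => h5 _
    refine ⟨fun w => ?_, fun w => ⟨fun h => ?_, fun h => ?_⟩⟩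
    · simp only [ContinuousLinearMap.comp_apply, h6]
    · rw [← h6 w]
      simp only [ContinuousLinearMap.comp_apply] at h
      rw [h, map_zero]
    · simp only [ContinuousLinearMap.comp_apply, h, map_zero]

namespace EdgeManifold

variable {m b f : ℕ} {X B Y F : Type*}
  [TopologicalSpace X] [ChartedSpace (EuclideanHalfSpace (m + 1)) X]
  [IsManifold (𝓡∂ (m + 1)) ∞ X]
  [TopologicalSpace B] [ChartedSpace (EuclideanSpace ℝ (Fin m)) B] [IsManifold (𝓡 m) ∞ B]
  [TopologicalSpace Y] [ChartedSpace (EuclideanSpace ℝ (Fin b)) Y] [IsManifold (𝓡 b) ∞ Y]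
  [TopologicalSpace F] [ChartedSpace (EuclideanSpace ℝ (Fin f)) F] [IsManifold (𝓡 f) ∞ F]
  (S : EdgeManifold m b f X B Y F)

theorem incl_mem_boundary (q : B) : S.incl q ∈ (𝓡∂ (m + 1)).boundary X :=
  S.range_incl ▸ mem_range_self q

/-- The immersion normal form of the inclusion gives a smooth local retraction onto the
boundary. -/
theorem exists_retraction (q₀ : B) : ∃ ρ : X → B, ∃ N ∈ 𝓝 (S.incl q₀), IsOpen N ∧
    ContMDiffOn (𝓡∂ (m + 1)) (𝓡 m) ∞ ρ N ∧ ∀ q, S.incl q ∈ N → ρ (S.incl q) = q := by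
  have h : IsImmersionAt (𝓡 m) (𝓡∂ (m + 1)) ∞ S.incl q₀ :=
    S.isSmoothEmbedding_incl.isImmersion.isImmersionAt q₀
  set φ := h.codChart.extend (𝓡∂ (m + 1)) with hφ
  set κ := h.domChart.extend (𝓡 m) with hκ
  let j : X → EuclideanSpace ℝ (Fin m) := fun x => (h.equiv.symm (φ x)).1
  have hj : ContMDiffOn (𝓡∂ (m + 1)) 𝓘(ℝ, EuclideanSpace ℝ (Fin m)) ∞ j h.codChart.source := by
    have h1 : ContMDiffOn (𝓡∂ (m + 1)) 𝓘(ℝ, EuclideanSpace ℝ (Fin (m + 1))) ∞ φ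
      h.codChart.source := h.codChart.contMDiffOn_extend h.codChart_mem_maximalAtlas
    have h2 : ContDiff ℝ ∞ fun z => (h.equiv.symm z).1 :=
      contDiff_fst.comp h.equiv.symm.contDiff
    exact h2.contMDiff.comp_contMDiffOn h1
  have hjincl : ∀ q ∈ h.domChart.source, j (S.incl q) = κ q := fun q hq => by
    have h1 : κ q ∈ κ.target := κ.map_source (by rwa [hκ, OpenPartialHomeomorph.extend_source])
    have h2 := h.writtenInCharts h1
    simp only [Function.comp_apply] at h2
    have h3 : κ.symm (κ q) = q := κ.left_inv (by rwa [hκ, OpenPartialHomeomorph.extend_source])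
    rw [← hκ, ← hφ, h3] at h2
    change (h.equiv.symm (φ (S.incl q))).1 = _
    rw [h2]
    simp
  have htar : IsOpen κ.target := h.domChart.isOpen_extend_target
  obtain ⟨O, hO, hO2⟩ : ∃ O, IsOpen O ∧ S.incl ⁻¹' O = h.domChart.source :=
    S.isSmoothEmbedding_incl.isEmbedding.isInducing.isOpen_iff.1 h.domChart.open_source
  have hNo := (hj.continuousOn.mono inter_subset_left).isOpen_inter_preimage
    (h.codChart.open_source.inter hO) htar
  have hq₀ : q₀ ∈ h.domChart.source := h.mem_domChart_source
  have hκs : κ.source = h.domChart.source := OpenPartialHomeomorph.extend_source _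
  refine ⟨κ.symm ∘ j, _, hNo.mem_nhds ⟨⟨h.mem_codChart_source, ?_⟩, ?_⟩, hNo, ?_, ?_⟩
  · change q₀ ∈ S.incl ⁻¹' O
    rwa [hO2]
  · rw [mem_preimage, hjincl q₀ hq₀]
    exact κ.map_source (by rwa [hκs])
  · have h1 := contMDiffOn_extend_symm (I := 𝓡 m) h.domChart_mem_maximalAtlas
    refine (h1.comp (hj.mono (inter_subset_left.trans inter_subset_left)) fun x hx => ?_)
    have h2 : j x ∈ κ.target := hx.2
    rw [hκ, OpenPartialHomeomorph.extend_target'] at h2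
    exact h2
  · intro q hq
    have hq' : q ∈ h.domChart.source := by
      rw [← hO2]
      exact hq.1.2
    rw [Function.comp_apply, hjincl q hq']
    exact κ.left_inv (by rwa [hκs])

/-- A smooth local section of the fibration, read in a chart of the base. -/
theorem exists_local_section (q₀ : B) : ∃ τ : EuclideanSpace ℝ (Fin b) → B,
    τ (extChartAt (𝓡 b) (S.proj q₀) (S.proj q₀)) = q₀ ∧
    ContMDiffAt (𝓡 b) (𝓡 m) ∞ τ (extChartAt (𝓡 b) (S.proj q₀) (S.proj q₀)) ∧
    ∀ᶠ z in 𝓝 (extChartAt (𝓡 b) (S.proj q₀) (S.proj q₀)),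
      extChartAt (𝓡 b) (S.proj q₀) (S.proj (τ z)) = z := by
  obtain ⟨e, he, h1, h2⟩ := S.locally_trivial (S.proj q₀)
  set c := extChartAt (𝓡 b) (S.proj q₀) with hc
  have hq : q₀ ∈ e.source := e.mem_source.2 he
  have hct : c.target ∈ 𝓝 (c (S.proj q₀)) := extChartAt_target_mem_nhds _
  have hc1 : ContMDiffAt (𝓡 b) (𝓡 b) ∞ c.symm (c (S.proj q₀)) :=
    (contMDiffOn_extChartAt_symm _).contMDiffAt hct
  have hc2 : c.symm (c (S.proj q₀)) = S.proj q₀ := extChartAt_to_inv _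
  let k : EuclideanSpace ℝ (Fin b) → Y × F := fun z => (c.symm z, (e q₀).2)
  have hk : ContMDiffAt (𝓡 b) ((𝓡 b).prod (𝓡 f)) ∞ k (c (S.proj q₀)) :=
    hc1.prodMk contMDiffAt_const
  have hk0 : k (c (S.proj q₀)) = e q₀ := Prod.ext (by rw [e.coe_fst hq]; exact hc2) rfl
  have hkt : k (c (S.proj q₀)) ∈ e.target := hk0 ▸ e.map_source hq
  refine ⟨e.toOpenPartialHomeomorph.symm ∘ k, ?_, ?_, ?_⟩
  · rw [Function.comp_apply, hk0]
    exact e.toOpenPartialHomeomorph.left_inv hq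
  · exact (h2.contMDiffAt (e.open_target.mem_nhds hkt)).comp _ hk
  · filter_upwards [hct, hk.continuousAt (e.open_target.mem_nhds hkt)] with z hz hz2
    have h3 : S.proj (e.toOpenPartialHomeomorph.symm (k z)) = c.symm z := e.proj_symm_apply hz2
    rw [Function.comp_apply, h3, c.right_inv hz]

end EdgeManifold

namespace EdgeManifold

variable {m b f : ℕ} {X B Y F : Type*}
  [TopologicalSpace X] [ChartedSpace (EuclideanHalfSpace (m + 1)) X]
  [IsManifold (𝓡∂ (m + 1)) ∞ X]
  [TopologicalSpace B] [ChartedSpace (EuclideanSpace ℝ (Fin m)) B] [IsManifold (𝓡 m) ∞ B]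
  [TopologicalSpace Y] [ChartedSpace (EuclideanSpace ℝ (Fin b)) Y] [IsManifold (𝓡 b) ∞ Y]
  [TopologicalSpace F] [ChartedSpace (EuclideanSpace ℝ (Fin f)) F] [IsManifold (𝓡 f) ∞ F]
  (S : EdgeManifold m b f X B Y F)

/-- In a boundary chart the fibration is a smooth map `P` of the tangential coordinates, which is a
submersion, and the vertical spaces are the kernels of its differential. -/
theorem exists_fibration_in_chart (q₀ : B) :
    ∃ r > 0, halfBall (chartCenter (m := m) (S.incl q₀)) r ⊆ (halfChart (m := m) (S.incl q₀)).target ∧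
      ∃ P : EuclideanSpace ℝ (Fin m) → EuclideanSpace ℝ (Fin b),
        ContDiffOn ℝ ∞ P (Metric.ball (chartCenter (S.incl q₀)) r) ∧
        (∃ C : EuclideanSpace ℝ (Fin b) →L[ℝ] EuclideanSpace ℝ (Fin m),
          fderiv ℝ P (chartCenter (S.incl q₀)) ∘L C = ContinuousLinearMap.id ℝ _) ∧
        ∀ q : B, S.incl q ∈ chartBall m (S.incl q₀) r →
          ∀ v : TangentSpace (𝓡∂ (m + 1)) (S.incl q), v ∈ S.vertical q ↔
            (dHalfChart (S.incl q₀) (S.incl q) v).1 = 0 ∧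
            fderiv ℝ P (halfChart (S.incl q₀) (S.incl q)).2
              (dHalfChart (S.incl q₀) (S.incl q) v).2 = 0 := by
  obtain ⟨ρ, N, hN, hNo, hρ, hρi⟩ := S.exists_retraction q₀
  set p := S.incl q₀ with hpdef
  have hp : p ∈ (𝓡∂ (m + 1)).boundary X := S.incl_mem_boundary q₀
  set y₀ := S.proj q₀
  set c := extChartAt (𝓡 b) y₀ with hc
  -- the fibration, extended to a neighbourhood of `p` by the retraction
  have hpr : ContinuousOn (S.proj ∘ ρ) N :=
    S.contMDiff_proj.continuous.comp_continuousOn hρ.continuousOn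
  have hN' : N ∩ (S.proj ∘ ρ) ⁻¹' (chartAt (EuclideanSpace ℝ (Fin b)) y₀).source ∈ 𝓝 p := by
    refine (hpr.isOpen_inter_preimage hNo (chartAt _ y₀).open_source).mem_nhds
      ⟨mem_of_mem_nhds hN, ?_⟩
    rw [mem_preimage, Function.comp_apply, hρi q₀ (mem_of_mem_nhds hN)]
    exact mem_chart_source _ _
  obtain ⟨r, hr, hrt, hrN⟩ := exists_chartBall_subset hp hN'
  set c₀ := chartCenter (m := m) p with hc₀
  let PX : X → EuclideanSpace ℝ (Fin b) := fun x => c (S.proj (ρ x))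
  have hPX : ContMDiffOn (𝓡∂ (m + 1)) 𝓘(ℝ, EuclideanSpace ℝ (Fin b)) ∞ PX (chartBall m p r) := by
    refine contMDiffOn_extChartAt.comp (S.contMDiff_proj.comp_contMDiffOn (hρ.mono fun x hx =>
      (hrN hx).1)) fun x hx => (hrN hx).2
  have hP' := hPX.contDiffOn_halfBall hrt
  have hball : ∀ q ∈ Metric.ball c₀ r, ((0 : ℝ), q) ∈ halfBall c₀ r := fun q hq =>
    ⟨⟨le_rfl, hr⟩, hq⟩
  let P : EuclideanSpace ℝ (Fin m) → EuclideanSpace ℝ (Fin b) :=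
    fun q => PX ((halfChart p).symm (0, q))
  have hP : ContDiffOn ℝ ∞ P (Metric.ball c₀ r) :=
    hP'.comp (contDiffOn_const.prodMk contDiffOn_id) hball
  have hPd : ∀ q ∈ Metric.ball c₀ r, HasFDerivAt P (fderiv ℝ P q) q := fun q hq =>
    ((hP.contDiffAt (Metric.isOpen_ball.mem_nhds hq)).differentiableAt (by simp)).hasFDerivAt
  -- `P` is the fibration
  have hchart : ∀ q : B, S.incl q ∈ chartBall m p r →
      halfChart (m := m) p (S.incl q) = (0, (halfChart (m := m) p (S.incl q)).2) := fun q hq =>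
    Prod.ext ((mem_boundary_iff_halfChart hq.1).1 (S.incl_mem_boundary q)) rfl
  have hPincl : ∀ q : B, S.incl q ∈ chartBall m p r →
      P (halfChart (m := m) p (S.incl q)).2 = c (S.proj q) := fun q hq => by
    change PX ((halfChart p).symm (0, _)) = _
    rw [← hchart q hq, (halfChart p).left_inv hq.1]
    change c (S.proj (ρ (S.incl q))) = _
    rw [hρi q (hrN hq).1]
  have hsrc : ∀ q : B, S.incl q ∈ chartBall m p r →
      S.proj q ∈ (chartAt (EuclideanSpace ℝ (Fin b)) y₀).source := fun q hq => by
    have := (hrN hq).2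
    rwa [mem_preimage, Function.comp_apply, hρi q (hrN hq).1] at this
  have hincl := S.isSmoothEmbedding_incl.contMDiff
  have hnear : ∀ q : B, S.incl q ∈ chartBall m p r → ∀ᶠ q' in 𝓝 q, S.incl q' ∈ chartBall m p r :=
    fun q hq => hincl.continuous.continuousAt ((isOpen_chartBall p r).mem_nhds hq)
  have hdincl : ∀ q : B, HasMFDerivAt (𝓡 m) (𝓡∂ (m + 1)) S.incl q
      (mfderiv (𝓡 m) (𝓡∂ (m + 1)) S.incl q) := fun q =>
    ((hincl q).mdifferentiableAt (by simp)).hasMFDerivAt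
  have hdproj : ∀ q : B, HasMFDerivAt (𝓡 m) (𝓡 b) S.proj q
      (mfderiv (𝓡 m) (𝓡 b) S.proj q) := fun q =>
    ((S.contMDiff_proj q).mdifferentiableAt (by simp)).hasMFDerivAt
  refine ⟨r, hr, hrt, P, hP, ?_, fun q hq v => ⟨?_, ?_⟩⟩
  · obtain ⟨τ, hτ0, hτ, hτc⟩ := S.exists_local_section q₀
    let w : EuclideanSpace ℝ (Fin b) → EuclideanSpace ℝ (Fin m) :=
      fun z => (halfChart (m := m) p (S.incl (τ z))).2
    have hw0 : w (c y₀) = c₀ := by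
      change (halfChart p (S.incl (τ (c y₀)))).2 = _
      rw [hτ0]
      rfl
    have hi0 : S.incl (τ (c y₀)) ∈ chartBall m p r := by
      rw [hτ0]
      exact mem_chartBall_self hp hr
    have hcont : ContMDiffAt 𝓘(ℝ, EuclideanSpace ℝ (Fin b))
        𝓘(ℝ, ℝ × EuclideanSpace ℝ (Fin m)) ∞ (fun z => halfChart (m := m) p (S.incl (τ z)))
        (c y₀) :=
      ContMDiffAt.comp (c y₀) ((contMDiffOn_halfChart p).contMDiffAt
        ((isOpen_halfChart_source p).mem_nhds hi0.1)) ((hincl _).comp _ hτ)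
    have hwd : DifferentiableAt ℝ w (c y₀) :=
      ((contMDiffAt_iff_contDiffAt.1 hcont).differentiableAt (n := ∞) (by simp)).snd
    refine ⟨fderiv ℝ w (c y₀), ?_⟩
    have h0 : HasFDerivAt P (fderiv ℝ P c₀) (w (c y₀)) := by
      rw [hw0]
      exact hPd c₀ (Metric.mem_ball_self hr)
    have h1 : HasFDerivAt (fun z => P (w z)) (fderiv ℝ P c₀ ∘L fderiv ℝ w (c y₀)) (c y₀) :=
      h0.comp (c y₀) hwd.hasFDerivAt
    refine h1.unique (((hasFDerivAt_id (𝕜 := ℝ) (c y₀))).congr_of_eventuallyEq ?_)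
    have h2 : ∀ᶠ z in 𝓝 (c y₀), S.incl (τ z) ∈ chartBall m p r :=
      (hincl.continuous.continuousAt.comp hτ.continuousAt)
        ((isOpen_chartBall p r).mem_nhds hi0)
    filter_upwards [h2, hτc] with z hz hz2
    exact (hPincl _ hz).trans hz2
  · rintro ⟨u, hu, rfl⟩
    have hu0 : mfderiv (𝓡 m) (𝓡 b) S.proj q u = 0 := hu
    have h1 : HasMFDerivAt (𝓡 m) 𝓘(ℝ, ℝ × EuclideanSpace ℝ (Fin m))
        (halfChart (m := m) p ∘ S.incl) q
        (dHalfChart p (S.incl q) ∘L mfderiv (𝓡 m) (𝓡∂ (m + 1)) S.incl q) :=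
      (hasMFDerivAt_halfChart hq.1).comp q (hdincl q)
    have h2 := ((ContinuousLinearMap.fst ℝ ℝ (EuclideanSpace ℝ (Fin m))).hasFDerivAt
      (x := (halfChart (m := m) p ∘ S.incl) q)).hasMFDerivAt.comp q h1
    have h3 := ((ContinuousLinearMap.snd ℝ ℝ (EuclideanSpace ℝ (Fin m))).hasFDerivAt
      (x := (halfChart (m := m) p ∘ S.incl) q)).hasMFDerivAt.comp q h1
    constructor
    · have h4 : HasMFDerivAt (𝓡 m) 𝓘(ℝ, ℝ)
          ((ContinuousLinearMap.fst ℝ ℝ (EuclideanSpace ℝ (Fin m))) ∘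
            (halfChart (m := m) p ∘ S.incl)) q 0 := by
        refine (hasMFDerivAt_const (0 : ℝ) q).congr_of_eventuallyEq ?_
        filter_upwards [hnear q hq] with q' hq'
        exact congrArg Prod.fst (hchart q' hq')
      exact congrArg (fun L : TangentSpace (𝓡 m) q →L[ℝ] ℝ => L u) (hasMFDerivAt_unique h2 h4)
    · have h5 : HasMFDerivAt (𝓡 m) 𝓘(ℝ, EuclideanSpace ℝ (Fin b))
          (P ∘ ((ContinuousLinearMap.snd ℝ ℝ (EuclideanSpace ℝ (Fin m))) ∘
            (halfChart (m := m) p ∘ S.incl))) q _ :=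
        HasMFDerivAt.comp q (hPd _ hq.2.2).hasMFDerivAt h3
      have h6 : HasMFDerivAt (𝓡 m) 𝓘(ℝ, EuclideanSpace ℝ (Fin b)) (c ∘ S.proj) q _ :=
        HasMFDerivAt.comp q (mdifferentiableAt_extChartAt (hsrc q hq)).hasMFDerivAt (hdproj q)
      have h7 := hasMFDerivAt_unique (h6.congr_of_eventuallyEq (by
        filter_upwards [hnear q hq] with q' hq'
        exact hPincl q' hq')) h5
      have h8 := congrArg (fun L : TangentSpace (𝓡 m) q →L[ℝ] EuclideanSpace ℝ (Fin b) => L u) h7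
      refine Eq.trans h8.symm ?_
      change mfderiv (𝓡 b) 𝓘(ℝ, EuclideanSpace ℝ (Fin b)) c (S.proj q)
        (mfderiv (𝓡 m) (𝓡 b) S.proj q u) = 0
      rw [hu0]
      exact map_zero _
  · rintro ⟨hv1, hv2⟩
    -- the boundary near `p` is parametrized by `σ`
    let σ : EuclideanSpace ℝ (Fin m) → B := fun z => ρ ((halfChart (m := m) p).symm (0, z))
    set z := (halfChart (m := m) p (S.incl q)).2 with hz
    have hzb : z ∈ Metric.ball c₀ r := hq.2.2
    have hσ : ContMDiffAt (𝓡 m) (𝓡 m) ∞ σ z := by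
      have h1 : ContMDiffOn 𝓘(ℝ, EuclideanSpace ℝ (Fin m)) (𝓡∂ (m + 1)) ∞
          (fun z => (halfChart (m := m) p).symm (0, z)) (Metric.ball c₀ r) :=
        ((contMDiffOn_halfChart_symm p).mono hrt).comp
          (contMDiffOn_iff_contDiffOn.2 (contDiffOn_const.prodMk contDiffOn_id)) hball
      exact (hρ.comp h1 fun z' hz' => (hrN (symm_mem_chartBall hrt (hball z' hz'))).1).contMDiffAt
        (Metric.isOpen_ball.mem_nhds hzb)
    have hσq : σ z = q := by
      change ρ ((halfChart (m := m) p).symm (0, (halfChart (m := m) p (S.incl q)).2)) = q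
      rw [← hchart q hq, (halfChart p).left_inv hq.1, hρi q (hrN hq).1]
    have hinclσ : ∀ z' ∈ Metric.ball c₀ r, halfChart (m := m) p (S.incl (σ z')) = (0, z') := by
      intro z' hz'
      have h1 := symm_mem_chartBall hrt (hball z' hz')
      have h2 : (halfChart (m := m) p).symm (0, z') ∈ (𝓡∂ (m + 1)).boundary X := by
        rw [mem_boundary_iff_halfChart h1.1, (halfChart p).right_inv (hrt (hball z' hz'))]
      rw [← S.range_incl] at h2
      obtain ⟨q', hq'⟩ := h2
      have h3 : σ z' = q' := by
        change ρ ((halfChart (m := m) p).symm (0, z')) = q'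
        rw [← hq']
        exact hρi q' (by rw [hq']; exact (hrN h1).1)
      rw [h3, hq', (halfChart p).right_inv (hrt (hball z' hz'))]
    have hdσ : HasMFDerivAt (𝓡 m) (𝓡 m) σ z (mfderiv (𝓡 m) (𝓡 m) σ z) :=
      (hσ.mdifferentiableAt (by simp)).hasMFDerivAt
    clear_value z
    subst hσq
    set w := (dHalfChart p (S.incl (σ z)) v).2 with hw
    let u : TangentSpace (𝓡 m) (σ z) := mfderiv (𝓡 m) (𝓡 m) σ z w
    have hball' : ∀ᶠ z' in 𝓝 z, z' ∈ Metric.ball c₀ r := Metric.isOpen_ball.mem_nhds hzb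
    have h1 : dHalfChart p (S.incl (σ z)) (mfderiv (𝓡 m) (𝓡∂ (m + 1)) S.incl (σ z) u) = (0, w) := by
      have h2 : HasMFDerivAt (𝓡 m) 𝓘(ℝ, ℝ × EuclideanSpace ℝ (Fin m))
          (halfChart (m := m) p ∘ (S.incl ∘ σ)) z _ :=
        (hasMFDerivAt_halfChart hq.1).comp z ((hdincl (σ z)).comp z hdσ)
      have h3 : HasFDerivAt (fun z' : EuclideanSpace ℝ (Fin m) => ((0 : ℝ), z'))
          ((0 : EuclideanSpace ℝ (Fin m) →L[ℝ] ℝ).prod (ContinuousLinearMap.id ℝ _)) z :=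
        (hasFDerivAt_const (0 : ℝ) z).prodMk (hasFDerivAt_id z)
      have h4 := hasMFDerivAt_unique h2 (h3.hasMFDerivAt.congr_of_eventuallyEq
        (by filter_upwards [hball'] with z' hz' using hinclσ z' hz'))
      exact congrArg (fun L : EuclideanSpace ℝ (Fin m) →L[ℝ] ℝ × EuclideanSpace ℝ (Fin m) => L w) h4
    have h5 : v = mfderiv (𝓡 m) (𝓡∂ (m + 1)) S.incl (σ z) u := by
      rw [← dHalfChartSymm_dHalfChart hq.1 v, ← dHalfChartSymm_dHalfChart hq.1
        (mfderiv (𝓡 m) (𝓡∂ (m + 1)) S.incl (σ z) u), h1, ← hv1]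
    refine ⟨u, ?_, h5.symm⟩
    have h6 : HasMFDerivAt (𝓡 m) 𝓘(ℝ, EuclideanSpace ℝ (Fin b)) (c ∘ (S.proj ∘ σ)) z _ :=
      HasMFDerivAt.comp z (mdifferentiableAt_extChartAt (hsrc _ hq)).hasMFDerivAt
        ((hdproj _).comp z hdσ)
    have h7 := hasMFDerivAt_unique h6 ((hPd z hzb).hasMFDerivAt.congr_of_eventuallyEq
      (Eventually.of_forall fun z' => rfl))
    have h8 := congrArg (fun L : EuclideanSpace ℝ (Fin m) →L[ℝ] EuclideanSpace ℝ (Fin b) => L w) h7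
    have h9 : mfderiv (𝓡 b) 𝓘(ℝ, EuclideanSpace ℝ (Fin b)) c (S.proj (σ z))
        (mfderiv (𝓡 m) (𝓡 b) S.proj (σ z) u) = 0 := by
      exact Eq.trans h8 hv2
    have : IsManifold (𝓡 b) 1 Y := IsManifold.of_le (n := ∞) (by norm_cast)
    have hinj := (isInvertible_mfderiv_extChartAt (I := 𝓡 b) (x := y₀) (y := S.proj (σ z))
      (by rw [extChartAt_source]; exact hsrc _ hq)).injective
    exact hinj (h9.trans (map_zero _).symm)

end EdgeManifold

/-! ### Local frames of edge vector fields -/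

section Anchor

variable {E : Type} [NormedAddCommGroup E] [NormedSpace ℝ E]

/-- The anchor of the edge tangent bundle in a local frame: with respect to a projection `Q` whose
kernel is the vertical space, the edge vector field with constant coefficients `(a, w)` is
`x a ∂ₓ + (1 - Q) w + x Q w`. -/
def edgeAnchor (Q : E → E →L[ℝ] E) (y : ℝ × E) : ℝ × E →L[ℝ] ℝ × E :=
  (y.1 • ContinuousLinearMap.fst ℝ ℝ E).prod
    (ContinuousLinearMap.snd ℝ ℝ E - Q y.2 ∘L ContinuousLinearMap.snd ℝ ℝ E +
      y.1 • (Q y.2 ∘L ContinuousLinearMap.snd ℝ ℝ E))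

theorem edgeAnchor_apply (Q : E → E →L[ℝ] E) (y v : ℝ × E) :
    edgeAnchor Q y v = (y.1 * v.1, v.2 - Q y.2 v.2 + y.1 • Q y.2 v.2) := rfl

theorem contDiffOn_edgeAnchor {Q : E → E →L[ℝ] E} {q₀ : E} {r : ℝ}
    (hQ : ContDiffOn ℝ ∞ Q (Metric.ball q₀ r)) :
    ContDiffOn ℝ ∞ (edgeAnchor Q) (halfBall q₀ r) := by
  have h1 : ContDiffOn ℝ ∞ (fun y : ℝ × E => Q y.2) (halfBall q₀ r) :=
    hQ.comp contDiffOn_snd fun y hy => hy.2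
  have h2 : ContDiffOn ℝ ∞ (fun y : ℝ × E => Q y.2 ∘L ContinuousLinearMap.snd ℝ ℝ E)
      (halfBall q₀ r) := h1.clm_comp contDiffOn_const
  have h3 : ContDiffOn ℝ ∞ (fun y : ℝ × E => y.1 • ContinuousLinearMap.fst ℝ ℝ E)
      (halfBall q₀ r) := contDiffOn_fst.smul contDiffOn_const
  have h4 := (contDiffOn_const (c := ContinuousLinearMap.snd ℝ ℝ E)).sub h2 |>.add
    (contDiffOn_fst.smul h2)
  have h5 : ContDiff ℝ ∞ fun L : (ℝ × E →L[ℝ] ℝ) × (ℝ × E →L[ℝ] E) => L.1.prod L.2 :=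
    (ContinuousLinearMap.prodₗᵢ (𝕜 := ℝ) (E := ℝ × E) (F := ℝ) (G := E) ℝ).toContinuousLinearEquiv.contDiff
  exact h5.comp_contDiffOn (h3.prodMk h4)

theorem edgeAnchor_injective {Q : E → E →L[ℝ] E} {y : ℝ × E}
    (hQ : ∀ w, Q y.2 (Q y.2 w) = Q y.2 w) (hy : 0 < y.1) :
    Function.Injective (edgeAnchor Q y) := by
  rw [injective_iff_map_eq_zero]
  intro v hv
  rw [edgeAnchor_apply, Prod.mk_eq_zero] at hv
  have h1 : v.1 = 0 := (mul_eq_zero.1 hv.1).resolve_left hy.ne'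
  have h2 : Q y.2 v.2 = 0 := by
    have := congrArg (Q y.2) hv.2
    simp only [map_add, map_sub, map_smul, hQ, sub_self, zero_add, map_zero] at this
    exact (smul_eq_zero.1 this).resolve_left hy.ne'
  have h3 : v.2 = 0 := by simpa [h2] using hv.2
  exact Prod.ext h1 h3

/-- A smooth vector field on a half ball which is vertical at the boundary has smooth coefficients
with respect to the edge frame. -/
theorem exists_edgeAnchor_eq [FiniteDimensional ℝ E] {Q : E → E →L[ℝ] E} {q₀ : E} {r : ℝ} (hr : 0 < r)
    (hQ : ContDiffOn ℝ ∞ Q (Metric.ball q₀ r))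
    (hQQ : ∀ q ∈ Metric.ball q₀ r, ∀ w, Q q (Q q w) = Q q w) {ξ : ℝ × E → ℝ × E}
    (hξ : ContDiffOn ℝ ∞ ξ (halfBall q₀ r))
    (h0 : ∀ q ∈ Metric.ball q₀ r, (ξ (0, q)).1 = 0 ∧ Q q (ξ (0, q)).2 = 0) :
    ∃ a : ℝ × E → ℝ × E, ContDiffOn ℝ ∞ a (halfBall q₀ r) ∧
      ∀ y ∈ halfBall q₀ r, edgeAnchor Q y (a y) = ξ y := by
  have : CompleteSpace E := FiniteDimensional.complete ℝ E
  have hξ1 : ContDiffOn ℝ ∞ (fun y => (ξ y).1) (halfBall q₀ r) := contDiff_fst.comp_contDiffOn hξ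
  have hξ2 : ContDiffOn ℝ ∞ (fun y => (ξ y).2) (halfBall q₀ r) := contDiff_snd.comp_contDiffOn hξ
  have hQ' : ContDiffOn ℝ ∞ (fun y : ℝ × E => Q y.2) (halfBall q₀ r) :=
    hQ.comp contDiffOn_snd fun y hy => hy.2
  have hQξ := hQ'.clm_apply hξ2
  obtain ⟨c, hc, hc'⟩ := exists_eq_smul_of_eq_zero hr hξ1 fun q hq => (h0 q hq).1
  obtain ⟨d, hd, hd'⟩ := exists_eq_smul_of_eq_zero hr hQξ fun q hq => (h0 q hq).2
  refine ⟨fun y => (c y, (ξ y).2 - Q y.2 (ξ y).2 + Q y.2 (d y)),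
    hc.prodMk ((hξ2.sub hQξ).add (hQ'.clm_apply hd)), fun y hy => ?_⟩
  have hQy := hQQ y.2 hy.2
  rw [edgeAnchor_apply]
  refine Prod.ext (hc' y hy).symm ?_
  have h1 : y.1 • Q y.2 (d y) = Q y.2 (ξ y).2 := by
    rw [← map_smul, ← hd' y hy, hQy]
  simp only [map_add, map_sub, hQy, sub_self, zero_add, h1]
  abel

end Anchor

/-- Continuous functions on a half ball that agree off the boundary agree. -/
theorem eqOn_halfBall_of_eqOn_pos {E W : Type*} [NormedAddCommGroup E] [NormedSpace ℝ E]
    [TopologicalSpace W] [T2Space W] {q₀ : E} {r : ℝ} {f g : ℝ × E → W}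
    (hf : ContinuousOn f (halfBall q₀ r)) (hg : ContinuousOn g (halfBall q₀ r))
    (h : ∀ y ∈ halfBall q₀ r, 0 < y.1 → f y = g y) : EqOn f g (halfBall q₀ r) := by
  intro y hy
  have hmem : ∀ t ∈ Ioo 0 (r - y.1), (y.1 + t, y.2) ∈ halfBall q₀ r := fun t ht =>
    ⟨⟨add_nonneg hy.1.1 ht.1.le, by linarith [ht.2]⟩, hy.2⟩
  have ht : Tendsto (fun t : ℝ => (y.1 + t, y.2)) (𝓝[>] 0) (𝓝[halfBall q₀ r] y) := by
    refine tendsto_nhdsWithin_iff.2 ⟨?_, ?_⟩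
    · have : Continuous fun t : ℝ => (y.1 + t, y.2) := by fun_prop
      have h2 := this.tendsto 0
      simp only [add_zero] at h2
      exact h2.mono_left nhdsWithin_le_nhds
    · filter_upwards [Ioo_mem_nhdsGT (sub_pos.2 hy.1.2)] with t ht using hmem t ht
  refine tendsto_nhds_unique_of_eventuallyEq ((hf y hy).tendsto.comp ht) ((hg y hy).tendsto.comp ht) ?_
  filter_upwards [Ioo_mem_nhdsGT (sub_pos.2 hy.1.2)] with t ht
  exact h _ (hmem t ht) (add_pos_of_nonneg_of_pos hy.1.1 ht.1)

namespace EdgeManifold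

variable {m b f : ℕ} {X B Y F : Type*}
  [TopologicalSpace X] [ChartedSpace (EuclideanHalfSpace (m + 1)) X]
  [IsManifold (𝓡∂ (m + 1)) ∞ X]
  [TopologicalSpace B] [ChartedSpace (EuclideanSpace ℝ (Fin m)) B] [IsManifold (𝓡 m) ∞ B]
  [TopologicalSpace Y] [ChartedSpace (EuclideanSpace ℝ (Fin b)) Y] [IsManifold (𝓡 b) ∞ Y]
  [TopologicalSpace F] [ChartedSpace (EuclideanSpace ℝ (Fin f)) F] [IsManifold (𝓡 f) ∞ F]
  (S : EdgeManifold m b f X B Y F)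

/-- `Q` is a smooth family of projections, on the ball of radius `r` in the boundary chart at the
boundary point `incl q₀`, whose kernels are the vertical spaces. -/
structure IsEdgeChart (q₀ : B) (r : ℝ)
    (Q : EuclideanSpace ℝ (Fin m) → EuclideanSpace ℝ (Fin m) →L[ℝ] EuclideanSpace ℝ (Fin m)) :
    Prop where
  pos : 0 < r
  subset_target : halfBall (chartCenter (m := m) (S.incl q₀)) r ⊆
    (halfChart (m := m) (S.incl q₀)).target
  contDiffOn : ContDiffOn ℝ ∞ Q (Metric.ball (chartCenter (S.incl q₀)) r)
  idem : ∀ q ∈ Metric.ball (chartCenter (S.incl q₀)) r, ∀ w, Q q (Q q w) = Q q w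
  vertical_iff : ∀ q : B, S.incl q ∈ chartBall m (S.incl q₀) r →
    ∀ v : TangentSpace (𝓡∂ (m + 1)) (S.incl q), v ∈ S.vertical q ↔
      (dHalfChart (S.incl q₀) (S.incl q) v).1 = 0 ∧
      Q (halfChart (S.incl q₀) (S.incl q)).2 (dHalfChart (S.incl q₀) (S.incl q) v).2 = 0

theorem exists_isEdgeChart (q₀ : B) : ∃ r Q, S.IsEdgeChart q₀ r Q := by
  obtain ⟨r, hr, hrt, P, hP, ⟨C, hC⟩, hv⟩ := S.exists_fibration_in_chart q₀
  obtain ⟨r', hr', hle, Q, hQ, hQ2⟩ := exists_projection_ker_eq hr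
    (hP.fderiv_of_isOpen Metric.isOpen_ball (m := ∞) (by simp)) hC
  refine ⟨r', Q, hr', (halfBall_mono hle).trans hrt, hQ, fun q hq => (hQ2 q hq).1,
    fun q hq v => ?_⟩
  rw [hv q (chartBall_mono _ hle hq) v, (hQ2 _ hq.2.2).2]

theorem IsEdgeChart.mono {S : EdgeManifold m b f X B Y F} {q₀ : B} {r r' : ℝ}
    {Q : EuclideanSpace ℝ (Fin m) → EuclideanSpace ℝ (Fin m) →L[ℝ] EuclideanSpace ℝ (Fin m)}
    (h : S.IsEdgeChart q₀ r Q) (hr' : 0 < r') (hle : r' ≤ r) : S.IsEdgeChart q₀ r' Q where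
  pos := hr'
  subset_target := (halfBall_mono hle).trans h.subset_target
  contDiffOn := h.contDiffOn.mono (Metric.ball_subset_ball hle)
  idem := fun q hq => h.idem q (Metric.ball_subset_ball hle hq)
  vertical_iff := fun q hq => h.vertical_iff q (chartBall_mono _ hle hq)

/-- The edge vector field `ξ` has coefficients `a` with respect to the edge frame given by `Q`. -/
structure HasCoeff (q₀ : B) (r : ℝ)
    (Q : EuclideanSpace ℝ (Fin m) → EuclideanSpace ℝ (Fin m) →L[ℝ] EuclideanSpace ℝ (Fin m))
    (ξ : S.edgeFields)
    (a : ℝ × EuclideanSpace ℝ (Fin m) → ℝ × EuclideanSpace ℝ (Fin m)) : Prop where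
  contDiffOn : ContDiffOn ℝ ∞ a (halfBall (chartCenter (S.incl q₀)) r)
  dHalfChart_eq : ∀ x ∈ chartBall m (S.incl q₀) r, dHalfChart (S.incl q₀) x (ξ.1 x) =
    edgeAnchor Q (halfChart (S.incl q₀) x) (a (halfChart (S.incl q₀) x))

variable {S}
variable {q₀ : B} {r : ℝ}
  {Q : EuclideanSpace ℝ (Fin m) → EuclideanSpace ℝ (Fin m) →L[ℝ] EuclideanSpace ℝ (Fin m)}

theorem HasCoeff.mono {ξ : S.edgeFields}
    {a : ℝ × EuclideanSpace ℝ (Fin m) → ℝ × EuclideanSpace ℝ (Fin m)}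
    (h : S.HasCoeff q₀ r Q ξ a) {r' : ℝ} (hle : r' ≤ r) : S.HasCoeff q₀ r' Q ξ a :=
  ⟨h.1.mono (halfBall_mono hle), fun x hx => h.2 x (chartBall_mono _ hle hx)⟩

theorem IsEdgeChart.exists_hasCoeff (h : S.IsEdgeChart q₀ r Q) (ξ : S.edgeFields) :
    ∃ a, S.HasCoeff q₀ r Q ξ a := by
  have h1 := contDiffOn_dHalfChart h.subset_target ξ.1
  obtain ⟨a, ha, ha'⟩ := exists_edgeAnchor_eq h.pos h.contDiffOn h.idem h1 fun q hq => by
    have hy : ((0 : ℝ), q) ∈ halfBall (chartCenter (m := m) (S.incl q₀)) r :=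
      ⟨⟨le_rfl, h.pos⟩, hq⟩
    have hx := symm_mem_chartBall h.subset_target hy
    have hψ := (halfChart (S.incl q₀)).right_inv (h.subset_target hy)
    have hb : (halfChart (S.incl q₀)).symm (0, q) ∈ (𝓡∂ (m + 1)).boundary X := by
      rw [mem_boundary_iff_halfChart hx.1, hψ]
    rw [← S.range_incl] at hb
    obtain ⟨q', hq'⟩ := hb
    have h2 := (h.vertical_iff q' (hq' ▸ hx) (ξ.1 (S.incl q'))).1 (ξ.2 q')
    rw [hq', hψ] at h2
    exact h2
  refine ⟨a, ha, fun x hx => ?_⟩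
  have h3 := ha' _ hx.2
  rw [(halfChart (S.incl q₀)).left_inv hx.1] at h3
  exact h3.symm

theorem HasCoeff.add {ξ η : S.edgeFields}
    {a c : ℝ × EuclideanSpace ℝ (Fin m) → ℝ × EuclideanSpace ℝ (Fin m)}
    (hξ : S.HasCoeff q₀ r Q ξ a) (hη : S.HasCoeff q₀ r Q η c) :
    S.HasCoeff q₀ r Q (ξ + η) (fun y => a y + c y) where
  contDiffOn := hξ.1.add hη.1
  dHalfChart_eq x hx := by
    rw [map_add, ← hξ.2 x hx, ← hη.2 x hx]
    exact map_add (dHalfChart (S.incl q₀) x) (ξ.1 x) (η.1 x)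

theorem HasCoeff.smul (h : S.IsEdgeChart q₀ r Q) {ξ ζ : S.edgeFields} {k : X → ℝ}
    {a : ℝ × EuclideanSpace ℝ (Fin m) → ℝ × EuclideanSpace ℝ (Fin m)}
    (hξ : S.HasCoeff q₀ r Q ξ a)
    (hk : ContMDiffOn (𝓡∂ (m + 1)) 𝓘(ℝ, ℝ) ∞ k (chartBall m (S.incl q₀) r))
    (hζ : ∀ x, ζ.1 x = k x • ξ.1 x) :
    S.HasCoeff q₀ r Q ζ (fun y => k ((halfChart (S.incl q₀)).symm y) • a y) where
  contDiffOn := (hk.contDiffOn_halfBall h.subset_target).smul hξ.1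
  dHalfChart_eq x hx := by
    rw [map_smul, ← hξ.2 x hx, (halfChart (S.incl q₀)).left_inv hx.1, hζ]
    exact map_smul (dHalfChart (S.incl q₀) x) (k x) (ξ.1 x)

/-- The coefficients are determined by the field: the anchor is injective off the boundary. -/
theorem HasCoeff.eqOn (h : S.IsEdgeChart q₀ r Q) {ξ : S.edgeFields}
    {a c : ℝ × EuclideanSpace ℝ (Fin m) → ℝ × EuclideanSpace ℝ (Fin m)}
    (ha : S.HasCoeff q₀ r Q ξ a) (hc : S.HasCoeff q₀ r Q ξ c) :
    EqOn a c (halfBall (chartCenter (S.incl q₀)) r) := by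
  refine eqOn_halfBall_of_eqOn_pos ha.1.continuousOn hc.1.continuousOn fun y hy hy0 => ?_
  have hx := symm_mem_chartBall h.subset_target hy
  have h1 := (ha.2 _ hx).symm.trans (hc.2 _ hx)
  rw [(halfChart (S.incl q₀)).right_inv (h.subset_target hy)] at h1
  exact edgeAnchor_injective (h.idem _ hy.2) hy0 h1

variable (S) in
theorem exists_smul_eq {k : X → ℝ} (hk : ContMDiff (𝓡∂ (m + 1)) 𝓘(ℝ, ℝ) ∞ k) (ξ : S.edgeFields) :
    ∃ ζ : S.edgeFields, ∀ x, ζ.1 x = k x • ξ.1 x := by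
  have : IsManifold (𝓡∂ (m + 1)) 1 X := IsManifold.of_le (n := ∞) (by norm_cast)
  exact ⟨⟨⟨_, hk.smul_section ξ.1.contMDiff⟩, fun q => (S.vertical q).smul_mem _ (ξ.2 q)⟩,
    fun x => rfl⟩

/-- A frame of edge vector fields near `incl q₀`, cut off by `χ`. -/
theorem IsEdgeChart.exists_frame (h : S.IsEdgeChart q₀ r Q) {χ : X → ℝ}
    (hχ : ContMDiff (𝓡∂ (m + 1)) 𝓘(ℝ, ℝ) ∞ χ) (hs : tsupport χ ⊆ chartBall m (S.incl q₀) r) :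
    ∃ e : (ℝ × EuclideanSpace ℝ (Fin m)) →ₗ[ℝ] S.edgeFields, ∀ v x, (e v).1 x =
      χ x • dHalfChartSymm (S.incl q₀) x (edgeAnchor Q (halfChart (S.incl q₀) x) v) := by
  have h1 : ∀ v, ∃ ξ : S.edgeFields, ∀ x, ξ.1 x =
      χ x • dHalfChartSymm (S.incl q₀) x (edgeAnchor Q (halfChart (S.incl q₀) x) v) := fun v => by
    obtain ⟨ξ, hξ⟩ := exists_section_eq_smul hχ hs (a := fun y => edgeAnchor Q y v)
      ((contDiffOn_edgeAnchor h.contDiffOn).clm_apply contDiffOn_const)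
    refine ⟨⟨ξ, fun q => ?_⟩, hξ⟩
    rw [hξ]
    by_cases hq : S.incl q ∈ chartBall m (S.incl q₀) r
    · refine (S.vertical q).smul_mem _ ((h.vertical_iff q hq _).2 ?_)
      rw [dHalfChart_symm hq.1, edgeAnchor_apply]
      have h2 := (mem_boundary_iff_halfChart hq.1).1 (S.incl_mem_boundary q)
      simp [h2, h.idem _ hq.2.2]
    · rw [image_eq_zero_of_notMem_tsupport fun h2 => hq (hs h2), zero_smul]
      exact zero_mem _
  choose e he using h1
  have hlin : ∀ x, IsLinearMap ℝ fun v =>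
      χ x • dHalfChartSymm (S.incl q₀) x (edgeAnchor Q (halfChart (S.incl q₀) x) v) := fun x =>
    ⟨fun v w => by simp only [dHalfChartSymm, map_add, smul_add],
      fun c v => by simp only [dHalfChartSymm, map_smul, smul_comm c]⟩
  refine ⟨⟨⟨e, fun v w => ?_⟩, fun c v => ?_⟩, he⟩
  · refine Subtype.ext (ContMDiffSection.ext fun x => ?_)
    refine ((he _ x).trans ((hlin x).map_add v w)).trans ?_
    rw [← he v x, ← he w x]
    rfl
  · refine Subtype.ext (ContMDiffSection.ext fun x => ?_)
    refine ((he _ x).trans ((hlin x).map_smul c v)).trans ?_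
    rw [← he v x]
    rfl

end EdgeManifold

namespace EdgeManifold

variable {m b f : ℕ} {X B Y F : Type*}
  [TopologicalSpace X] [ChartedSpace (EuclideanHalfSpace (m + 1)) X]
  [IsManifold (𝓡∂ (m + 1)) ∞ X]
  [TopologicalSpace B] [ChartedSpace (EuclideanSpace ℝ (Fin m)) B] [IsManifold (𝓡 m) ∞ B]
  [TopologicalSpace Y] [ChartedSpace (EuclideanSpace ℝ (Fin b)) Y] [IsManifold (𝓡 b) ∞ Y]
  [TopologicalSpace F] [ChartedSpace (EuclideanSpace ℝ (Fin f)) F] [IsManifold (𝓡 f) ∞ F]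
  (S : EdgeManifold m b f X B Y F)

/-- The edge vector fields `e v` have constant coefficients `v` in an edge chart, and their values
form a frame of the edge tangent bundle there. -/
structure IsEdgeFrame (q₀ : B) (r : ℝ)
    (Q : EuclideanSpace ℝ (Fin m) → EuclideanSpace ℝ (Fin m) →L[ℝ] EuclideanSpace ℝ (Fin m))
    (e : (ℝ × EuclideanSpace ℝ (Fin m)) →ₗ[ℝ] S.edgeFields) : Prop
    extends S.IsEdgeChart q₀ r Q where
  hasCoeff : ∀ v, S.HasCoeff q₀ r Q (e v) fun _ => v
  val_eq : ∀ ξ a, S.HasCoeff q₀ r Q ξ a → ∀ x ∈ chartBall m (S.incl q₀) r,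
    S.val x ξ = S.val x (e (a (halfChart (S.incl q₀) x)))
  injective : ∀ x ∈ chartBall m (S.incl q₀) r, Function.Injective fun v => S.val x (e v)

variable {S}
variable {q₀ : B} {r : ℝ}
  {Q : EuclideanSpace ℝ (Fin m) → EuclideanSpace ℝ (Fin m) →L[ℝ] EuclideanSpace ℝ (Fin m)}

theorem smul_mem_vanishing {p : X} {k : X → ℝ} (hk : ContMDiff (𝓡∂ (m + 1)) 𝓘(ℝ, ℝ) ∞ k)
    (hp : k p = 0) {η ζ : S.edgeFields} (h : ∀ x, ζ.1 x = k x • η.1 x) : ζ ∈ S.vanishing p :=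
  Submodule.subset_span ⟨k, hk, hp, η, h⟩

/-- The fields in `I_x · 𝓥` have coefficients vanishing at `x`. -/
theorem IsEdgeChart.exists_hasCoeff_eq_zero (h : S.IsEdgeChart q₀ r Q) {x : X}
    (hx : x ∈ chartBall m (S.incl q₀) r) {ζ : S.edgeFields} (hζ : ζ ∈ S.vanishing x) :
    ∃ a, S.HasCoeff q₀ r Q ζ a ∧ a (halfChart (S.incl q₀) x) = 0 := by
  have hgen : ∀ (k : X → ℝ), ContMDiff (𝓡∂ (m + 1)) 𝓘(ℝ, ℝ) ∞ k → ∀ η ζ : S.edgeFields,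
      (∀ y, ζ.1 y = k y • η.1 y) → ∃ a, S.HasCoeff q₀ r Q η a ∧ S.HasCoeff q₀ r Q ζ
        (fun y => k ((halfChart (S.incl q₀)).symm y) • a y) := fun k hk η ζ hζ => by
    obtain ⟨a, ha⟩ := h.exists_hasCoeff η
    exact ⟨a, ha, ha.smul h hk.contMDiffOn hζ⟩
  refine Submodule.span_induction (p := fun ζ _ => ∃ a, S.HasCoeff q₀ r Q ζ a ∧
    a (halfChart (S.incl q₀) x) = 0) ?_ ?_ ?_ ?_ hζ
  · rintro ζ ⟨k, hk, hk0, η, hη⟩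
    obtain ⟨a, -, ha⟩ := hgen k hk η ζ hη
    refine ⟨_, ha, ?_⟩
    simp only [(halfChart (S.incl q₀)).left_inv hx.1, hk0, zero_smul]
  · obtain ⟨a, -, ha⟩ := hgen (fun _ => 0) contMDiff_const 0 0 fun y => by simp
    exact ⟨_, ha, by simp⟩
  · rintro ξ η - - ⟨a, ha, ha0⟩ ⟨c, hc, hc0⟩
    exact ⟨_, ha.add hc, by simp [ha0, hc0]⟩
  · rintro c ξ - ⟨a, ha, ha0⟩
    exact ⟨_, ha.smul h (k := fun _ => c) contMDiffOn_const fun y => by simp, by simp [ha0]⟩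

theorem IsEdgeChart.exists_isEdgeFrame [T2Space X] (h : S.IsEdgeChart q₀ r Q) :
    ∃ r' > 0, r' ≤ r ∧ ∃ e, S.IsEdgeFrame q₀ r' Q e := by
  have hp := S.incl_mem_boundary q₀
  obtain ⟨χ, hχ, hs, h1⟩ := exists_bump (m := m) (chartBall_mem_nhds hp h.pos)
  obtain ⟨r₁, hr₁, -, hr₁'⟩ := exists_chartBall_subset hp h1
  obtain ⟨e, he⟩ := h.exists_frame hχ hs
  have hr' : 0 < min r r₁ := lt_min h.pos hr₁
  have hle : min r r₁ ≤ r := min_le_left _ _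
  have hχ1 : ∀ x ∈ chartBall m (S.incl q₀) (min r r₁), χ x = 1 := fun x hx =>
    hr₁' (chartBall_mono _ (min_le_right _ _) hx)
  have h' := h.mono hr' hle
  have hcoeff : ∀ v, S.HasCoeff q₀ (min r r₁) Q (e v) fun _ => v := fun v =>
    ⟨contDiffOn_const, fun x hx => by rw [he, hχ1 x hx, one_smul, dHalfChart_symm hx.1]⟩
  refine ⟨min r r₁, hr', hle, e, h', hcoeff, fun ξ a ha x hx => ?_, fun x hx => ?_⟩
  · obtain ⟨c, hc⟩ := h.exists_hasCoeff ξ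
    have hx' := chartBall_mono _ hle hx
    rw [ha.eqOn h' (hc.mono hle) hx.2]
    rw [← sub_eq_zero, ← map_sub]
    refine (Submodule.Quotient.mk_eq_zero _).2 ?_
    set v := c (halfChart (S.incl q₀) x) with hv
    set β := Module.finBasis ℝ (ℝ × EuclideanSpace ℝ (Fin m)) with hβ
    -- the coefficients with respect to a basis, cut off
    let k : Fin (Module.finrank ℝ (ℝ × EuclideanSpace ℝ (Fin m))) → X → ℝ :=
      fun i y => χ y * β.equivFunL (c (halfChart (S.incl q₀) y)) i
    have hk : ∀ i, ContMDiff (𝓡∂ (m + 1)) 𝓘(ℝ, ℝ) ∞ (k i) := fun i => by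
      refine contMDiff_mul_of_tsupport (isOpen_chartBall _ r) hχ hs ?_
      have h2 : ContDiffOn ℝ ∞ (fun y => β.equivFunL (c y) i)
          (halfBall (chartCenter (m := m) (S.incl q₀)) r) :=
        (contDiff_pi.1 β.equivFunL.contDiff i).comp_contDiffOn hc.1
      exact h2.contMDiffOn_chartBall
    obtain ⟨ζ₀, hζ₀⟩ := S.exists_smul_eq (k := fun y => 1 - χ y * χ y)
      (contMDiff_const.sub (hχ.mul hχ)) ξ
    choose ζ hζ using fun i => S.exists_smul_eq (k := fun y => k i y - β.equivFunL v i)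
      ((hk i).sub contMDiff_const) (e (β i))
    have hsum : ξ - e v = ζ₀ + ∑ i, ζ i := by
      refine Subtype.ext (ContMDiffSection.ext fun y => ?_)
      have hev : (e v).1 y = ∑ i, β.equivFunL v i • (e (β i)).1 y := by
        conv_lhs => rw [← β.sum_equivFun v]
        simp only [map_sum, map_smul]
        have h3 : ∀ (s : Finset (Fin (Module.finrank ℝ (ℝ × EuclideanSpace ℝ (Fin m)))))
            (η : Fin (Module.finrank ℝ (ℝ × EuclideanSpace ℝ (Fin m))) → S.edgeFields),
            (∑ i ∈ s, η i).1 y = ∑ i ∈ s, (η i).1 y := fun s η => map_sum (S.fieldEval y) η s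
        rw [h3]
        rfl
      have hsumy : (∑ i, ζ i).1 y = ∑ i, (k i y - β.equivFunL v i) • (e (β i)).1 y := by
        have h3 : (∑ i, ζ i).1 y = ∑ i, (ζ i).1 y := map_sum (S.fieldEval y) ζ _
        rw [h3]
        exact Finset.sum_congr rfl fun i _ => hζ i y
      have hχξ : (χ y * χ y) • ξ.1 y = ∑ i, k i y • (e (β i)).1 y := by
        by_cases hy : y ∈ chartBall m (S.incl q₀) r
        · have h4 : ξ.1 y = dHalfChartSymm (S.incl q₀) y
              (edgeAnchor Q (halfChart (S.incl q₀) y) (c (halfChart (S.incl q₀) y))) := by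
            rw [← hc.2 y hy, dHalfChartSymm_dHalfChart hy.1]
          have h5 : dHalfChartSymm (S.incl q₀) y
              (edgeAnchor Q (halfChart (S.incl q₀) y) (c (halfChart (S.incl q₀) y))) =
              ∑ i, β.equivFunL (c (halfChart (S.incl q₀) y)) i • dHalfChartSymm (S.incl q₀) y
                (edgeAnchor Q (halfChart (S.incl q₀) y) (β i)) := by
            conv_lhs => rw [← β.sum_equivFun (c (halfChart (S.incl q₀) y))]
            simp only [dHalfChartSymm, map_sum, map_smul]
            rfl
          rw [h4, h5, Finset.smul_sum]
          refine Finset.sum_congr rfl fun i _ => ?_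
          rw [he, smul_smul, smul_smul]
          congr 1
          change _ = χ y * _ * χ y
          ring
        · have h4 : χ y = 0 := image_eq_zero_of_notMem_tsupport fun h2 => hy (hs h2)
          simp [k, h4]
      change ξ.1 y - (e v).1 y = ζ₀.1 y + (∑ i, ζ i).1 y
      rw [hsumy, hζ₀, hev]
      simp only [sub_smul, Finset.sum_sub_distrib, one_smul]
      rw [hχξ]
      abel
    rw [hsum]
    refine add_mem (smul_mem_vanishing (contMDiff_const.sub (hχ.mul hχ)) ?_ hζ₀)
      (sum_mem fun i _ => smul_mem_vanishing ((hk i).sub contMDiff_const) ?_ (hζ i))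
    · simp [hχ1 x hx]
    · simp [k, hχ1 x hx, hv]
  · intro v w hvw
    have h2 : e (v - w) ∈ S.vanishing x := by
      rw [← Submodule.Quotient.mk_eq_zero, map_sub]
      change S.val x (e v - e w) = 0
      rw [map_sub, sub_eq_zero]
      exact hvw
    obtain ⟨a, ha, ha0⟩ := h'.exists_hasCoeff_eq_zero hx h2
    have h3 := ha.eqOn h' (hcoeff (v - w)) hx.2
    rw [ha0] at h3
    exact sub_eq_zero.1 h3.symm

theorem IsEdgeFrame.mono {e : (ℝ × EuclideanSpace ℝ (Fin m)) →ₗ[ℝ] S.edgeFields}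
    (h : S.IsEdgeFrame q₀ r Q e) {r' : ℝ} (hr' : 0 < r') (hle : r' ≤ r) :
    S.IsEdgeFrame q₀ r' Q e where
  toIsEdgeChart := h.toIsEdgeChart.mono hr' hle
  hasCoeff v := (h.hasCoeff v).mono hle
  val_eq ξ a ha x hx := by
    obtain ⟨c, hc⟩ := h.exists_hasCoeff ξ
    rw [ha.eqOn (h.toIsEdgeChart.mono hr' hle) (hc.mono hle) hx.2]
    exact h.val_eq ξ c hc x (chartBall_mono _ hle hx)
  injective x hx := h.injective x (chartBall_mono _ hle hx)

theorem IsEdgeFrame.surjective {e : (ℝ × EuclideanSpace ℝ (Fin m)) →ₗ[ℝ] S.edgeFields}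
    (h : S.IsEdgeFrame q₀ r Q e) {x : X} (hx : x ∈ chartBall m (S.incl q₀) r) (w : S.Tangent x) :
    ∃ v, S.val x (e v) = w := by
  obtain ⟨ξ, rfl⟩ := Submodule.Quotient.mk_surjective _ w
  obtain ⟨a, ha⟩ := h.exists_hasCoeff ξ
  exact ⟨_, (h.val_eq ξ a ha x hx).symm⟩

end EdgeManifold

/-! ### The dual metric and the logarithmic differential in an edge frame -/

section DualForm

variable {V : Type} [NormedAddCommGroup V] [NormedSpace ℝ V] [FiniteDimensional ℝ V]

/-- Continuous bilinear forms on a normed space. -/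
abbrev ContinuousForm (W : Type*) [NormedAddCommGroup W] [NormedSpace ℝ W] : Type _ :=
  W →L[ℝ] W →L[ℝ] ℝ

/-- A bilinear form on a finite-dimensional space as a continuous bilinear form. -/
def continuousForm (β : V →ₗ[ℝ] V →ₗ[ℝ] ℝ) : V →L[ℝ] V →L[ℝ] ℝ :=
  LinearMap.toContinuousLinearMap ((LinearMap.toContinuousLinearMap :
    (V →ₗ[ℝ] ℝ) ≃ₗ[ℝ] (V →L[ℝ] ℝ)).toLinearMap ∘ₗ β)

/-- The bilinear form on the dual space induced by a nondegenerate bilinear form. -/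
def dualForm (β : V →L[ℝ] V →L[ℝ] ℝ) : ContinuousForm (V →L[ℝ] ℝ) :=
  (ContinuousLinearMap.apply ℝ ℝ : V →L[ℝ] (V →L[ℝ] ℝ) →L[ℝ] ℝ) ∘L β.inverse

theorem dualForm_apply (β : V →L[ℝ] V →L[ℝ] ℝ) (α α' : V →L[ℝ] ℝ) :
    dualForm β α α' = α' (β.inverse α) := rfl

theorem isInvertible_of_injective {β : V →L[ℝ] V →L[ℝ] ℝ} (h : Function.Injective β) :
    β.IsInvertible := by
  have hfr : Module.finrank ℝ V = Module.finrank ℝ (V →L[ℝ] ℝ) := by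
    rw [← (LinearMap.toContinuousLinearMap : (V →ₗ[ℝ] ℝ) ≃ₗ[ℝ] (V →L[ℝ] ℝ)).finrank_eq]
    exact (Subspace.dual_finrank_eq (K := ℝ) (V := V)).symm
  have : FiniteDimensional ℝ (V →L[ℝ] ℝ) := inferInstance
  have hs : Function.Surjective β.toLinearMap :=
    (LinearMap.injective_iff_surjective_of_finrank_eq_finrank hfr).1 h
  exact ⟨(LinearEquiv.ofBijective β.toLinearMap ⟨h, hs⟩).toContinuousLinearEquiv,
    ContinuousLinearMap.ext fun v => rfl⟩

theorem inverse_eq_iff {β : V →L[ℝ] V →L[ℝ] ℝ} (h : Function.Injective β) {α : V →L[ℝ] ℝ} {v : V} :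
    β.inverse α = v ↔ β v = α := by
  obtain ⟨e, rfl⟩ := isInvertible_of_injective h
  rw [ContinuousLinearMap.inverse_equiv]
  exact e.symm_apply_eq.trans eq_comm

theorem contDiffOn_dualForm {V' : Type*} [NormedAddCommGroup V'] [NormedSpace ℝ V']
    {β : V' → V →L[ℝ] V →L[ℝ] ℝ} {s : Set V'} (hβ : ContDiffOn ℝ ∞ β s)
    (h : ∀ y ∈ s, Function.Injective (β y)) : ContDiffOn ℝ ∞ (fun y => dualForm (β y)) s := by
  have : CompleteSpace V := FiniteDimensional.complete ℝ V
  refine contDiffOn_const.clm_comp fun y hy => ?_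
  obtain ⟨e, he⟩ := isInvertible_of_injective (h y hy)
  have h4 : ContDiffAt ℝ ∞ ContinuousLinearMap.inverse (β y) := by
    rw [← he]
    exact contDiffAt_map_inverse e
  exact h4.comp_contDiffWithinAt y (hβ y hy)

end DualForm

namespace EdgeManifold

variable {m b f : ℕ} {X B Y F : Type*}
  [TopologicalSpace X] [ChartedSpace (EuclideanHalfSpace (m + 1)) X]
  [IsManifold (𝓡∂ (m + 1)) ∞ X]
  [TopologicalSpace B] [ChartedSpace (EuclideanSpace ℝ (Fin m)) B] [IsManifold (𝓡 m) ∞ B]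
  [TopologicalSpace Y] [ChartedSpace (EuclideanSpace ℝ (Fin b)) Y] [IsManifold (𝓡 b) ∞ Y]
  [TopologicalSpace F] [ChartedSpace (EuclideanSpace ℝ (Fin f)) F] [IsManifold (𝓡 f) ∞ F]
  {S : EdgeManifold m b f X B Y F}
  {q₀ : B} {r : ℝ}
  {Q : EuclideanSpace ℝ (Fin m) → EuclideanSpace ℝ (Fin m) →L[ℝ] EuclideanSpace ℝ (Fin m)}
  {e : (ℝ × EuclideanSpace ℝ (Fin m)) →ₗ[ℝ] S.edgeFields}

/-- The metric at `x`, with respect to the frame `e`. -/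
def Metric.gram (g : S.Metric) (e : (ℝ × EuclideanSpace ℝ (Fin m)) →ₗ[ℝ] S.edgeFields) (x : X) :
    (ℝ × EuclideanSpace ℝ (Fin m)) →L[ℝ] (ℝ × EuclideanSpace ℝ (Fin m)) →L[ℝ] ℝ :=
  continuousForm ((g.form x).compl₁₂ (S.val x ∘ₗ e) (S.val x ∘ₗ e))

theorem Metric.gram_apply (g : S.Metric)
    (e : (ℝ × EuclideanSpace ℝ (Fin m)) →ₗ[ℝ] S.edgeFields) (x : X)
    (v w : ℝ × EuclideanSpace ℝ (Fin m)) :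
    g.gram e x v w = g.form x (S.val x (e v)) (S.val x (e w)) := rfl

/-- The metric on the edge cotangent bundle, in the edge frame. -/
def Metric.cogram (g : S.Metric) (e : (ℝ × EuclideanSpace ℝ (Fin m)) →ₗ[ℝ] S.edgeFields) (q₀ : B)
    (y : ℝ × EuclideanSpace ℝ (Fin m)) :
    ContinuousForm ((ℝ × EuclideanSpace ℝ (Fin m)) →L[ℝ] ℝ) :=
  dualForm (g.gram e ((halfChart (S.incl q₀)).symm y))

theorem IsEdgeFrame.gram_injective (h : S.IsEdgeFrame q₀ r Q e) (g : S.Metric) {x : X}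
    (hx : x ∈ chartBall m (S.incl q₀) r) : Function.Injective (g.gram e x) := by
  rw [injective_iff_map_eq_zero]
  intro v hv
  have h1 : S.val x (e v) = 0 := by
    refine (g.nondegenerate x).1 _ fun w => ?_
    obtain ⟨w, rfl⟩ := h.surjective hx w
    rw [← Metric.gram_apply, hv]
    rfl
  refine h.injective x hx ?_
  simp only [h1, map_zero]

theorem IsEdgeFrame.contDiffOn_cogram (h : S.IsEdgeFrame q₀ r Q e) (g : S.Metric) :
    ContDiffOn ℝ ∞ (g.cogram e q₀) (halfBall (chartCenter (S.incl q₀)) r) := by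
  refine contDiffOn_dualForm (β := fun y => g.gram e ((halfChart (S.incl q₀)).symm y)) ?_
    fun y hy => h.gram_injective g (symm_mem_chartBall h.subset_target hy)
  refine contDiffOn_clm_apply.2 fun v => contDiffOn_clm_apply.2 fun w => ?_
  exact (g.contMDiff (e v) (e w)).contMDiffOn.contDiffOn_halfBall h.subset_target

theorem IsEdgeFrame.cogram_symm (h : S.IsEdgeFrame q₀ r Q e) (g : S.Metric)
    {y : ℝ × EuclideanSpace ℝ (Fin m)} (hy : y ∈ halfBall (chartCenter (S.incl q₀)) r)
    (α α' : (ℝ × EuclideanSpace ℝ (Fin m)) →L[ℝ] ℝ) :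
    g.cogram e q₀ y α α' = g.cogram e q₀ y α' α := by
  have hx := symm_mem_chartBall h.subset_target hy
  have hinj := h.gram_injective g hx
  have h1 := (inverse_eq_iff hinj (α := α)).1 rfl
  have h2 := (inverse_eq_iff hinj (α := α')).1 rfl
  rw [Metric.cogram, dualForm_apply, dualForm_apply]
  set v := (g.gram e ((halfChart (S.incl q₀)).symm y)).inverse α
  set w := (g.gram e ((halfChart (S.incl q₀)).symm y)).inverse α'
  rw [← h1, ← h2, Metric.gram_apply, Metric.gram_apply]
  exact (g.isSymm _).eq _ _

theorem IsEdgeFrame.isSharp_iff (h : S.IsEdgeFrame q₀ r Q e) (g : S.Metric) {x : X}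
    (hx : x ∈ chartBall m (S.incl q₀) r) {θ : Module.Dual ℝ (S.Tangent x)}
    {α : (ℝ × EuclideanSpace ℝ (Fin m)) →L[ℝ] ℝ} (hα : ∀ v, θ (S.val x (e v)) = α v)
    {w : ℝ × EuclideanSpace ℝ (Fin m)} :
    IsSharp (g.form x) θ (S.val x (e w)) ↔ (g.gram e x).inverse α = w := by
  rw [inverse_eq_iff (h.gram_injective g hx)]
  constructor
  · intro h1
    refine ContinuousLinearMap.ext fun v => ?_
    rw [Metric.gram_apply, h1, hα]
  · intro h1 u
    obtain ⟨v, rfl⟩ := h.surjective hx u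
    rw [← Metric.gram_apply, h1, hα]

theorem IsEdgeFrame.isNormSq_iff (h : S.IsEdgeFrame q₀ r Q e) (g : S.Metric) {x : X}
    (hx : x ∈ chartBall m (S.incl q₀) r) {θ : Module.Dual ℝ (S.Tangent x)}
    {α : (ℝ × EuclideanSpace ℝ (Fin m)) →L[ℝ] ℝ} (hα : ∀ v, θ (S.val x (e v)) = α v) {c : ℝ} :
    IsNormSq (g.form x) θ c ↔ g.cogram e q₀ (halfChart (S.incl q₀) x) α α = c := by
  rw [Metric.cogram, dualForm_apply, (halfChart (S.incl q₀)).left_inv hx.1]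
  constructor
  · rintro ⟨v, hv, hc⟩
    obtain ⟨w, rfl⟩ := h.surjective hx v
    rw [(h.isSharp_iff g hx hα).1 hv, ← hα, hc]
  · intro h1
    exact ⟨_, (h.isSharp_iff g hx hα).2 rfl, by rw [hα, h1]⟩

/-- The covector in the edge frame with prescribed components is the value of a covector of the
edge tangent bundle. -/
theorem IsEdgeFrame.exists_dual (h : S.IsEdgeFrame q₀ r Q e) {x : X}
    (hx : x ∈ chartBall m (S.incl q₀) r) (α : (ℝ × EuclideanSpace ℝ (Fin m)) →L[ℝ] ℝ) :
    ∃ θ : Module.Dual ℝ (S.Tangent x), ∀ v, θ (S.val x (e v)) = α v := by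
  let E := LinearEquiv.ofBijective (S.val x ∘ₗ e) ⟨h.injective x hx, h.surjective hx⟩
  refine ⟨α.toLinearMap ∘ₗ E.symm.toLinearMap, fun v => ?_⟩
  have h1 : E.symm (S.val x (e v)) = v := E.symm_apply_apply v
  simp [h1]

/-- In the boundary chart at `p`, the function `f` is the first coordinate times the smooth positive
function `k`. -/
structure HasFactor (p : X) (r : ℝ) (f : X → ℝ) (k : ℝ × EuclideanSpace ℝ (Fin m) → ℝ) : Prop where
  contDiffOn : ContDiffOn ℝ ∞ k (halfBall (chartCenter p) r)
  pos : ∀ y ∈ halfBall (chartCenter (m := m) p) r, 0 < k y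
  eq : ∀ z ∈ chartBall m p r, f z = (halfChart (m := m) p z).1 * k (halfChart (m := m) p z)

theorem HasFactor.mono {p : X} {f : X → ℝ} {k : ℝ × EuclideanSpace ℝ (Fin m) → ℝ}
    (h : HasFactor (m := m) p r f k) {r' : ℝ} (hle : r' ≤ r) : HasFactor (m := m) p r' f k :=
  ⟨h.1.mono (halfBall_mono hle), fun y hy => h.2 y (halfBall_mono hle hy),
    fun z hz => h.3 z (chartBall_mono p hle hz)⟩

/-- The components of `d(x k) / (x k)` in the edge frame, where `x` is the first coordinate. -/
def logForm
    (Q : EuclideanSpace ℝ (Fin m) → EuclideanSpace ℝ (Fin m) →L[ℝ] EuclideanSpace ℝ (Fin m))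
    (s : Set (ℝ × EuclideanSpace ℝ (Fin m))) (k : ℝ × EuclideanSpace ℝ (Fin m) → ℝ)
    (y : ℝ × EuclideanSpace ℝ (Fin m)) : (ℝ × EuclideanSpace ℝ (Fin m)) →L[ℝ] ℝ :=
  ContinuousLinearMap.fst ℝ ℝ (EuclideanSpace ℝ (Fin m)) +
    (k y)⁻¹ • (fderivWithin ℝ k s y ∘L edgeAnchor Q y)

theorem IsEdgeChart.contDiffOn_logForm (h : S.IsEdgeChart q₀ r Q)
    {k : ℝ × EuclideanSpace ℝ (Fin m) → ℝ} {x : X → ℝ}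
    (hk : HasFactor (m := m) (S.incl q₀) r x k) :
    ContDiffOn ℝ ∞ (logForm Q (halfBall (chartCenter (S.incl q₀)) r) k)
      (halfBall (chartCenter (S.incl q₀)) r) := by
  have h1 := hk.contDiffOn.fderivWithin (m := ∞) (uniqueDiffOn_halfBall _ h.pos) (by simp)
  exact contDiffOn_const.add ((hk.contDiffOn.inv fun y hy => (hk.pos y hy).ne').smul
    (h1.clm_comp (contDiffOn_edgeAnchor h.contDiffOn)))

/-- The differential of `x k` along an edge vector field, off the boundary. -/
theorem dif_div_eq_logForm
    {k : ℝ × EuclideanSpace ℝ (Fin m) → ℝ} {x : X → ℝ}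
    (hk : HasFactor (m := m) (S.incl q₀) r x k)
    {ξ : S.edgeFields} {a : ℝ × EuclideanSpace ℝ (Fin m) → ℝ × EuclideanSpace ℝ (Fin m)}
    (ha : S.HasCoeff q₀ r Q ξ a) {z : X} (hz : z ∈ chartBall m (S.incl q₀) r)
    (hz0 : z ∈ (𝓡∂ (m + 1)).interior X) :
    dif x z (ξ.1 z) / x z = logForm Q (halfBall (chartCenter (S.incl q₀)) r) k
      (halfChart (S.incl q₀) z) (a (halfChart (S.incl q₀) z)) := by
  set y := halfChart (m := m) (S.incl q₀) z with hy
  have hy0 : 0 < y.1 := (mem_interior_iff_halfChart hz.1).1 hz0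
  have hyb : y ∈ halfBall (chartCenter (m := m) (S.incl q₀)) r := hz.2
  have hkd : HasFDerivAt k (fderivWithin ℝ k (halfBall (chartCenter (S.incl q₀)) r) y) y :=
    ((hk.contDiffOn y hyb).differentiableWithinAt (by simp)).hasFDerivWithinAt.hasFDerivAt
      (halfBall_mem_nhds hyb hy0)
  have hF := (hasFDerivAt_fst (𝕜 := ℝ) (p := y)).mul hkd
  rw [dif_eq_of_hasFDerivAt hz.1 (F := fun y => y.1 * k y)
    (by filter_upwards [(isOpen_chartBall (m := m) _ r).mem_nhds hz] with z' hz' using hk.eq z' hz') hF,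
    ha.2 z hz, hk.eq z hz, ← hy]
  have hk1 := (hk.pos y hyb).ne'
  simp only [logForm, add_apply, FunLike.coe_smul, Pi.smul_apply,
    ContinuousLinearMap.comp_apply, ContinuousLinearMap.coe_fst', smul_eq_mul]
  have h3 : (edgeAnchor Q y (a y)).1 = y.1 * (a y).1 := rfl
  rw [h3]
  field_simp
  ring

theorem interior_nhdsWithin_neBot {z : X} (hz : z ∈ chartBall m (S.incl q₀) r)
    (h : S.IsEdgeChart q₀ r Q) : (𝓝[(𝓡∂ (m + 1)).interior X] z).NeBot := by
  rw [← mem_closure_iff_nhdsWithin_neBot, mem_closure_iff]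
  intro O hO hzO
  set y := halfChart (m := m) (S.incl q₀) z with hy
  have ht : Tendsto (fun t : ℝ => (halfChart (m := m) (S.incl q₀)).symm (y.1 + t, y.2)) (𝓝[>] 0)
      (𝓝 z) := by
    have h1 := ((contMDiffOn_halfChart_symm (m := m) (S.incl q₀)).continuousOn.mono
      h.subset_target) y hz.2
    rw [ContinuousWithinAt, (halfChart (S.incl q₀)).left_inv hz.1] at h1
    refine h1.comp (tendsto_nhdsWithin_iff.2 ⟨?_, ?_⟩)
    · have : Continuous fun t : ℝ => (y.1 + t, y.2) := by fun_prop
      have h2 := this.tendsto 0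
      simp only [add_zero] at h2
      exact h2.mono_left nhdsWithin_le_nhds
    · filter_upwards [Ioo_mem_nhdsGT (sub_pos.2 hz.2.1.2)] with t ht
      exact ⟨⟨add_nonneg hz.2.1.1 ht.1.le, by linarith [ht.2]⟩, hz.2.2⟩
  obtain ⟨t, ht1, ht2⟩ := ((ht.eventually (hO.mem_nhds hzO)).and
    (Ioo_mem_nhdsGT (sub_pos.2 hz.2.1.2))).exists
  refine ⟨_, ht1, ?_⟩
  have hyt : (y.1 + t, y.2) ∈ halfBall (chartCenter (m := m) (S.incl q₀)) r :=
    ⟨⟨add_nonneg hz.2.1.1 ht2.1.le, by linarith [ht2.2]⟩, hz.2.2⟩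
  rw [mem_interior_iff_halfChart (symm_mem_chartBall h.subset_target hyt).1,
    (halfChart (S.incl q₀)).right_inv (h.subset_target hyt)]
  exact add_pos_of_nonneg_of_pos hz.2.1.1 ht2.1

theorem IsEdgeFrame.isDlog_iff (h : S.IsEdgeFrame q₀ r Q e)
    {k : ℝ × EuclideanSpace ℝ (Fin m) → ℝ} {x : X → ℝ}
    (hk : HasFactor (m := m) (S.incl q₀) r x k) {z : X}
    (hz : z ∈ chartBall m (S.incl q₀) r) {θ : Module.Dual ℝ (S.Tangent z)} :
    S.IsDlog x z θ ↔ ∀ v, θ (S.val z (e v)) =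
      logForm Q (halfBall (chartCenter (S.incl q₀)) r) k (halfChart (S.incl q₀) z) v := by
  have hlim : ∀ ξ a, S.HasCoeff q₀ r Q ξ a → Tendsto (fun z' : X => dif x z' (ξ.1 z') / x z')
      (𝓝[(𝓡∂ (m + 1)).interior X] z)
      (𝓝 (logForm Q (halfBall (chartCenter (S.incl q₀)) r) k (halfChart (S.incl q₀) z)
        (a (halfChart (S.incl q₀) z)))) := fun ξ a ha => by
    have h1 := ((h.contDiffOn_logForm hk).clm_apply ha.1).contMDiffOn_chartBall.continuousOn
    have h2 := (h1.continuousAt ((isOpen_chartBall (m := m) _ r).mem_nhds hz)).tendsto.mono_left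
      (nhdsWithin_le_nhds (s := (𝓡∂ (m + 1)).interior X))
    refine h2.congr' ?_
    filter_upwards [self_mem_nhdsWithin,
      mem_nhdsWithin_of_mem_nhds ((isOpen_chartBall (m := m) _ r).mem_nhds hz)] with z' hz0 hz'
    exact (dif_div_eq_logForm hk ha hz' hz0).symm
  have := interior_nhdsWithin_neBot hz h.toIsEdgeChart
  constructor
  · intro hθ v
    exact tendsto_nhds_unique (hθ (e v)) (hlim _ _ (h.hasCoeff v))
  · intro hθ ξ
    obtain ⟨a, ha⟩ := h.exists_hasCoeff ξ
    rw [h.val_eq ξ a ha z hz, hθ]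
    exact hlim ξ a ha

end EdgeManifold

/-! ### Defining functions in a boundary chart -/

namespace EdgeManifold

section Factor

variable {m : ℕ} {X : Type*} [TopologicalSpace X] [ChartedSpace (EuclideanHalfSpace (m + 1)) X]
  [IsManifold (𝓡∂ (m + 1)) ∞ X]

theorem dif_eq_mul_of_boundary {p : X} {r : ℝ} {f : X → ℝ}
    {k : ℝ × EuclideanSpace ℝ (Fin m) → ℝ}
    (hk : ContDiffOn ℝ ∞ k (halfBall (chartCenter p) r))
    (hf : ∀ z ∈ chartBall m p r,
      f z = (halfChart (m := m) p z).1 * k (halfChart (m := m) p z)) {z : X}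
    (hz : z ∈ chartBall m p r) (hz0 : z ∈ (𝓡∂ (m + 1)).boundary X)
    (v : TangentSpace (𝓡∂ (m + 1)) z) :
    dif f z v = k (halfChart p z) * (dHalfChart p z v).1 := by
  have hz' := (isOpen_chartBall p r).mem_nhds hz
  have h1 : HasMFDerivAt (𝓡∂ (m + 1)) 𝓘(ℝ, ℝ) (fun z => k (halfChart p z)) z _ :=
    ((hk.contMDiffOn_chartBall.contMDiffAt hz').mdifferentiableAt (by simp)).hasMFDerivAt
  have h2 : HasMFDerivAt (𝓡∂ (m + 1)) 𝓘(ℝ, ℝ) (fun z => (halfChart (m := m) p z).1) z _ :=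
    ((ContinuousLinearMap.fst ℝ ℝ (EuclideanSpace ℝ (Fin m))).hasFDerivAt
      (x := halfChart p z)).hasMFDerivAt.comp z (hasMFDerivAt_halfChart hz.1)
  have h3 := (h2.mul h1).congr_of_eventuallyEq (f₁ := f)
    (by filter_upwards [hz'] with y hy using hf y hy)
  rw [dif, h3.mfderiv]
  have h4 := (mem_boundary_iff_halfChart hz.1).1 hz0
  have h5 : ∀ (a c : ℝ) (L M : TangentSpace (𝓡∂ (m + 1)) z →L[ℝ] ℝ), a = 0 →
      (a • L + c • M) v = c * M v := fun a c L M ha => by simp [ha]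
  exact h5 _ _ _ _ h4

theorem HasFactor.isDefiningOn {p : X} {r : ℝ} {f : X → ℝ}
    {k : ℝ × EuclideanSpace ℝ (Fin m) → ℝ} (h : HasFactor (m := m) p r f k) :
    IsDefiningOn m X (chartBall m p r) f where
  contMDiffOn := by
    have h1 : ContDiffOn ℝ ∞ (fun y : ℝ × EuclideanSpace ℝ (Fin m) => y.1 * k y)
      (halfBall (chartCenter p) r) := contDiffOn_fst.mul h.contDiffOn
    exact h1.contMDiffOn_chartBall.congr fun z hz => h.eq z hz
  pos z hz hz0 := by
    rw [h.eq z hz]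
    exact mul_pos ((mem_interior_iff_halfChart hz.1).1 hz0) (h.pos _ hz.2)
  eq_zero z hz hz0 := by
    rw [h.eq z hz, (mem_boundary_iff_halfChart hz.1).1 hz0, zero_mul]
  mfderiv_ne_zero z hz hz0 h0 := by
    have h1 := dif_eq_mul_of_boundary h.contDiffOn h.eq hz hz0 (dHalfChartSymm p z (1, 0))
    rw [dHalfChart_symm hz.1, mul_one, dif, h0] at h1
    exact (h.pos _ hz.2).ne h1

theorem IsDefiningOn.mono {U V : Set X} {f : X → ℝ} (h : IsDefiningOn m X U f) (hV : V ⊆ U) :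
    IsDefiningOn m X V f :=
  ⟨h.1.mono hV, fun p hp => h.2 p (hV hp), fun p hp => h.3 p (hV hp), fun p hp => h.4 p (hV hp)⟩

theorem IsDefiningOn.exists_hasFactor {p : X} (hp : p ∈ (𝓡∂ (m + 1)).boundary X) {U : Set X}
    (hU : U ∈ 𝓝 p) {f : X → ℝ} (hf : IsDefiningOn m X U f) :
    ∃ r > 0, chartBall m p r ⊆ U ∧ ∃ k, HasFactor (m := m) p r f k := by
  obtain ⟨r, hr, hrt, hrU⟩ := exists_chartBall_subset hp hU
  have hf' := (hf.contMDiffOn.mono hrU).contDiffOn_halfBall hrt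
  obtain ⟨k, hk, hk'⟩ := exists_eq_smul_of_eq_zero hr hf' fun q hq => by
    have hy : ((0 : ℝ), q) ∈ halfBall (chartCenter (m := m) p) r := ⟨⟨le_rfl, hr⟩, hq⟩
    have hx := symm_mem_chartBall hrt hy
    exact hf.eq_zero _ (hrU hx) ((mem_boundary_iff_halfChart hx.1).2 (by
      rw [(halfChart p).right_inv (hrt hy)]))
  have heq : ∀ z ∈ chartBall m p r,
      f z = (halfChart (m := m) p z).1 * k (halfChart (m := m) p z) := fun z hz => by
    rw [← smul_eq_mul, ← hk' _ hz.2, (halfChart p).left_inv hz.1]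
  refine ⟨r, hr, hrU, k, hk, fun y hy => ?_, heq⟩
  have hx := symm_mem_chartBall hrt hy
  have hψ := (halfChart p).right_inv (hrt hy)
  have hpos : ∀ y ∈ halfBall (chartCenter (m := m) p) r, 0 < y.1 → 0 < k y := fun y hy hy0 => by
    have hx := symm_mem_chartBall hrt hy
    have h1 := hf.pos _ (hrU hx) ((mem_interior_iff_halfChart hx.1).2 (by
      rwa [(halfChart p).right_inv (hrt hy)]))
    rw [hk' y hy, smul_eq_mul] at h1
    exact (mul_pos_iff_of_pos_left hy0).1 h1
  rcases hy.1.1.lt_or_eq with h0 | h0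
  · exact hpos y hy h0
  · have hb : (halfChart p).symm y ∈ (𝓡∂ (m + 1)).boundary X :=
      (mem_boundary_iff_halfChart hx.1).2 (by rw [hψ]; exact h0.symm)
    have hne : k y ≠ 0 := fun hk0 => hf.mfderiv_ne_zero _ (hrU hx) hb (by
      refine ContinuousLinearMap.ext fun v => ?_
      have h1 := dif_eq_mul_of_boundary hk heq hx hb v
      rw [hψ, hk0, zero_mul] at h1
      exact h1)
    have hge : 0 ≤ k y := by
      have h1 : ContinuousOn (fun y => max (k y) 0) (halfBall (chartCenter (m := m) p) r) :=
        hk.continuousOn.sup continuousOn_const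
      have h2 := eqOn_halfBall_of_eqOn_pos h1 hk.continuousOn
        (fun y hy hy0 => max_eq_left (hpos y hy hy0).le) hy
      exact max_eq_left_iff.1 h2
    exact lt_of_le_of_ne hge hne.symm

/-- Two defining functions that agree to second order have the quotient `e^{x u}`, with `u` smooth. -/
theorem HasFactor.exists_eq_mul_exp {p : X} {r : ℝ} (hr : 0 < r)
    (hrt : halfBall (chartCenter (m := m) p) r ⊆ (halfChart (m := m) p).target) {f f₀ : X → ℝ}
    {k k₀ : ℝ × EuclideanSpace ℝ (Fin m) → ℝ} (hk : HasFactor (m := m) p r f k)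
    (hk₀ : HasFactor (m := m) p r f₀ k₀)
    (h : ∀ z ∈ chartBall m p r, z ∈ (𝓡∂ (m + 1)).boundary X →
      (fun x => f x - f₀ x) =O[𝓝 z] (fun x => f₀ x ^ 2)) :
    ∃ u, ContDiffOn ℝ ∞ u (halfBall (chartCenter (m := m) p) r) ∧
      ∀ y ∈ halfBall (chartCenter (m := m) p) r, k y = k₀ y * Real.exp (y.1 * u y) := by
  have hlog : ContDiffOn ℝ ∞ (fun y => Real.log (k y) - Real.log (k₀ y))
      (halfBall (chartCenter (m := m) p) r) :=
    (hk.contDiffOn.log fun y hy => (hk.pos y hy).ne').sub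
      (hk₀.contDiffOn.log fun y hy => (hk₀.pos y hy).ne')
  obtain ⟨u, hu, hu'⟩ := exists_eq_smul_of_eq_zero hr hlog fun q hq => by
    have hy : ((0 : ℝ), q) ∈ halfBall (chartCenter (m := m) p) r := ⟨⟨le_rfl, hr⟩, hq⟩
    have hx := symm_mem_chartBall hrt hy
    have hb : (halfChart p).symm (0, q) ∈ (𝓡∂ (m + 1)).boundary X :=
      (mem_boundary_iff_halfChart hx.1).2 (by rw [(halfChart p).right_inv (hrt hy)])
    obtain ⟨C, hC⟩ := (h _ hx hb).bound
    -- approach the boundary point along the normal coordinate line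
    have hmem : ∀ t ∈ Ioo 0 r, (t, q) ∈ halfBall (chartCenter (m := m) p) r := fun t ht =>
      ⟨⟨ht.1.le, ht.2⟩, hq⟩
    have hline : Tendsto (fun t : ℝ => (t, q)) (𝓝[>] 0)
        (𝓝[halfBall (chartCenter (m := m) p) r] (0, q)) := by
      refine tendsto_nhdsWithin_iff.2 ⟨?_, ?_⟩
      · have : Continuous fun t : ℝ => (t, q) := by fun_prop
        exact (this.tendsto 0).mono_left nhdsWithin_le_nhds
      · filter_upwards [Ioo_mem_nhdsGT hr] with t ht using hmem t ht
    have hsymm := (((contMDiffOn_halfChart_symm (m := m) p).continuousOn.mono hrt) _ hy).tendsto.comp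
      hline
    have hk1 := (hk.contDiffOn.continuousOn _ hy).tendsto.comp hline
    have hk2 := (hk₀.contDiffOn.continuousOn _ hy).tendsto.comp hline
    have hbd : ∀ᶠ t in 𝓝[>] (0 : ℝ), |k (t, q) - k₀ (t, q)| ≤ C * t * k₀ (t, q) ^ 2 := by
      filter_upwards [hsymm.eventually hC, Ioo_mem_nhdsGT hr] with t ht ht2
      have hx' := symm_mem_chartBall hrt (hmem t ht2)
      simp only [Function.comp_apply] at ht
      rw [hk.eq _ hx', hk₀.eq _ hx', (halfChart p).right_inv (hrt (hmem t ht2)), ← mul_sub,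
        Real.norm_eq_abs, Real.norm_eq_abs, abs_mul, abs_of_pos ht2.1, 
        abs_of_nonneg (sq_nonneg (t * k₀ (t, q)))]
        at ht
      have h3 : t * |k (t, q) - k₀ (t, q)| ≤ t * (C * t * k₀ (t, q) ^ 2) := by
        refine ht.trans (le_of_eq ?_)
        ring
      exact le_of_mul_le_mul_left h3 ht2.1
    have hid : Tendsto (fun t : ℝ => t) (𝓝[>] 0) (𝓝 0) := nhdsWithin_le_nhds
    have hlim : Tendsto (fun t => C * t * k₀ (t, q) ^ 2) (𝓝[>] (0 : ℝ)) (𝓝 0) := by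
      have h4 := (hid.const_mul C).mul (hk2.pow 2)
      simpa using h4
    have h5 : Tendsto (fun t => |k (t, q) - k₀ (t, q)|) (𝓝[>] (0 : ℝ)) (𝓝 0) :=
      squeeze_zero' (Eventually.of_forall fun t => abs_nonneg _) hbd hlim
    have h6 := tendsto_nhds_unique h5 (hk1.sub hk2).abs
    have h7 : k (0, q) = k₀ (0, q) := sub_eq_zero.1 (abs_eq_zero.1 h6.symm)
    rw [h7, sub_self]
  refine ⟨u, hu, fun y hy => ?_⟩
  rw [← smul_eq_mul (a := y.1), ← hu' y hy, Real.exp_sub, Real.exp_log (hk.pos y hy),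
    Real.exp_log (hk₀.pos y hy)]
  field_simp [(hk₀.pos y hy).ne']

theorem HasFactor.isBigO_of_eq_mul_exp {p : X} {r : ℝ} (hr : 0 < r) {f f₀ : X → ℝ}
    {k k₀ u : ℝ × EuclideanSpace ℝ (Fin m) → ℝ} (hk : HasFactor (m := m) p r f k)
    (hk₀ : HasFactor (m := m) p r f₀ k₀)
    (hu : ContDiffOn ℝ ∞ u (halfBall (chartCenter (m := m) p) r))
    (h : ∀ y ∈ halfBall (chartCenter (m := m) p) r, k y = k₀ y * Real.exp (y.1 * u y)) {z : X}
    (hz : z ∈ chartBall m p r) : (fun x => f x - f₀ x) =O[𝓝 z] (fun x => f₀ x ^ 2) := by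
  have h1 : ContDiffOn ℝ ∞ (fun y => Real.exp (y.1 * u y) - 1)
      (halfBall (chartCenter (m := m) p) r) := (contDiffOn_fst.mul hu).exp.sub contDiffOn_const
  obtain ⟨d, hd, hd'⟩ := exists_eq_smul_of_eq_zero hr h1 fun q hq => by simp
  have h2 : ContDiffOn ℝ ∞ (fun y => d y / k₀ y) (halfBall (chartCenter (m := m) p) r) :=
    hd.div hk₀.contDiffOn fun y hy => (hk₀.pos y hy).ne'
  have hz' := (isOpen_chartBall p r).mem_nhds hz
  have h3 := (h2.contMDiffOn_chartBall.continuousOn.continuousAt hz')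
  have h4 := h3.norm.isBoundedUnder_le.isBigO_one ℝ |>.mul
    (Asymptotics.isBigO_refl (fun x => f₀ x ^ 2) (𝓝 z))
  simp only [one_mul] at h4
  refine h4.congr' ?_ EventuallyEq.rfl
  filter_upwards [hz'] with x hx
  have h5 := hd' _ hx.2
  simp only [smul_eq_mul] at h5
  have h6 := (hk₀.pos _ hx.2).ne'
  rw [hk.eq x hx, hk₀.eq x hx, h _ hx.2, ← mul_sub, ← mul_sub_one, h5]
  field_simp

end Factor

end EdgeManifold

/-! ### The eikonal equation near a boundary point -/

namespace EdgeManifold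

variable {m b f : ℕ} {X B Y F : Type*}
  [TopologicalSpace X] [ChartedSpace (EuclideanHalfSpace (m + 1)) X]
  [IsManifold (𝓡∂ (m + 1)) ∞ X]
  [TopologicalSpace B] [ChartedSpace (EuclideanSpace ℝ (Fin m)) B] [IsManifold (𝓡 m) ∞ B]
  [TopologicalSpace Y] [ChartedSpace (EuclideanSpace ℝ (Fin b)) Y] [IsManifold (𝓡 b) ∞ Y]
  [TopologicalSpace F] [ChartedSpace (EuclideanSpace ℝ (Fin f)) F] [IsManifold (𝓡 f) ∞ F]
  {S : EdgeManifold m b f X B Y F}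
  {q₀ : B} {r : ℝ}
  {Q : EuclideanSpace ℝ (Fin m) → EuclideanSpace ℝ (Fin m) →L[ℝ] EuclideanSpace ℝ (Fin m)}
  {e : (ℝ × EuclideanSpace ℝ (Fin m)) →ₗ[ℝ] S.edgeFields}

/-- The components, in the edge frame, of the pullback of a tangential covector by the anchor. -/
def edgeCovector
    (Q : EuclideanSpace ℝ (Fin m) → EuclideanSpace ℝ (Fin m) →L[ℝ] EuclideanSpace ℝ (Fin m))
    (y : ℝ × EuclideanSpace ℝ (Fin m)) :
    (EuclideanSpace ℝ (Fin m) →L[ℝ] ℝ) →L[ℝ] ((ℝ × EuclideanSpace ℝ (Fin m)) →L[ℝ] ℝ) :=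
  (ContinuousLinearMap.compL ℝ (ℝ × EuclideanSpace ℝ (Fin m)) (EuclideanSpace ℝ (Fin m)) ℝ).flip
    (ContinuousLinearMap.snd ℝ ℝ (EuclideanSpace ℝ (Fin m)) ∘L edgeAnchor Q y)

theorem edgeCovector_apply
    (Q : EuclideanSpace ℝ (Fin m) → EuclideanSpace ℝ (Fin m) →L[ℝ] EuclideanSpace ℝ (Fin m))
    (y v : ℝ × EuclideanSpace ℝ (Fin m)) (η : EuclideanSpace ℝ (Fin m) →L[ℝ] ℝ) :
    edgeCovector Q y η v = η (edgeAnchor Q y v).2 := rfl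

theorem logForm_mul_exp {k u : ℝ × EuclideanSpace ℝ (Fin m) → ℝ}
    {s : Set (ℝ × EuclideanSpace ℝ (Fin m))} (hs : UniqueDiffOn ℝ s) (hk : ContDiffOn ℝ ∞ k s)
    {y : ℝ × EuclideanSpace ℝ (Fin m)} (hy : y ∈ s) (hk0 : 0 < k y)
    {L : (ℝ × EuclideanSpace ℝ (Fin m)) →L[ℝ] ℝ}
    (hL : HasFDerivWithinAt (fun y : ℝ × EuclideanSpace ℝ (Fin m) => y.1 * u y) L s y) :
    logForm Q s (fun y => k y * Real.exp (y.1 * u y)) y =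
      logForm Q s k y + L ∘L edgeAnchor Q y := by
  have h1 := ((hk y hy).differentiableWithinAt (by simp)).hasFDerivWithinAt
  have h2 : fderivWithin ℝ (fun y => k y * Real.exp (y.1 * u y)) s y = _ :=
    (h1.mul hL.exp).fderivWithin (hs y hy)
  refine ContinuousLinearMap.ext fun v => ?_
  have h3 := (Real.exp_pos (y.1 * u y)).ne'
  have h4 := hk0.ne'
  rw [logForm, h2]
  simp only [logForm, add_apply, FunLike.coe_smul, Pi.smul_apply,
    ContinuousLinearMap.comp_apply, smul_eq_mul]
  field_simp
  ring

theorem comp_edgeAnchor_eq (y : ℝ × EuclideanSpace ℝ (Fin m)) (σ : ℝ)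
    (η : EuclideanSpace ℝ (Fin m) →L[ℝ] ℝ) :
    (σ • ContinuousLinearMap.fst ℝ ℝ (EuclideanSpace ℝ (Fin m)) +
      y.1 • η.comp (ContinuousLinearMap.snd ℝ ℝ (EuclideanSpace ℝ (Fin m)))) ∘L edgeAnchor Q y =
    y.1 • (σ • ContinuousLinearMap.fst ℝ ℝ (EuclideanSpace ℝ (Fin m)) + edgeCovector Q y η) := by
  refine ContinuousLinearMap.ext fun v => ?_
  simp only [add_apply, FunLike.coe_smul, Pi.smul_apply,
    ContinuousLinearMap.comp_apply, smul_eq_mul, edgeCovector_apply, ContinuousLinearMap.coe_fst',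
    ContinuousLinearMap.coe_snd', edgeAnchor_apply]
  ring

theorem logForm_mono {k : ℝ × EuclideanSpace ℝ (Fin m) → ℝ} {c : EuclideanSpace ℝ (Fin m)}
    (hk : ContDiffOn ℝ ∞ k (halfBall c r)) {r' : ℝ} (hr' : 0 < r') (hle : r' ≤ r)
    {y : ℝ × EuclideanSpace ℝ (Fin m)} (hy : y ∈ halfBall c r') :
    logForm Q (halfBall c r') k y = logForm Q (halfBall c r) k y := by
  rw [logForm, logForm, fderivWithin_subset (halfBall_mono hle) (uniqueDiffOn_halfBall c hr' y hy)
    ((hk y (halfBall_mono hle hy)).differentiableWithinAt (by simp))]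

/-- Multiplication of a defining function by `e^{x u}` does not change its logarithmic differential
at the boundary. -/
theorem logForm_mul_exp_boundary {k u : ℝ × EuclideanSpace ℝ (Fin m) → ℝ}
    {s : Set (ℝ × EuclideanSpace ℝ (Fin m))} (hs : UniqueDiffOn ℝ s) (hk : ContDiffOn ℝ ∞ k s)
    (hu : ContDiffOn ℝ ∞ u s) {y : ℝ × EuclideanSpace ℝ (Fin m)} (hy : y ∈ s) (hk0 : 0 < k y)
    (hy0 : y.1 = 0) :
    logForm Q s (fun y => k y * Real.exp (y.1 * u y)) y = logForm Q s k y := by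
  have h1 : HasFDerivWithinAt (fun y : ℝ × EuclideanSpace ℝ (Fin m) => y.1 * u y) _ s y :=
    (hasFDerivWithinAt_fst (𝕜 := ℝ)).mul
      ((hu y hy).differentiableWithinAt (by simp)).hasFDerivWithinAt
  rw [logForm_mul_exp hs hk hy hk0 h1, add_eq_left]
  refine ContinuousLinearMap.ext fun v => ?_
  simp [hy0, edgeAnchor_apply]

theorem dHalfChart_eval (h : S.IsEdgeFrame q₀ r Q e) {q : B}
    (hq : S.incl q ∈ chartBall m (S.incl q₀) r) (w : ℝ × EuclideanSpace ℝ (Fin m)) :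
    dHalfChart (S.incl q₀) (S.incl q) (S.eval (S.incl q) (S.val (S.incl q) (e w))) =
      edgeAnchor Q (halfChart (S.incl q₀) (S.incl q)) w :=
  (h.hasCoeff w).dHalfChart_eq _ hq

/-- For a related defining function, the vector dual to its logarithmic differential is horizontal,
and by normalization it pairs to `1` with the logarithmic differential. -/
theorem Metric.IsRelated.exists_horizontal {g : S.Metric} (hnorm : g.IsNormalized) {x₀ : X → ℝ}
    (hx₀ : IsDefiningOn m X univ x₀) (hrel : g.IsRelated x₀) (q : B) :
    ∃ (θ : Module.Dual ℝ (S.Tangent (S.incl q))) (v : S.Tangent (S.incl q)),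
      S.IsDlog x₀ (S.incl q) θ ∧ IsSharp (g.form (S.incl q)) θ v ∧ S.eval (S.incl q) v = 0 ∧
      θ v = 1 := by
  obtain ⟨θ, v, hθ, hv, v', hv', hvv'⟩ := hrel q
  have hv'0 : v' = 0 := (g.nondegenerate (S.incl q)).1 v' fun w => by
    rw [hv' w, LinearMap.zero_comp]
    rfl
  rw [hv'0, map_zero] at hvv'
  have hev : S.eval (S.incl q) v = 0 := congrArg Subtype.val hvv'.symm
  refine ⟨θ, v, hθ, hv, hev, ?_⟩
  obtain ⟨w, hw, hw1⟩ := hnorm.2 x₀ hx₀ q θ hθ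
  have hvw : (⟨v, hev⟩ : S.horizontal q) - w = 0 := by
    refine (hnorm.1 q).1 _ fun w' => ?_
    rw [map_sub, LinearMap.sub_apply, hw w', sub_eq_zero]
    exact hv w'
  rw [← sub_eq_zero.1 hvw] at hw1
  exact hw1

theorem IsEdgeFrame.isEikonalData (h : S.IsEdgeFrame q₀ r Q e) {g : S.Metric}
    (hnorm : g.IsNormalized) {x₀ : X → ℝ} (hx₀ : IsDefiningOn m X univ x₀) (hrel : g.IsRelated x₀)
    {k : ℝ × EuclideanSpace ℝ (Fin m) → ℝ} (hk : HasFactor (m := m) (S.incl q₀) r x₀ k) :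
    IsEikonalData (W := (ℝ × EuclideanSpace ℝ (Fin m)) →L[ℝ] ℝ) (chartCenter (S.incl q₀)) r
      (g.cogram e q₀) (logForm Q (halfBall (chartCenter (S.incl q₀)) r) k)
      (ContinuousLinearMap.fst ℝ ℝ (EuclideanSpace ℝ (Fin m))) (edgeCovector Q) := by
  have hbd : ∀ q ∈ Metric.ball (chartCenter (m := m) (S.incl q₀)) r,
      ∃ w : ℝ × EuclideanSpace ℝ (Fin m), edgeAnchor Q (0, q) w = 0 ∧
        logForm Q (halfBall (chartCenter (S.incl q₀)) r) k (0, q) w = 1 ∧ ∀ α,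
          g.cogram e q₀ (0, q) (logForm Q (halfBall (chartCenter (S.incl q₀)) r) k (0, q)) α =
            α w := fun q hq => by
    have hy : ((0 : ℝ), q) ∈ halfBall (chartCenter (m := m) (S.incl q₀)) r :=
      ⟨⟨le_rfl, h.pos⟩, hq⟩
    have hx := symm_mem_chartBall h.subset_target hy
    have hψ := (halfChart (S.incl q₀)).right_inv (h.subset_target hy)
    have hb : (halfChart (S.incl q₀)).symm (0, q) ∈ (𝓡∂ (m + 1)).boundary X := by
      rw [mem_boundary_iff_halfChart hx.1, hψ]
    rw [← S.range_incl] at hb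
    obtain ⟨q', hq'⟩ := hb
    obtain ⟨θ, v, hθ, hv, hev, hv1⟩ := hrel.exists_horizontal hnorm hx₀ q'
    have hx' : S.incl q' ∈ chartBall m (S.incl q₀) r := hq' ▸ hx
    have hψ' : halfChart (S.incl q₀) (S.incl q') = (0, q) := by rw [hq', hψ]
    obtain ⟨w, rfl⟩ := h.surjective hx' v
    have hθ' := (h.isDlog_iff hk hx').1 hθ
    rw [hψ'] at hθ'
    refine ⟨w, ?_, by rw [← hθ', hv1], fun α => ?_⟩
    · rw [← hψ', ← dHalfChart_eval h hx', hev, map_zero]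
    · rw [Metric.cogram, dualForm_apply, ← hq', (h.isSharp_iff g hx' hθ').1 hv]
  refine ⟨h.pos, h.contDiffOn_cogram g, h.contDiffOn_logForm hk, ?_,
    fun y hy => h.cogram_symm g hy, fun q hq => ?_, fun q hq η => ?_, fun q hq => ?_⟩
  · exact contDiffOn_const.clm_apply (contDiffOn_const.clm_comp (contDiffOn_edgeAnchor h.contDiffOn))
  · obtain ⟨w, -, hw1, hw⟩ := hbd q hq
    rw [hw, hw1]
  · obtain ⟨w, hw0, -, hw⟩ := hbd q hq
    rw [hw, edgeCovector_apply, hw0]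
    exact map_zero η
  · obtain ⟨w, hw0, hw1, hw⟩ := hbd q hq
    rw [hw, ← hw1, logForm]
    simp [hw0]

end EdgeManifold

namespace EdgeManifold

variable {m b f : ℕ} {X B Y F : Type*}
  [TopologicalSpace X] [ChartedSpace (EuclideanHalfSpace (m + 1)) X]
  [IsManifold (𝓡∂ (m + 1)) ∞ X]
  [TopologicalSpace B] [ChartedSpace (EuclideanSpace ℝ (Fin m)) B] [IsManifold (𝓡 m) ∞ B]
  [TopologicalSpace Y] [ChartedSpace (EuclideanSpace ℝ (Fin b)) Y] [IsManifold (𝓡 b) ∞ Y]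
  [TopologicalSpace F] [ChartedSpace (EuclideanSpace ℝ (Fin f)) F] [IsManifold (𝓡 f) ∞ F]
  {S : EdgeManifold m b f X B Y F}
  {q₀ : B} {r : ℝ}
  {Q : EuclideanSpace ℝ (Fin m) → EuclideanSpace ℝ (Fin m) →L[ℝ] EuclideanSpace ℝ (Fin m)}
  {e : (ℝ × EuclideanSpace ℝ (Fin m)) →ₗ[ℝ] S.edgeFields}

theorem IsEdgeFrame.eikonal_iff (h : S.IsEdgeFrame q₀ r Q e) (g : S.Metric) {x : X → ℝ}
    {k : ℝ × EuclideanSpace ℝ (Fin m) → ℝ} (hk : HasFactor (m := m) (S.incl q₀) r x k) {z : X}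
    (hz : z ∈ chartBall m (S.incl q₀) r) :
    (∃ θ : Module.Dual ℝ (S.Tangent z), S.IsDlog x z θ ∧ IsNormSq (g.form z) θ 1) ↔
      g.cogram e q₀ (halfChart (S.incl q₀) z)
        (logForm Q (halfBall (chartCenter (S.incl q₀)) r) k (halfChart (S.incl q₀) z))
        (logForm Q (halfBall (chartCenter (S.incl q₀)) r) k (halfChart (S.incl q₀) z)) = 1 := by
  constructor
  · rintro ⟨θ, hθ, hn⟩
    exact (h.isNormSq_iff g hz ((h.isDlog_iff hk hz).1 hθ)).1 hn
  · intro hn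
    obtain ⟨θ, hθ⟩ := h.exists_dual hz
      (logForm Q (halfBall (chartCenter (S.incl q₀)) r) k (halfChart (S.incl q₀) z))
    exact ⟨θ, (h.isDlog_iff hk hz).2 hθ, (h.isNormSq_iff g hz hθ).2 hn⟩

variable (m S) in
/-- `x` is a defining function on `U` which solves the eikonal equation and agrees with `x₀` to
second order at the boundary. -/
structure IsLocalSolution (g : S.Metric) (x₀ : X → ℝ) (U : Set X) (x : X → ℝ) : Prop where
  isDefiningOn : IsDefiningOn m X U x
  eikonal : g.SolvesEikonalOn U x
  isBigO : ∀ p ∈ U, p ∈ (𝓡∂ (m + 1)).boundary X →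
    (fun r => x r - x₀ r) =O[𝓝 p] (fun r => x₀ r ^ 2)

theorem IsLocalSolution.mono {g : S.Metric} {x₀ x : X → ℝ} {U V : Set X}
    (h : S.IsLocalSolution m g x₀ U x) (hV : V ⊆ U) : S.IsLocalSolution m g x₀ V x :=
  ⟨h.1.mono hV, fun p hp => h.2 p (hV hp), fun p hp => h.3 p (hV hp)⟩

theorem IsDlog.congr {x x' : X → ℝ} {p : X} {θ : Module.Dual ℝ (S.Tangent p)}
    (h : S.IsDlog x p θ) (hx : x' =ᶠ[𝓝 p] x) : S.IsDlog x' p θ := fun ξ => by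
  refine (h ξ).congr' ?_
  filter_upwards [mem_nhdsWithin_of_mem_nhds (eventually_eventually_nhds.2 hx)] with r hr
  rw [dif, dif, Filter.EventuallyEq.mfderiv_eq hr, Filter.EventuallyEq.eq_of_nhds hr]

theorem IsLocalSolution.congr {g : S.Metric} {x₀ x x' : X → ℝ} {U : Set X} (hU : IsOpen U)
    (h : S.IsLocalSolution m g x₀ U x) (hx : EqOn x' x U) : S.IsLocalSolution m g x₀ U x' := by
  have hev : ∀ p ∈ U, x' =ᶠ[𝓝 p] x := fun p hp => hx.eventuallyEq_of_mem (hU.mem_nhds hp)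
  refine ⟨⟨h.1.1.congr hx, fun p hp hp' => ?_, fun p hp hp' => ?_, fun p hp hp' => ?_⟩,
    fun p hp => ?_, fun p hp hp' => ?_⟩
  · rw [hx hp]
    exact h.1.pos p hp hp'
  · rw [hx hp]
    exact h.1.eq_zero p hp hp'
  · rw [(hev p hp).mfderiv_eq]
    exact h.1.mfderiv_ne_zero p hp hp'
  · obtain ⟨θ, hθ, hn⟩ := h.eikonal p hp
    exact ⟨θ, hθ.congr (hev p hp), hn⟩
  · exact (h.isBigO p hp hp').congr' ((hev p hp).symm.sub EventuallyEq.rfl) EventuallyEq.rfl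

theorem IsLocalSolution.of_local {g : S.Metric} {x₀ x : X → ℝ} {U : Set X}
    (h : ∀ p ∈ U, ∃ V, IsOpen V ∧ p ∈ V ∧ S.IsLocalSolution m g x₀ V x) :
    S.IsLocalSolution m g x₀ U x := by
  choose! V hVo hpV hV using h
  exact ⟨⟨fun p hp => ((hV p hp).1.1.contMDiffAt ((hVo p hp).mem_nhds (hpV p hp))).contMDiffWithinAt,
    fun p hp => (hV p hp).1.2 p (hpV p hp), fun p hp => (hV p hp).1.3 p (hpV p hp),
    fun p hp => (hV p hp).1.4 p (hpV p hp)⟩, fun p hp => (hV p hp).2 p (hpV p hp),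
    fun p hp => (hV p hp).3 p (hpV p hp)⟩

theorem HasFactor.congr {p : X} {x : X → ℝ} {k k' : ℝ × EuclideanSpace ℝ (Fin m) → ℝ}
    (h : HasFactor (m := m) p r x k)
    (hk : ∀ y ∈ halfBall (chartCenter (m := m) p) r, k' y = k y) : HasFactor (m := m) p r x k' :=
  ⟨h.1.congr hk, fun y hy => by rw [hk y hy]; exact h.2 y hy,
    fun z hz => by rw [hk _ hz.2]; exact h.3 z hz⟩

/-- A frame and a factorization of the given defining function on a common half ball. -/
theorem exists_isEdgeFrame_hasFactor [T2Space X] (q₀ : B) {x₀ : X → ℝ}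
    (hx₀ : IsDefiningOn m X univ x₀) :
    ∃ r Q e k, S.IsEdgeFrame q₀ r Q e ∧ HasFactor (m := m) (S.incl q₀) r x₀ k := by
  obtain ⟨r₀, Q, hQ⟩ := S.exists_isEdgeChart q₀
  obtain ⟨r₁, hr₁, -, e, he⟩ := hQ.exists_isEdgeFrame
  obtain ⟨r₂, hr₂, -, k, hk⟩ := hx₀.exists_hasFactor (S.incl_mem_boundary q₀) univ_mem
  exact ⟨min r₁ r₂, Q, e, k, he.mono (lt_min hr₁ hr₂) (min_le_left _ _), hk.mono (min_le_right _ _)⟩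

/-- Near a boundary point, a defining function that agrees with `x₀` to second order is
`x₀ e^{x u}`, with `u` smooth. -/
theorem IsLocalSolution.exists_factor {g : S.Metric} {x₀ x : X → ℝ} {U : Set X} (hU : IsOpen U)
    (hx : S.IsLocalSolution m g x₀ U x) (hq : S.incl q₀ ∈ U) (h : S.IsEdgeFrame q₀ r Q e)
    {k : ℝ × EuclideanSpace ℝ (Fin m) → ℝ} (hk : HasFactor (m := m) (S.incl q₀) r x₀ k) :
    ∃ r' > 0, r' ≤ r ∧ chartBall m (S.incl q₀) r' ⊆ U ∧ ∃ u,
      ContDiffOn ℝ ∞ u (halfBall (chartCenter (m := m) (S.incl q₀)) r') ∧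
      HasFactor (m := m) (S.incl q₀) r' x (fun y => k y * Real.exp (y.1 * u y)) := by
  obtain ⟨r₁, hr₁, hr₁U, k₁, hk₁⟩ :=
    hx.isDefiningOn.exists_hasFactor (S.incl_mem_boundary q₀) (hU.mem_nhds hq)
  have hr' : 0 < min r r₁ := lt_min h.pos hr₁
  have hsub : chartBall m (S.incl q₀) (min r r₁) ⊆ U :=
    (chartBall_mono _ (min_le_right _ _)).trans hr₁U
  have hk₁' := hk₁.mono (min_le_right r r₁)
  obtain ⟨u, hu, hu'⟩ := hk₁'.exists_eq_mul_exp hr'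
    ((halfBall_mono (min_le_left _ _)).trans h.subset_target) (hk.mono (min_le_left r r₁))
    fun z hz hz0 => hx.isBigO z (hsub hz) hz0
  exact ⟨min r r₁, hr', min_le_left _ _, hsub, u, hu, hk₁'.congr fun y hy => (hu' y hy).symm⟩

theorem IsLocalSolution.isDlog [T2Space X] {g : S.Metric} {x₀ x : X → ℝ}
    (hx₀ : IsDefiningOn m X univ x₀) {U : Set X} (hU : IsOpen U)
    (hx : S.IsLocalSolution m g x₀ U x) (hq : S.incl q₀ ∈ U)
    {θ : Module.Dual ℝ (S.Tangent (S.incl q₀))} (hθ : S.IsDlog x₀ (S.incl q₀) θ) :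
    S.IsDlog x (S.incl q₀) θ := by
  obtain ⟨r, Q, e, k, h, hk⟩ := S.exists_isEdgeFrame_hasFactor q₀ hx₀
  obtain ⟨r', hr', hle, -, u, hu, hu'⟩ := hx.exists_factor hU hq h hk
  have h' := h.mono hr' hle
  have hk' := hk.mono hle
  have hp := mem_chartBall_self (S.incl_mem_boundary q₀) hr'
  have h1 := (h'.isDlog_iff hk' hp).1 hθ
  refine (h'.isDlog_iff hu' hp).2 fun v => ?_
  rw [h1, logForm_mul_exp_boundary (uniqueDiffOn_halfBall _ hr') hk'.contDiffOn hu hp.2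
    (hk'.pos _ hp.2) ((mem_boundary_iff_halfChart hp.1).1 (S.incl_mem_boundary q₀))]

/-- The eikonal equation in the form to which the uniqueness theorem on half balls applies. -/
theorem IsLocalSolution.cogram_eq_one {g : S.Metric} {x₀ x : X → ℝ} {U : Set X}
    (hx : S.IsLocalSolution m g x₀ U x) (h : S.IsEdgeFrame q₀ r Q e)
    (hsub : chartBall m (S.incl q₀) r ⊆ U) {k u : ℝ × EuclideanSpace ℝ (Fin m) → ℝ}
    (hk : HasFactor (m := m) (S.incl q₀) r x₀ k)
    (hu : HasFactor (m := m) (S.incl q₀) r x (fun y => k y * Real.exp (y.1 * u y))) :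
    ∀ y ∈ halfBall (chartCenter (m := m) (S.incl q₀)) r, 0 < y.1 →
      ∀ (σ : ℝ) (η : EuclideanSpace ℝ (Fin m) →L[ℝ] ℝ),
      HasFDerivAt (fun y : ℝ × EuclideanSpace ℝ (Fin m) => y.1 * u y)
        (σ • ContinuousLinearMap.fst ℝ ℝ (EuclideanSpace ℝ (Fin m)) +
          y.1 • η.comp (ContinuousLinearMap.snd ℝ ℝ (EuclideanSpace ℝ (Fin m)))) y →
      g.cogram e q₀ y
        (logForm Q (halfBall (chartCenter (S.incl q₀)) r) k y +
          y.1 • (σ • ContinuousLinearMap.fst ℝ ℝ (EuclideanSpace ℝ (Fin m)) + edgeCovector Q y η))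
        (logForm Q (halfBall (chartCenter (S.incl q₀)) r) k y +
          y.1 • (σ • ContinuousLinearMap.fst ℝ ℝ (EuclideanSpace ℝ (Fin m)) + edgeCovector Q y η))
        = 1 := by
  intro y hy hy0 σ η hσ
  have hz := symm_mem_chartBall h.subset_target hy
  have h1 := (h.eikonal_iff g hu hz).1 (hx.eikonal _ (hsub hz))
  rw [(halfChart (S.incl q₀)).right_inv (h.subset_target hy),
    logForm_mul_exp (uniqueDiffOn_halfBall _ h.pos) hk.contDiffOn hy (hk.pos y hy)
      hσ.hasFDerivWithinAt, comp_edgeAnchor_eq] at h1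
  exact h1

theorem IsLocalSolution.eventuallyEq [T2Space X] {g : S.Metric} (hnorm : g.IsNormalized)
    {x₀ x₁ x₂ : X → ℝ} (hx₀ : IsDefiningOn m X univ x₀) (hrel : g.IsRelated x₀) {U : Set X}
    (hU : IsOpen U) (hx₁ : S.IsLocalSolution m g x₀ U x₁) (hx₂ : S.IsLocalSolution m g x₀ U x₂)
    (hq : S.incl q₀ ∈ U) : x₁ =ᶠ[𝓝 (S.incl q₀)] x₂ := by
  obtain ⟨r, Q, e, k, h, hk⟩ := S.exists_isEdgeFrame_hasFactor q₀ hx₀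
  obtain ⟨r₁, hr₁, hle₁, hs₁, u₁, hu₁, hu₁'⟩ := hx₁.exists_factor hU hq h hk
  obtain ⟨r₂, hr₂, hle₂, hs₂, u₂, hu₂, hu₂'⟩ := hx₂.exists_factor hU hq (h.mono hr₁ hle₁)
    (hk.mono hle₁)
  have h' := (h.mono hr₁ hle₁).mono hr₂ hle₂
  have hk' := (hk.mono hle₁).mono hle₂
  obtain ⟨r', hr', hle', heq⟩ := (h'.isEikonalData hnorm hx₀ hrel hk').eq_of_solution
    (hu₁.mono (halfBall_mono hle₂)) hu₂ (hx₁.cogram_eq_one h' hs₂ hk' (hu₁'.mono hle₂))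
    (hx₂.cogram_eq_one h' hs₂ hk' hu₂')
  filter_upwards [chartBall_mem_nhds (S.incl_mem_boundary q₀) hr'] with z hz
  rw [(hu₁'.mono (hle'.trans hle₂)).eq z hz, (hu₂'.mono hle').eq z hz, heq _ hz.2]

theorem exists_isLocalSolution [T2Space X] {g : S.Metric} (hnorm : g.IsNormalized)
    {x₀ : X → ℝ} (hx₀ : IsDefiningOn m X univ x₀) (hrel : g.IsRelated x₀) (q₀ : B) :
    ∃ U x, IsOpen U ∧ S.incl q₀ ∈ U ∧ S.IsLocalSolution m g x₀ U x := by
  obtain ⟨r, Q, e, k, h, hk⟩ := S.exists_isEdgeFrame_hasFactor q₀ hx₀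
  obtain ⟨r', hr', hle, u, hu, hsol⟩ := (h.isEikonalData hnorm hx₀ hrel hk).exists_solution
  have h' := h.mono hr' hle
  have hk' := hk.mono hle
  set c := chartCenter (m := m) (S.incl q₀) with hc
  let x : X → ℝ := fun z => (halfChart (m := m) (S.incl q₀) z).1 *
    (k (halfChart (S.incl q₀) z) * Real.exp ((halfChart (m := m) (S.incl q₀) z).1 *
      u (halfChart (S.incl q₀) z)))
  have hx : HasFactor (m := m) (S.incl q₀) r' x (fun y => k y * Real.exp (y.1 * u y)) :=
    ⟨hk'.contDiffOn.mul (contDiffOn_fst.mul hu).exp,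
      fun y hy => mul_pos (hk'.pos y hy) (Real.exp_pos _), fun z hz => rfl⟩
  refine ⟨chartBall m (S.incl q₀) r', x, isOpen_chartBall _ _,
    mem_chartBall_self (S.incl_mem_boundary q₀) hr', hx.isDefiningOn, fun z hz => ?_,
    fun z hz hz0 => hx.isBigO_of_eq_mul_exp hr' hk' hu (fun y hy => rfl) hz⟩
  rw [h'.eikonal_iff g hx hz]
  -- the equation holds off the boundary, and at the boundary by continuity
  have hlog := h'.contDiffOn_logForm hx
  have hcont : ContDiffOn ℝ ∞ (fun y => g.cogram e q₀ y
      (logForm Q (halfBall c r') (fun y => k y * Real.exp (y.1 * u y)) y)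
      (logForm Q (halfBall c r') (fun y => k y * Real.exp (y.1 * u y)) y)) (halfBall c r') :=
    ((h'.contDiffOn_cogram g).clm_apply hlog).clm_apply hlog
  refine eqOn_halfBall_of_eqOn_pos hcont.continuousOn (continuousOn_const (c := (1 : ℝ)))
    (fun y hy hy0 => ?_) hz.2
  obtain ⟨σ, η, h1, h2⟩ := hsol y hy hy0
  rw [logForm_mul_exp (uniqueDiffOn_halfBall _ hr') hk'.contDiffOn hy (hk'.pos y hy)
      h2.hasFDerivWithinAt, comp_edgeAnchor_eq, logForm_mono hk.contDiffOn hr' hle hy]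
  exact h1

end EdgeManifold

/-! ### Gluing germs along a closed set -/

/-- Functions on open sets covering a closed set `A`, any two of which have the same germ at each
common point of `A`, are the germs along `A` of a single function. -/
theorem exists_glue_germs {X ι : Type*} [TopologicalSpace X] [NormalSpace X] [ParacompactSpace X]
    {A : Set X} (hA : IsClosed A) {N : ι → Set X} (hN : ∀ i, IsOpen (N i)) (hAN : A ⊆ ⋃ i, N i)
    {Z : Type*} [Nonempty Z] {f : ι → X → Z}
    (hf : ∀ i j, ∀ p ∈ A, p ∈ N i → p ∈ N j → f i =ᶠ[𝓝 p] f j) :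
    ∃ F : X → Z, ∀ i, ∀ p ∈ A, p ∈ N i → F =ᶠ[𝓝 p] f i := by
  classical
  obtain ⟨v, hvo, hAv, hvf, hvN⟩ := precise_refinement_set hA N hN hAN
  obtain ⟨w, hAw, hwo, hwv⟩ := exists_subset_iUnion_closure_subset hA hvo
    (fun x _ => hvf.point_finite x) hAv
  have hcf : LocallyFinite fun i => closure (w i) := hvf.subset hwv
  refine ⟨fun x => if h : ∃ i, x ∈ closure (w i) then f h.choose x else Classical.arbitrary Z,
    fun i p hp hpi => ?_⟩
  obtain ⟨j, hj⟩ := mem_iUnion.1 (hAw hp)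
  have h1 : ∀ᶠ x in 𝓝 p, ∀ i', x ∈ closure (w i') → p ∈ closure (w i') := by
    filter_upwards [hcf.iInter_compl_mem_nhds (fun i => isClosed_closure) p] with x hx i' hi'
    by_contra hpi'
    exact mem_iInter₂.1 hx i' hpi' hi'
  have h2 : ∀ᶠ x in 𝓝 p, ∀ i' ∈ {i' | p ∈ closure (w i')}, f i' x = f i x :=
    (eventually_all_finite (hcf.point_finite p)).2 fun i' hi' =>
      hf i' i p hp (hvN i' (hwv i' hi')) hpi
  filter_upwards [h1, h2, (hwo j).mem_nhds hj] with x hx1 hx2 hx3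
  have hex : ∃ i, x ∈ closure (w i) := ⟨j, subset_closure hx3⟩
  rw [dif_pos hex]
  exact hx2 _ (hx1 _ hex.choose_spec)

end

theorem mainTheorem3 {m b f : ℕ} {X B Y F : Type*}
    [TopologicalSpace X] [T2Space X] [SecondCountableTopology X]
    [ChartedSpace (EuclideanHalfSpace (m + 1)) X] [IsManifold (𝓡∂ (m + 1)) ∞ X]
    [TopologicalSpace B] [ChartedSpace (EuclideanSpace ℝ (Fin m)) B] [IsManifold (𝓡 m) ∞ B]
    [TopologicalSpace Y] [T2Space Y] [SecondCountableTopology Y]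
    [ChartedSpace (EuclideanSpace ℝ (Fin b)) Y] [IsManifold (𝓡 b) ∞ Y]
    [TopologicalSpace F] [T2Space F] [SecondCountableTopology F]
    [ChartedSpace (EuclideanSpace ℝ (Fin f)) F] [IsManifold (𝓡 f) ∞ F]
    (S : EdgeManifold m b f X B Y F) (g : S.Metric) (hexact : g.IsExact)
    (hnorm : g.IsNormalized) (x₀ : X → ℝ) (hx₀ : EdgeManifold.IsDefiningOn m X univ x₀)
    (hrel : g.IsRelated x₀) :
    ∃ (U : Set X) (xh : X → ℝ), IsOpen U ∧ (𝓡∂ (m + 1)).boundary X ⊆ U ∧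
      EdgeManifold.IsDefiningOn m X U xh ∧ g.IsRelated xh ∧ g.SolvesEikonalOn U xh ∧
      (∀ p ∈ (𝓡∂ (m + 1)).boundary X, (fun r => xh r - x₀ r) =O[𝓝 p] (fun r => x₀ r ^ 2)) ∧
      ∀ (U' : Set X) (xh' : X → ℝ), IsOpen U' → (𝓡∂ (m + 1)).boundary X ⊆ U' →
        EdgeManifold.IsDefiningOn m X U' xh' → g.SolvesEikonalOn U' xh' →
        (∀ p ∈ (𝓡∂ (m + 1)).boundary X,
          (fun r => xh' r - x₀ r) =O[𝓝 p] (fun r => x₀ r ^ 2)) →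
        ∃ W : Set X, IsOpen W ∧ (𝓡∂ (m + 1)).boundary X ⊆ W ∧ ∀ r ∈ W, xh' r = xh r := by
  have : NormalSpace X := by
    have : LocallyCompactSpace X := Manifold.locallyCompact_of_finiteDimensional (𝓡∂ (m + 1))
    infer_instance
  have : ParacompactSpace X := by
    have : LocallyCompactSpace X := Manifold.locallyCompact_of_finiteDimensional (𝓡∂ (m + 1))
    infer_instance
  choose N f hN hqN hf using fun q => S.exists_isLocalSolution hnorm hx₀ hrel q
  have hcover : (𝓡∂ (m + 1)).boundary X ⊆ ⋃ q, N q := by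
    rw [← S.range_incl]
    rintro _ ⟨q, rfl⟩
    exact mem_iUnion.2 ⟨q, hqN q⟩
  obtain ⟨xh, hxh⟩ := exists_glue_germs
    ((𝓡∂ (m + 1)).isClosed_boundary (M := X) (n := ∞) (by simp)) hN hcover (f := f) (by
      intro q q' p hp hpq hpq'
      rw [← S.range_incl] at hp
      obtain ⟨q₀, rfl⟩ := hp
      exact ((hf q).mono inter_subset_left).eventuallyEq hnorm hx₀ hrel ((hN q).inter (hN q'))
        ((hf q').mono inter_subset_right) ⟨hpq, hpq'⟩)
  have hloc : ∀ q, ∃ V, IsOpen V ∧ S.incl q ∈ V ∧ S.IsLocalSolution m g x₀ V xh := fun q => by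
    obtain ⟨V, hV, hVo, hqV⟩ := eventually_nhds_iff.1 (hxh q _ (S.incl_mem_boundary q) (hqN q))
    exact ⟨V ∩ N q, hVo.inter (hN q), ⟨hqV, hqN q⟩,
      ((hf q).mono inter_subset_right).congr (hVo.inter (hN q)) fun x hx => hV x hx.1⟩
  set U : Set X := ⋃₀ {V | IsOpen V ∧ S.IsLocalSolution m g x₀ V xh} with hUdef
  have hU : IsOpen U := isOpen_sUnion fun V hV => hV.1
  have hbU : (𝓡∂ (m + 1)).boundary X ⊆ U := by
    rw [← S.range_incl]
    rintro _ ⟨q, rfl⟩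
    obtain ⟨V, hVo, hqV, hV⟩ := hloc q
    exact mem_sUnion.2 ⟨V, ⟨hVo, hV⟩, hqV⟩
  have hsol : S.IsLocalSolution m g x₀ U xh := EdgeManifold.IsLocalSolution.of_local fun p hp => by
    obtain ⟨V, ⟨hVo, hV⟩, hpV⟩ := mem_sUnion.1 hp
    exact ⟨V, hVo, hpV, hV⟩
  refine ⟨U, xh, hU, hbU, hsol.isDefiningOn, fun q => ?_, hsol.eikonal,
    fun p hp => hsol.isBigO p (hbU hp) hp, fun U' xh' hU' hbU' hdef heik hO => ?_⟩
  · obtain ⟨θ, v, hθ, hv⟩ := hrel q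
    exact ⟨θ, v, hsol.isDlog hx₀ hU (hbU (S.incl_mem_boundary q)) hθ, hv⟩
  · have hsol' : S.IsLocalSolution m g x₀ U' xh' := ⟨hdef, heik, fun p _ hp => hO p hp⟩
    refine ⟨interior {r | xh' r = xh r}, isOpen_interior, fun p hp => ?_,
      fun r hr => (interior_subset hr : r ∈ {r | xh' r = xh r})⟩
    rw [mem_interior_iff_mem_nhds]
    have hpU : p ∈ U ∩ U' := ⟨hbU hp, hbU' hp⟩
    rw [← S.range_incl] at hp
    obtain ⟨q, rfl⟩ := hp
    exact (hsol'.mono inter_subset_right).eventuallyEq hnorm hx₀ hrel (hU.inter hU')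
      (hsol.mono inter_subset_left) hpU
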